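/- **Setting.** There are $m$ bidders and $n$ items. A valuation is a function $v:2^{[n]}\to[0,\infty)$ with $v(\emptyset)=0$ (neither monotonicity nor subadditivity is needed). Bidders are risk neutral and quasi-linear, and bidder $j$'s valuation is drawn independently from a probability distribution $D_j$; $D=\times_j D_j$. A mechanism $M$ maps each reported profile to a lottery over allocations of disjoint bundles and to a payment for every bidder. For a report $t$ of bidder $j$, let $\phi_j(t)$ be her random bundle and $p_j(t)$ her expected payment, over the randomness of $M$ and the others' truthful reports drawn from $D_{-j}$; write $v(\phi_j(t))$ for the expected value. Let $T_j$ be a set of types with $D_j(T_j)=1$. $M$ is *BIC* for $D$ on $(T_j)$ if $v(\phi_j(v))-p_j(v)\ge v(\phi_j(t))-p_j(t)$, and *individually rational (IR)* if $v(\phi_j(v))-p_j(v)\ge 0$, for all $j$ and $v,t\in T_j$. It is *well posed* if it is measurable, $p_j(t)$ is a finite expectation for every $t\in T_j$, and the negative part of each bidder's payment has finite expectation under truthful play; $\mathrm{Rev}^M(D)\in(-\infty,\infty]$ is the expected total payment under truthful play. Let $D^+=\times_jD_j^+$ be another product distribution that dominates $D$: for each $j$ there is a coupling of $v_j^+\sim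 D_j^+$ and $v_j\sim D_j$ with $v_j^+(S)\ge v_j(S)$ for all $S$ almost surely. Fix such couplings, let $\delta_j$ be the law of $v_j^+-v_j$, and put $$\mathrm{Val}(\delta)=\mathbb E\Big[\max_{S_1,\dots,S_m\text{ pairwise disjoint}}\ \sum_j d_j(S_j)\Big]\in[0,\infty],\qquad d_j\sim\delta_j\text{ independent}.$$ **Mechanism $M'_{r}$** (for $r\ge1$ and $\varepsilon\in(0,1)$). Let $M^\varepsilon$ be $M$ with all payments multiplied by $1-\varepsilon$, with interim outcomes $\phi_j^\varepsilon,p_j^\varepsilon$. *Phase 1.* For each bidder $j$ draw independently $r-1$ replicas from $D_j^+$ and $r$ surrogates from $D_j$. Form the complete bipartite graph with bidder $j$ (with her reported type) and her replicas on the left and the surrogates on the right, where the edge between a left type $\rho$ and a surrogate $s$ has weight $\rho(\phi^\varepsilon_j(s))-p^\varepsilon_j(s)$. Take a maximum-weight (not necessarily perfect) matching, and assign the unmatched left nodes uniformly at random to the unmatched surrogates, one to each; ties are broken by choosing uniformly among all pairs (maximum-weight matching, completion to a perfect matching). *Phase 2.* The surrogates assigned to the $m$ bidders play $M^\varepsilon$.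 A bidder who was matched by the maximum-weight matching receives her surrogate's bundle and pays her surrogate's payment plus her VCG price, namely the maximum weight of a matching not using her node minus the weight that the other left nodes get in the chosen matching. Every other bidder gets nothing and pays nothing. **Theorem.** Let $D^+$ dominate $D$ as above, let $M$ be well posed, BIC and IR for $D$ on $(T_j)$, and let $\varepsilon\in(0,1)$. Then for every $r\ge1$ the mechanism $M'_r$ is well posed, BIC and IR for $D^+$, on the space of all valuations, and $$\liminf_{r\to\infty}\mathrm{Rev}^{M'_r}(D^+)\ \ge\ (1-\varepsilon)\Big(\mathrm{Rev}^M(D)-\frac{\mathrm{Val}(\delta)}{\varepsilon}\Big),$$ in the extended reals (the bound is read as $-\infty$ if $\mathrm{Val}(\delta)=\infty$). -/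

import Mathlib

open MeasureTheory

noncomputable section

/-- A valuation on `n` items: a nonnegative set function that vanishes on the empty bundle.
Neither monotonicity nor subadditivity is imposed. -/
abbrev BidderValuation (n : ℕ) : Type :=
  {v : Finset (Fin n) → ℝ // v ∅ = 0 ∧ ∀ S, 0 ≤ v S}

/-- A profile of valuations, one for each of the `m` bidders. -/
abbrev Profile (m n : ℕ) : Type := Fin m → BidderValuation n

/-- A feasible allocation: pairwise disjoint bundles (items may stay unsold). -/
abbrev Allocation (m n : ℕ) : Type :=
  {a : Fin m → Finset (Fin n) // ∀ i j, i ≠ j → Disjoint (a i) (a j)}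

/-- A (randomized, direct-revelation) mechanism for risk-neutral quasi-linear bidders.
`lottery v a` is the probability that the allocation is `a` when the reported profile is `v`, and
`pay v j` is the payment of bidder `j` at that profile, averaged over the mechanism's own coins. -/
structure Mechanism (m n : ℕ) where
  lottery : Profile m n → Allocation m n → ℝ
  pay : Profile m n → Fin m → ℝ

namespace Mechanism

variable {m n : ℕ}

/-- Expected value, to a bidder `j` with valuation `v`, of what she is allocated when she reports
`t` and the other bidders report truthfully (the coordinate `j` of the sampled profile is
overwritten by `t`). This is `v(φ_j(t))`. -/
def interimValue (M : Mechanism m n) (D : Fin m → Measure (BidderValuation n)) (j : Fin m)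
    (v t : BidderValuation n) : ℝ :=
  ∫ w, ∑ a, M.lottery (Function.update w j t) a * v.1 (a.1 j) ∂(Measure.pi D)

/-- Expected price `p_j(t)` of bidder `j` when reporting `t`, the others being truthful. -/
def interimPay (M : Mechanism m n) (D : Fin m → Measure (BidderValuation n)) (j : Fin m)
    (t : BidderValuation n) : ℝ :=
  ∫ w, M.pay (Function.update w j t) j ∂(Measure.pi D)

/-- `M` is a well-posed mechanism for bidders with independent types `v_j ∼ D j` and sets of
admissible reports `T j`: outcomes are lotteries over feasible allocations, everything is
measurable, interim prices are finite, and the revenue is well defined in `(-∞, ∞]`. -/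
structure IsWellPosed (M : Mechanism m n) (D : Fin m → Measure (BidderValuation n))
    (T : Fin m → Set (BidderValuation n)) : Prop where
  lottery_mem : ∀ v, M.lottery v ∈ stdSimplex ℝ (Allocation m n)
  measurable_lottery : ∀ a, Measurable fun v => M.lottery v a
  measurable_pay : ∀ j, Measurable fun v => M.pay v j
  integrable_pay : ∀ j, ∀ t ∈ T j,
    Integrable (fun w => M.pay (Function.update w j t) j) (Measure.pi D)
  lintegral_neg_pay : ∀ j, ∫⁻ v, ENNReal.ofReal (-(M.pay v j)) ∂(Measure.pi D) < ⊤

/-- Bayesian incentive compatibility on the type spaces `T j`. -/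
def IsBIC (M : Mechanism m n) (D : Fin m → Measure (BidderValuation n))
    (T : Fin m → Set (BidderValuation n)) : Prop :=
  ∀ j, ∀ v ∈ T j, ∀ t ∈ T j,
    M.interimValue D j v t - M.interimPay D j t ≤ M.interimValue D j v v - M.interimPay D j v

/-- (Interim) individual rationality on the type spaces `T j`. -/
def IsIR (M : Mechanism m n) (D : Fin m → Measure (BidderValuation n))
    (T : Fin m → Set (BidderValuation n)) : Prop :=
  ∀ j, ∀ v ∈ T j, 0 ≤ M.interimValue D j v v - M.interimPay D j v

/-- Expected total payment under truthful play, as an extended real number. -/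
def revenue (M : Mechanism m n) (D : Fin m → Measure (BidderValuation n)) : EReal :=
  ((∫⁻ v, ENNReal.ofReal (∑ j, M.pay v j) ∂(Measure.pi D) : ENNReal) : EReal) -
    ((∫⁻ v, ENNReal.ofReal (-∑ j, M.pay v j) ∂(Measure.pi D) : ENNReal) : EReal)

/-- The mechanism `M` with all prices multiplied by `c`. -/
def scalePrices (M : Mechanism m n) (c : ℝ) : Mechanism m n where
  lottery := M.lottery
  pay v j := c * M.pay v j

end Mechanism

/-- `C` is a coupling of `Dp` (first coordinate) and `D` (second coordinate) under which the first
valuation is almost surely at least the second one on every bundle. -/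
structure IsDominatingCoupling {n : ℕ} (C : Measure (BidderValuation n × BidderValuation n))
    (Dp D : Measure (BidderValuation n)) : Prop where
  map_fst : C.map Prod.fst = Dp
  map_snd : C.map Prod.snd = D
  le : ∀ᵐ c ∂C, ∀ S, c.2.1 S ≤ c.1.1 S

/-- The law of the random set function `v⁺ - v` under a coupling of `v⁺` and `v`. -/
def differenceLaw {n : ℕ} (C : Measure (BidderValuation n × BidderValuation n)) :
    Measure (Finset (Fin n) → ℝ) :=
  C.map fun c S => c.1.1 S - c.2.1 S

/-- `Val`: the expected maximum welfare over feasible allocations when bidder `j` has a random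
set function (nonnegative, zero on the empty bundle) with law `δ j`, independently. -/
def expectedWelfare {m n : ℕ} (δ : Fin m → Measure (Finset (Fin n) → ℝ)) : ENNReal :=
  ∫⁻ d, ENNReal.ofReal (⨆ a : Allocation m n, ∑ j, d j (a.1 j)) ∂(Measure.pi δ)

/-! ### Maximum-weight matchings and VCG prices in a bipartite graph with weights `w` -/

/-- A matching between two copies of `Fin r`, together with a completion to a perfect matching:
the left nodes in `μ.2` are matched, along `μ.1`; the left nodes outside `μ.2` are assigned by
`μ.1` to the right nodes that the matching leaves over. -/
abbrev CompletedMatching (r : ℕ) : Type := Equiv.Perm (Fin r) × Finset (Fin r)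

/-- The weight of a matching; completing edges do not count. -/
def matchingWeight {r : ℕ} (w : Fin r → Fin r → ℝ) (μ : CompletedMatching r) : ℝ :=
  ∑ i ∈ μ.2, w i (μ.1 i)

/-- The maximum-weight matchings, with all their completions. A uniformly random element is a
maximum-weight matching with a uniformly random completion. -/
def maxMatchings {r : ℕ} (w : Fin r → Fin r → ℝ) : Finset (CompletedMatching r) :=
  {μ | ∀ ν, matchingWeight w ν ≤ matchingWeight w μ}

/-- The maximum weight of a matching that leaves the left node `i` unmatched. -/
def maxWeightWithout {r : ℕ} (w : Fin r → Fin r → ℝ) (i : Fin r) : ℝ :=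
  ({ν | i ∉ ν.2} : Finset (CompletedMatching r)).sup' ⟨(1, ∅), by simp⟩ (matchingWeight w)

/-- The VCG price of a left node `i` that is matched in `μ`: the maximum total weight of the other
left nodes if `i` were absent, minus their total weight in `μ`. -/
def vcgPrice {r : ℕ} (w : Fin r → Fin r → ℝ) (μ : CompletedMatching r) (i : Fin r) : ℝ :=
  maxWeightWithout w i - ∑ l ∈ μ.2.erase i, w l (μ.1 l)

/-! ### The replica–surrogate mechanism -/

/-- The random types drawn in phase 1 for one bidder: `k` replicas and `k + 1` surrogates. -/
abbrev Draw (k n : ℕ) : Type := (Fin k → BidderValuation n) × (Fin (k + 1) → BidderValuation n)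

/-- The law of the draws for all bidders: replicas of bidder `j` i.i.d. from `Dp j`, surrogates
i.i.d. from `D j`, everything independent. -/
def drawLaw {m n : ℕ} (D Dp : Fin m → Measure (BidderValuation n)) (k : ℕ) :
    Measure (Fin m → Draw k n) :=
  Measure.pi fun j =>
    (Measure.pi fun _ : Fin k => Dp j).prod (Measure.pi fun _ : Fin (k + 1) => D j)

/-- Edge weights of the graph of bidder `j` when she reports `t` and `x` was drawn. The left nodes
are the bidder (node `0`) and her replicas, the right nodes are the surrogates; the weight of an
edge is the utility of the left type for the interim outcome of `Mε` at the surrogate's report. -/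
def edgeWeight {m n k : ℕ} (Mε : Mechanism m n) (D : Fin m → Measure (BidderValuation n))
    (j : Fin m)
    (t : BidderValuation n) (x : Draw k n) (i l : Fin (k + 1)) : ℝ :=
  Mε.interimValue D j ((Fin.cons t x.1 : Fin (k + 1) → BidderValuation n) i) (x.2 l)
    - Mε.interimPay D j (x.2 l)

/-- The surrogate profile: bidder `j` is represented by the surrogate assigned to her. -/
def surrogateProfile {m n k : ℕ} (x : Fin m → Draw k n)
    (μ : Fin m → CompletedMatching (k + 1)) : Profile m n :=
  fun j => (x j).2 ((μ j).1 0)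

/-- Award bundles only to the bidders in `B`; the others get nothing. -/
def restrictAllocation {m n : ℕ} (B : Finset (Fin m)) (b : Allocation m n) : Allocation m n :=
  ⟨fun j => if j ∈ B then b.1 j else ∅, fun i j hij => by
    have := b.2 i j hij
    dsimp only
    split_ifs <;> simp [this]⟩

/-- The bidders that are matched to their surrogate by the VCG matching. -/
def matchedBidders {m k : ℕ} (μ : Fin m → CompletedMatching (k + 1)) : Finset (Fin m) :=
  {j | 0 ∈ (μ j).2}

/-- The VCG matchings that can be selected, one for each bidder. -/
def vcgMatchings {m n k : ℕ} (Mε : Mechanism m n) (D : Fin m → Measure (BidderValuation n))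
    (v : Profile m n) (x : Fin m → Draw k n) : Finset (Fin m → CompletedMatching (k + 1)) :=
  Fintype.piFinset fun j => maxMatchings (edgeWeight Mε D j (v j) (x j))

/-- The replica–surrogate mechanism with `r = k + 1` surrogates per bidder, built from `M`.
Replicas and surrogates are drawn; each bidder's maximum-weight matching is chosen uniformly at
random and completed uniformly at random; the surrogates assigned to the bidders play `M` with all
prices multiplied by `1 - ε`; a bidder matched by VCG gets her surrogate's bundle and pays her
surrogate's price plus her VCG price; any other bidder gets and pays nothing. -/
def replicaSurrogate {m n : ℕ} (M : Mechanism m n) (D Dp : Fin m → Measure (BidderValuation n))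
    (ε : ℝ) (k : ℕ) : Mechanism m n where
  lottery v a :=
    ∫ x, (vcgMatchings (M.scalePrices (1 - ε)) D v x).expect (fun μ =>
      ∑ b with restrictAllocation (matchedBidders μ) b = a,
        (M.scalePrices (1 - ε)).lottery (surrogateProfile x μ) b) ∂(drawLaw D Dp k)
  pay v j :=
    ∫ x, (vcgMatchings (M.scalePrices (1 - ε)) D v x).expect (fun μ =>
      if j ∈ matchedBidders μ then
        vcgPrice (edgeWeight (M.scalePrices (1 - ε)) D j (v j) (x j)) (μ j) 0
          + (M.scalePrices (1 - ε)).pay (surrogateProfile x μ) j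
      else 0) ∂(drawLaw D Dp k)

end

/-!
The replica–surrogate mechanism inherits incentives from VCG and revenue from `M`.

*Incentives.* If the left types of a bidder's graph are i.i.d., then by exchangeability the right
node assigned to a fixed left node is distributed like every right node (`map_partner_eq`). So the
surrogate of a truthful bidder has law `D i`, and since the graphs of different bidders are
independent (`map_bidderStates`), bidder `j` with surrogate `s` faces a profile of other surrogates
drawn from `D`: conditionally on her graph and matching she gets the interim outcome of `Mε` at `s`
(`average_eq_integral_stateLaw`). Edge weights are utilities for exactly these outcomes, whence her
expected utility is the one of her node in the VCG mechanism for the matching problem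
(`replicaSurrogate_utility`), which is truthful and individually rational (`vcg_utility_le`,
`vcg_utility_eq`). For a fixed report payments are integrable, even if `D` has infinite mean, because
the VCG price and the surrogate's interim price together never exceed the value of the outcome to
the reported valuation (`stateVcgPrice_add_le`).

*Revenue.* VCG prices are nonnegative, so a bidder pays on average at least `1 - ε` times the interim
price of her surrogate, if she is matched (`integral_stateSurrogatePay_le`); by exchangeability this
is the average over all left nodes. To compare it with the average price of all surrogates, draw
the left types from the coupling: each left type `v⁺` has a shadow `v` of law `D j`. Shadows and
surrogates are then samples from the same law, and for large `r` all but a small fraction of the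
surrogates can be paired with almost equal shadows (`exists_classPairing`,
`integral_abs_count_sub_le`). For a paired shadow, truthfulness of `M` makes her surrogate a best
match, up to the excess value `v⁺ - v` of the outcome, and the discount makes every other surrogate
less attractive in proportion to `ε` times how much less it pays. Optimality of the matching,
tested on alternating chains, therefore bounds the price lost on unmatched surrogates by
the total excess of the matched nodes over `ε`, plus small errors (`sum_good_sub_sum_matched_le`).
The surrogates of all bidders form a profile drawn from `D` and share one feasible allocation, so
the expected excesses of the bidders add up to at most `Val(δ)` (`sum_lintegral_slotExcess_le`).

Interim prices need not be integrable, and the few unpaired surrogates could be expensive; prices of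
surrogates are therefore truncated at a level `N` first, and the truncated averages recover the
revenue as `N → ∞` (`exists_lt_sum_integral_truncatedPay`). A mechanism with a payment that is not
integrable has infinite revenue (`revenue_eq_top`), so in the bound for the replica–surrogate
mechanism its payments may be assumed to be integrable.
-/


set_option linter.unusedSectionVars false

/-! ### Maximum-weight matchings and VCG prices -/

section Matching

variable {r : ℕ}

lemma mem_maxMatchings {w : Fin r → Fin r → ℝ} {μ : CompletedMatching r} :
    μ ∈ maxMatchings w ↔ ∀ ν, matchingWeight w ν ≤ matchingWeight w μ := by
  simp [maxMatchings]

lemma maxMatchings_nonempty (w : Fin r → Fin r → ℝ) : (maxMatchings w).Nonempty := by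
  obtain ⟨μ, hμ⟩ := Finite.exists_max (matchingWeight w)
  exact ⟨μ, mem_maxMatchings.2 hμ⟩

lemma matchingWeight_le_maxWeightWithout (w : Fin r → Fin r → ℝ) {i : Fin r}
    {ν : CompletedMatching r} (hν : i ∉ ν.2) :
    matchingWeight w ν ≤ maxWeightWithout w i :=
  Finset.le_sup' (matchingWeight w) (by simpa using hν)

lemma maxWeightWithout_le {w : Fin r → Fin r → ℝ} {μ : CompletedMatching r}
    (hμ : μ ∈ maxMatchings w) (i : Fin r) : maxWeightWithout w i ≤ matchingWeight w μ :=
  Finset.sup'_le _ _ fun ν _ => mem_maxMatchings.1 hμ ν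

lemma maxWeightWithout_congr {w w' : Fin r → Fin r → ℝ} {i : Fin r}
    (h : ∀ l, l ≠ i → w l = w' l) : maxWeightWithout w i = maxWeightWithout w' i := by
  refine Finset.sup'_congr _ rfl fun ν hν => Finset.sum_congr rfl fun l hl => ?_
  rw [h l]
  rintro rfl
  simp_all

lemma vcgPrice_nonneg (w : Fin r → Fin r → ℝ) (μ : CompletedMatching r) (i : Fin r) :
    0 ≤ vcgPrice w μ i :=
  sub_nonneg.2 (matchingWeight_le_maxWeightWithout w (ν := (μ.1, μ.2.erase i)) (by simp))

lemma vcgPrice_le {w : Fin r → Fin r → ℝ} {μ : CompletedMatching r} (hμ : μ ∈ maxMatchings w)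
    {i : Fin r} (hi : i ∈ μ.2) : vcgPrice w μ i ≤ w i (μ.1 i) := by
  have h1 := maxWeightWithout_le hμ i
  have h2 := Finset.add_sum_erase μ.2 (fun l => w l (μ.1 l)) hi
  simp only [matchingWeight, vcgPrice] at *
  linarith

/-- The utility of left node `i` under VCG when all weights are reported truthfully is her
marginal contribution to the maximum weight. -/
lemma vcg_utility_eq {w : Fin r → Fin r → ℝ} {μ : CompletedMatching r} (hμ : μ ∈ maxMatchings w)
    (i : Fin r) :
    (if i ∈ μ.2 then w i (μ.1 i) - vcgPrice w μ i else 0)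
      = matchingWeight w μ - maxWeightWithout w i := by
  split_ifs with hi
  · have h2 := Finset.add_sum_erase μ.2 (fun l => w l (μ.1 l)) hi
    simp only [matchingWeight, vcgPrice] at *
    linarith
  · have h1 := maxWeightWithout_le hμ i
    have h2 := matchingWeight_le_maxWeightWithout w hi
    linarith

/-- VCG is truthful: if `w` and `w'` differ only in the row of `i`, then a left node `i` whose true
row is that of `w'` gets from any matching that is priced by `w` at most the utility that she
obtains from truthful play. -/
lemma vcg_utility_le {w w' : Fin r → Fin r → ℝ} {μ : CompletedMatching r}
    (hμ : μ ∈ maxMatchings w') {i : Fin r} (h : ∀ l, l ≠ i → w l = w' l)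
    (ν : CompletedMatching r) :
    (if i ∈ ν.2 then w' i (ν.1 i) - vcgPrice w ν i else 0)
      ≤ matchingWeight w' μ - maxWeightWithout w' i := by
  split_ifs with hi
  · have h1 := mem_maxMatchings.1 hμ ν
    have h2 := Finset.add_sum_erase ν.2 (fun l => w' l (ν.1 l)) hi
    have h3 : ∑ l ∈ ν.2.erase i, w l (ν.1 l) = ∑ l ∈ ν.2.erase i, w' l (ν.1 l) :=
      Finset.sum_congr rfl fun l hl => by rw [h l (Finset.ne_of_mem_erase hl)]
    have h4 := maxWeightWithout_congr h
    simp only [matchingWeight, vcgPrice] at *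
    linarith
  · exact sub_nonneg.2 (maxWeightWithout_le hμ i)

/-- Relabelling the left nodes of a matching along `σ`. -/
def relabel (σ : Equiv.Perm (Fin r)) : Equiv.Perm (CompletedMatching r) :=
  (Equiv.mulRight σ).prodCongr (σ.symm.finsetCongr)

@[simp] lemma relabel_fst (σ : Equiv.Perm (Fin r)) (μ : CompletedMatching r) (i : Fin r) :
    (relabel σ μ).1 i = μ.1 (σ i) := rfl

@[simp] lemma mem_relabel_snd (σ : Equiv.Perm (Fin r)) (μ : CompletedMatching r) (i : Fin r) :
    i ∈ (relabel σ μ).2 ↔ σ i ∈ μ.2 := by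
  simp only [relabel, Equiv.prodCongr_apply, Prod.map_snd, Equiv.finsetCongr_apply,
    Finset.mem_map_equiv, Equiv.symm_symm]

lemma matchingWeight_relabel (w : Fin r → Fin r → ℝ) (σ : Equiv.Perm (Fin r))
    (μ : CompletedMatching r) :
    matchingWeight (fun i => w (σ i)) (relabel σ μ) = matchingWeight w μ := by
  refine Finset.sum_equiv σ (fun i => mem_relabel_snd σ μ i) fun i _ => by simp

lemma maxMatchings_relabel (w : Fin r → Fin r → ℝ) (σ : Equiv.Perm (Fin r)) :
    maxMatchings (fun i => w (σ i)) = (maxMatchings w).map (relabel σ).toEmbedding := by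
  ext μ
  obtain ⟨μ, rfl⟩ := (relabel σ).surjective μ
  simp only [mem_maxMatchings, matchingWeight_relabel,
    Finset.mem_map_equiv, Equiv.symm_apply_apply]
  constructor
  · intro h ν
    have := h (relabel σ ν)
    rwa [matchingWeight_relabel] at this
  · intro h ν
    obtain ⟨ν, rfl⟩ := (relabel σ).surjective ν
    rw [matchingWeight_relabel]
    exact h ν

/-- A partial injection between the nodes is a matching, and has a completion. -/
lemma exists_completedMatching (s : Finset (Fin r)) (f : Fin r → Fin r)
    (hf : Set.InjOn f s) : ∃ μ : CompletedMatching r, μ.2 = s ∧ ∀ i ∈ s, μ.1 i = f i := by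
  obtain ⟨g, hg⟩ := Finset.exists_equiv_extend_of_card_eq (t := Finset.univ) (by simp)
    (Finset.subset_univ (s.image f)) hf
  exact ⟨(g.trans (Equiv.subtypeUnivEquiv (by simp)), s), rfl, fun i hi => hg i hi⟩

/-- The set that is reached from the `good` elements outside `A` by iterating `g`, where `g` is only
applied on `dom` and the iteration ends when it leaves `good`. -/
inductive Reached {α : Type*} (A good : Set α) (dom : Set α) (g : α → α) : α → Prop
  | base {l : α} (h : l ∈ good) (hA : l ∉ A) : Reached A good dom g l
  | step {l : α} (h : Reached A good dom g l) (hd : l ∈ dom) (hg : g l ∈ good) :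
      Reached A good dom g (g l)

/-- The deterministic heart of the revenue bound. Let `μ` be a maximum-weight matching, and let the
right nodes `l` in `good` have partners `β l` on the left such that the row of `β l` is, up to an
error `κ` and a nonnegative excess `d`, that of a node to which `l` is the best match
(with utility `u l ≥ 0`), all right nodes being discounted by a fraction `ε` of their price `p`.
Rerouting `μ` along the alternating chains `l, μ (β l), …` that start at the unmatched good nodes
cannot increase the weight, and therefore bounds the total price of the unmatched good nodes by
what is collected at the bad ends of the chains, the excess and the error. -/
lemma sum_good_sub_sum_matched_le {w : Fin r → Fin r → ℝ} {μ : CompletedMatching r}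
    (hμ : μ ∈ maxMatchings w) (p u : Fin r → ℝ) (d : Fin r → Fin r → ℝ) (hd : ∀ i l, 0 ≤ d i l)
    (hu : ∀ l, 0 ≤ u l) {κ ε : ℝ} (hκ : 0 ≤ κ) (hε : 0 ≤ ε) (good : Finset (Fin r))
    (β : Fin r → Fin r) (hβ : Set.InjOn β good)
    (lower : ∀ l ∈ good, u l - κ + ε * p l ≤ w (β l) l)
    (upper : ∀ l ∈ good, ∀ l', w (β l) l' ≤ u l + κ + d (β l) l' + ε * p l') :
    ε * (∑ l ∈ good, p l - ∑ l ∈ goodᶜ, max (-p l) 0 - ∑ i ∈ μ.2, p (μ.1 i))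
      ≤ 2 * κ * r + ∑ i ∈ μ.2, d i (μ.1 i) := by
  classical
  set M : Finset (Fin r) := μ.2.image μ.1 with hM
  have hMmem : ∀ i, μ.1 i ∈ M ↔ i ∈ μ.2 := fun i => by simp [hM]
  set g : Fin r → Fin r := fun l => μ.1 (β l) with hg
  -- `M` is the set of matched right nodes, and `X` is the set of good nodes on the chains.
  let X : Finset (Fin r) :=
    {l | Reached (M : Set (Fin r)) (good : Set (Fin r)) {l | β l ∈ μ.2} g l}
  have memX : ∀ l, l ∈ X ↔ Reached (M : Set (Fin r)) (good : Set (Fin r)) {l | β l ∈ μ.2} g l :=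
    fun l => by simp [X]
  have hXgood : X ⊆ good := by
    intro l hl
    rw [memX] at hl
    cases hl with
    | base h _ => exact h
    | step _ _ h => exact h
  have hXstart : good \ M ⊆ X := by
    intro l hl
    rw [memX]
    rw [Finset.mem_sdiff] at hl
    exact .base hl.1 hl.2
  -- The nodes of `Xm` have a matched partner, who gives up her right node when she is rematched.
  set Xm : Finset (Fin r) := {l ∈ X | β l ∈ μ.2} with hXm
  have hXstep : ∀ l ∈ Xm, g l ∈ good → g l ∈ X := by
    intro l hl h
    simp only [hXm, Finset.mem_filter] at hl
    rw [memX]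
    exact .step ((memX l).1 hl.1) hl.2 h
  have hXM : ∀ l ∈ X, l ∈ M → ∃ l' ∈ Xm, l = g l' := by
    intro l hl hlM
    rw [memX] at hl
    cases hl with
    | base _ h => exact absurd hlM h
    | @step l' h hd _ => exact ⟨l', by simp [hXm, memX, h]; exact hd, rfl⟩
  have hβX : Set.InjOn β X := hβ.mono (by exact_mod_cast hXgood)
  -- Partners of nodes on the chains are rematched along `β`, all other nodes keep their match.
  let inv : Fin r → Fin r := fun i => if h : ∃ l ∈ X, β l = i then h.choose else μ.1 i
  have inv_β : ∀ l ∈ X, inv (β l) = l := by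
    intro l hl
    have h : ∃ l' ∈ X, β l' = β l := ⟨l, hl, rfl⟩
    simp only [inv, dif_pos h]
    exact hβX h.choose_spec.1 hl h.choose_spec.2
  set Y : Finset (Fin r) := X.image β with hY
  have inv_not : ∀ i, i ∉ Y → inv i = μ.1 i := by
    intro i hi
    have h : ¬ ∃ l ∈ X, β l = i := by simpa [hY] using hi
    simp only [inv, dif_neg h]
  have hinj : Set.InjOn inv (Y ∪ (μ.2 \ Y) : Finset (Fin r)) := by
    have key : ∀ l ∈ X, ∀ i, i ∈ μ.2 → i ∉ Y → l ≠ μ.1 i := by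
      intro l hl i hi hiY h
      obtain ⟨l', hl', h'⟩ := hXM l hl (by rw [h, hMmem]; exact hi)
      rw [h] at h'
      have := μ.1.injective h'
      apply hiY
      rw [this]
      exact Finset.mem_image_of_mem _ (Finset.mem_filter.1 hl').1
    intro i hi i' hi' h
    simp only [Finset.coe_union, Finset.coe_sdiff, Set.mem_union, Finset.mem_coe, Set.mem_sdiff]
      at hi hi'
    rcases hi with hi | hi <;> rcases hi' with hi' | hi'
    · obtain ⟨l, hl, rfl⟩ := Finset.mem_image.1 hi
      obtain ⟨l', hl', rfl⟩ := Finset.mem_image.1 hi'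
      rw [inv_β l hl, inv_β l' hl'] at h
      rw [h]
    · obtain ⟨l, hl, rfl⟩ := Finset.mem_image.1 hi
      rw [inv_β l hl, inv_not i' hi'.2] at h
      exact absurd h (key l hl i' hi'.1 hi'.2)
    · obtain ⟨l, hl, rfl⟩ := Finset.mem_image.1 hi'
      rw [inv_β l hl, inv_not i hi.2] at h
      exact absurd h.symm (key l hl i hi.1 hi.2)
    · rw [inv_not i hi.2, inv_not i' hi'.2] at h
      exact μ.1.injective h
  obtain ⟨ν, hν2, hν1⟩ := exists_completedMatching _ inv hinj
  have hopt := mem_maxMatchings.1 hμ ν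
  have hWν : matchingWeight w ν = ∑ l ∈ X, w (β l) l + ∑ i ∈ μ.2 \ Y, w i (μ.1 i) := by
    unfold matchingWeight
    rw [hν2, Finset.sum_union Finset.disjoint_sdiff, hY, Finset.sum_image hβX]
    congr 1
    · refine Finset.sum_congr rfl fun l hl => ?_
      rw [hν1 _ (by rw [hY]; exact Finset.mem_union_left _ (Finset.mem_image_of_mem _ hl)),
        inv_β l hl]
    · refine Finset.sum_congr rfl fun i hi => ?_
      rw [hν1 _ (Finset.mem_union_right _ hi), inv_not i (Finset.mem_sdiff.1 hi).2]
  have hβXm : Set.InjOn β Xm := hβX.mono (by exact_mod_cast Finset.filter_subset _ _)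
  have hWμ : matchingWeight w μ = ∑ l ∈ Xm, w (β l) (g l) + ∑ i ∈ μ.2 \ Y, w i (μ.1 i) := by
    unfold matchingWeight
    rw [← Finset.sum_inter_add_sum_sdiff μ.2 Y]
    congr 1
    have : μ.2 ∩ Y = Xm.image β := by
      ext i
      simp only [hXm, hY, Finset.mem_inter, Finset.mem_image, Finset.mem_filter]
      constructor
      · rintro ⟨h, l, hl, rfl⟩; exact ⟨l, ⟨hl, h⟩, rfl⟩
      · rintro ⟨l, ⟨hl, h⟩, rfl⟩; exact ⟨h, l, hl, rfl⟩
    rw [this, Finset.sum_image hβXm]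
  have h1 : ∑ l ∈ X, w (β l) l ≤ ∑ l ∈ Xm, w (β l) (g l) := by linarith
  have h2 : ∑ l ∈ X, (u l - κ + ε * p l) ≤ ∑ l ∈ X, w (β l) l :=
    Finset.sum_le_sum fun l hl => lower l (hXgood hl)
  have hXmX : Xm ⊆ X := Finset.filter_subset _ _
  have h3 : ∑ l ∈ Xm, w (β l) (g l) ≤ ∑ l ∈ Xm, (u l + κ + d (β l) (g l) + ε * p (g l)) :=
    Finset.sum_le_sum fun l hl => upper l (hXgood (hXmX hl)) _
  -- By `hu`, ending a chain at an unmatched partner only helps.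
  have h4 : ∑ l ∈ Xm, u l ≤ ∑ l ∈ X, u l :=
    Finset.sum_le_sum_of_subset_of_nonneg hXmX fun l _ _ => hu l
  have h5 : ∑ l ∈ Xm, d (β l) (g l) ≤ ∑ i ∈ μ.2, d i (μ.1 i) := by
    rw [← Finset.sum_image (f := fun i => d i (μ.1 i)) hβXm]
    refine Finset.sum_le_sum_of_subset_of_nonneg ?_ fun i _ _ => hd _ _
    intro i hi
    obtain ⟨l, hl, rfl⟩ := Finset.mem_image.1 hi
    exact (Finset.mem_filter.1 hl).2
  have hcard : ∀ s : Finset (Fin r), ∑ l ∈ s, κ ≤ κ * r := by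
    intro s
    rw [Finset.sum_const, nsmul_eq_mul, mul_comm]
    have : (s.card : ℝ) ≤ r := by
      exact_mod_cast (Finset.card_le_univ s).trans_eq (Fintype.card_fin r)
    gcongr
  have h6 := hcard X
  have h7 := hcard Xm
  simp only [Finset.sum_add_distrib, Finset.sum_sub_distrib, ← Finset.mul_sum] at h2 h3
  have h8 : ε * (∑ l ∈ X, p l - ∑ l ∈ Xm, p (g l)) ≤ 2 * κ * r + ∑ i ∈ μ.2, d i (μ.1 i) := by
    linarith
  refine le_trans (mul_le_mul_of_nonneg_left ?_ hε) h8
  -- `Z` is the set of nodes released by the partners of `X`. The nodes in `X` but not in `Z` are the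
  -- starts of the chains; the nodes in `Z` but not in `X` are their ends at nodes that are not good.
  set Z : Finset (Fin r) := Xm.image g with hZ
  have hgXm : Set.InjOn g Xm := fun a ha b hb h => hβXm ha hb (μ.1.injective h)
  have hpZ : ∑ l ∈ Xm, p (g l) = ∑ l ∈ Z, p l := by rw [hZ, Finset.sum_image hgXm]
  have hpM : ∑ i ∈ μ.2, p (μ.1 i) = ∑ l ∈ M, p l := by
    rw [hM, Finset.sum_image μ.1.injective.injOn]
  have hZM : Z ⊆ M := by
    intro l hl
    obtain ⟨l', hl', rfl⟩ := Finset.mem_image.1 hl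
    rw [hMmem]
    exact (Finset.mem_filter.1 hl').2
  have e1 : X \ Z = good \ M := by
    ext l
    simp only [Finset.mem_sdiff]
    constructor
    · rintro ⟨hl, hlZ⟩
      refine ⟨hXgood hl, fun hlM => hlZ ?_⟩
      obtain ⟨l', hl', rfl⟩ := hXM l hl hlM
      exact Finset.mem_image_of_mem _ hl'
    · rintro ⟨hl, hlM⟩
      exact ⟨hXstart (by simp [hl, hlM]), fun h => hlM (hZM h)⟩
  have e2 : Z \ X ⊆ M \ good := by
    intro l hl
    obtain ⟨hlZ, hlX⟩ := Finset.mem_sdiff.1 hl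
    refine Finset.mem_sdiff.2 ⟨hZM hlZ, fun h => hlX ?_⟩
    obtain ⟨l', hl', rfl⟩ := Finset.mem_image.1 hlZ
    exact hXstep l' hl' h
  have f1 := Finset.sum_inter_add_sum_sdiff X Z p
  have f2 := Finset.sum_inter_add_sum_sdiff Z X p
  have f3 := Finset.sum_inter_add_sum_sdiff good M p
  have f4 := Finset.sum_inter_add_sum_sdiff M good p
  rw [Finset.inter_comm] at f2 f4
  have f5 : ∑ l ∈ Z \ X, p l ≤ ∑ l ∈ M \ good, p l + ∑ l ∈ goodᶜ, max (-p l) 0 := by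
    calc ∑ l ∈ Z \ X, p l ≤ ∑ l ∈ Z \ X, (p l + max (-p l) 0) :=
          Finset.sum_le_sum fun l _ => le_add_of_nonneg_right (le_max_right _ _)
      _ ≤ ∑ l ∈ M \ good, (p l + max (-p l) 0) := by
          refine Finset.sum_le_sum_of_subset_of_nonneg e2 fun l _ _ => ?_
          linarith [le_max_left (-p l) 0]
      _ ≤ _ := by
          rw [Finset.sum_add_distrib]
          gcongr
          exact fun l hl => Finset.mem_compl.2 (Finset.mem_sdiff.1 hl).2
  rw [hpZ, hpM]
  rw [e1] at f1
  linarith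

end Matching

/-! ### Uniform random choices from finite sets, and product measures -/

section UniformChoice

open ProbabilityTheory

variable {Y U : Type*} [MeasurableSpace Y] [Fintype U] [MeasurableSpace U]
  [MeasurableSingletonClass U]

lemma integral_uniformOn (a : Finset U) (f : U → ℝ) :
    ∫ u, f u ∂(uniformOn (a : Set U)) = a.expect f := by
  classical
  rw [integral_fintype Integrable.of_finite, Finset.expect_eq_sum_div_card, Finset.sum_div,
    ← Finset.sum_subset (Finset.subset_univ a)]
  · refine Finset.sum_congr rfl fun u hu => ?_
    rw [measureReal_def, ← Finset.coe_singleton, uniformOn_apply_finset]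
    simp [hu, div_eq_inv_mul]
  · intro u _ hu
    rw [measureReal_def, ← Finset.coe_singleton, uniformOn_apply_finset]
    simp [hu]

lemma lintegral_uniformOn (a : Finset U) (f : U → ENNReal) :
    ∫⁻ u, f u ∂(uniformOn (a : Set U)) = (∑ u ∈ a, f u) / a.card := by
  classical
  rw [lintegral_fintype, ← Finset.sum_subset (Finset.subset_univ a)]
  · simp_rw [div_eq_mul_inv, Finset.sum_mul]
    refine Finset.sum_congr rfl fun u hu => ?_
    rw [← Finset.coe_singleton, uniformOn_apply_finset]
    simp [hu]
  · intro u _ hu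
    rw [← Finset.coe_singleton, uniformOn_apply_finset]
    simp [hu]

/-- The kernel that picks a uniformly random element of a finite set depending on the state. -/
noncomputable def uniformChoice (A : Y → Finset U) (hA : Measurable A) : Kernel Y U :=
  (Kernel.ofFunOfCountable fun a : Finset U => uniformOn (a : Set U)).comap A hA

lemma uniformChoice_apply (A : Y → Finset U) (hA : Measurable A) (y : Y) :
    uniformChoice A hA y = uniformOn (A y : Set U) := rfl

instance (A : Y → Finset U) (hA : Measurable A) : IsFiniteKernel (uniformChoice A hA) :=
  ⟨1, ENNReal.one_lt_top, fun y => by rw [uniformChoice_apply]; exact prob_le_one⟩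

lemma isMarkovKernel_uniformChoice {A : Y → Finset U} (hA : Measurable A)
    (h : ∀ y, (A y).Nonempty) : IsMarkovKernel (uniformChoice A hA) :=
  ⟨fun y => by
    rw [uniformChoice_apply]
    exact isProbabilityMeasure_uniformOn (A y).finite_toSet (by simpa using h y)⟩

/-- A uniform choice is transported along a map that preserves the measure and the choice set. -/
lemma map_compProd_uniformChoice {Y' : Type*} [MeasurableSpace Y'] {ν : Measure Y}
    {ν' : Measure Y'} [SFinite ν] [SFinite ν'] {A : Y → Finset U} (hA : Measurable A)
    {A' : Y' → Finset U} (hA' : Measurable A') {T : Y → Y'} (hT : MeasurePreserving T ν ν')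
    (h : ∀ y, A' (T y) = A y) :
    (ν.compProd (uniformChoice A hA)).map (fun z => (T z.1, z.2))
      = ν'.compProd (uniformChoice A' hA') := by
  have hm : Measurable fun z : Y × U => (T z.1, z.2) :=
    (hT.measurable.comp measurable_fst).prodMk measurable_snd
  refine Measure.ext_of_lintegral _ fun f hf => ?_
  rw [lintegral_map hf hm, Measure.lintegral_compProd (by fun_prop),
    Measure.lintegral_compProd hf, ← hT.lintegral_comp (by fun_prop)]
  simp_rw [uniformChoice_apply, h]

end UniformChoice

section Pi

variable {ι : Type*} [Fintype ι] [DecidableEq ι]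

/-- Resampling one coordinate of a vector with independent coordinates. -/
lemma map_update_prod_pi {α : ι → Type*} [∀ i, MeasurableSpace (α i)]
    (ν : ∀ i, Measure (α i)) [∀ i, IsProbabilityMeasure (ν i)] (j : ι) :
    ((ν j).prod (Measure.pi ν)).map (fun q => Function.update q.2 j q.1) = Measure.pi ν := by
  refine (Measure.pi_eq fun s hs => ?_).symm
  have hm : Measurable fun q : α j × (∀ i, α i) => Function.update q.2 j q.1 :=
    measurable_pi_iff.2 fun i => by
      by_cases h : i = j
      · subst h; simpa using measurable_fst
      · simp only [Function.update_of_ne h]; fun_prop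
  rw [Measure.map_apply hm (.univ_pi hs)]
  have : (fun q : α j × (∀ i, α i) => Function.update q.2 j q.1) ⁻¹' (Set.univ.pi s)
      = s j ×ˢ Set.univ.pi (Function.update s j Set.univ) := by
    ext q
    simp only [Set.mem_preimage, Set.mem_univ_pi, Set.mem_prod]
    constructor
    · intro h
      refine ⟨by simpa using h j, fun i => ?_⟩
      by_cases hi : i = j
      · subst hi; simp
      · simpa [hi] using h i
    · rintro ⟨h1, h2⟩ i
      by_cases hi : i = j
      · subst hi; simpa using h1
      · simpa [hi] using h2 i
  rw [this, Measure.prod_prod, Measure.pi_pi,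
    ← Finset.mul_prod_erase Finset.univ _ (Finset.mem_univ j),
    ← Finset.mul_prod_erase Finset.univ (fun i => ν i (s i)) (Finset.mem_univ j)]
  simp only [Function.update_self, measure_univ, one_mul]
  congr 1
  refine Finset.prod_congr rfl fun i hi => ?_
  rw [Function.update_of_ne (Finset.ne_of_mem_erase hi)]

variable {α : Type*} [MeasurableSpace α]

lemma measurable_update_pair (j : ι) :
    Measurable fun q : α × (ι → α) => Function.update q.2 j q.1 :=
  measurable_pi_iff.2 fun i => by
    by_cases h : i = j
    · subst h; simpa using measurable_fst
    · simp only [Function.update_of_ne h]; fun_prop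

instance isProbabilityMeasure_update_dirac (ν : ι → Measure α) [∀ i, IsProbabilityMeasure (ν i)]
    (j : ι) (t : α) (i : ι) :
    IsProbabilityMeasure (Function.update ν j (Measure.dirac t) i) := by
  by_cases h : i = j
  · subst h; simp only [Function.update_self]; infer_instance
  · simp only [Function.update_of_ne h]; infer_instance

lemma map_update_pi (ν : ι → Measure α) [∀ i, IsProbabilityMeasure (ν i)] (j : ι) (t : α) :
    (Measure.pi ν).map (fun w => Function.update w j t)
      = Measure.pi (Function.update ν j (Measure.dirac t)) := by
  have h1 : (fun w : ι → α => Function.update w j t)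
      = fun w i => (if i = j then fun _ => t else id : α → α) (w i) := by
    ext w i
    by_cases h : i = j
    · subst h; simp
    · simp [h]
  have hm : ∀ i, Measurable (if i = j then fun _ => t else id : α → α) := fun i => by
    split_ifs
    · exact measurable_const
    · exact measurable_id
  have := fun i => Measure.isProbabilityMeasure_map (μ := ν i) (hm i).aemeasurable
  rw [h1, Measure.pi_map_pi fun i => (hm i).aemeasurable]
  congr 1
  ext1 i
  by_cases h : i = j
  · subst h; simp [Measure.map_const]
  · simp [h, Measure.map_id]

/-- If the coordinates `ω i` are independent and `h` turns each of them, except possibly the one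
of `j`, into a variable with law `ν i`, then from the point of view of `ω j` the vector `h ∘ ω` is
a vector with law `pi ν` whose coordinate `j` has been overwritten by `h (ω j)`. -/
lemma map_eval_comp_pi {Ω : Type*} [MeasurableSpace Ω] (γ : ι → Measure Ω)
    [∀ i, IsProbabilityMeasure (γ i)] (ν : ι → Measure α) [∀ i, IsProbabilityMeasure (ν i)]
    {h : Ω → α} (hh : Measurable h) (j : ι) (hν : ∀ i, i ≠ j → (γ i).map h = ν i) :
    (Measure.pi γ).map (fun ω => (ω j, fun i => h (ω i)))
      = ((γ j).prod (Measure.pi ν)).map (fun q => (q.1, Function.update q.2 j (h q.1))) := by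
  have hprob : ∀ i, IsProbabilityMeasure ((γ i).map h) :=
    fun i => Measure.isProbabilityMeasure_map hh.aemeasurable
  have hm1 : Measurable fun ω : ι → Ω => (ω j, fun i => h (ω i)) := by fun_prop
  have hm2 : Measurable fun q : Ω × (ι → α) => (q.1, Function.update q.2 j (h q.1)) :=
    measurable_fst.prodMk ((measurable_update_pair j).comp
      ((hh.comp measurable_fst).prodMk measurable_snd))
  have hm3 : Measurable fun z : ι → Ω => fun i => h (z i) := by fun_prop
  refine Measure.ext_of_lintegral _ fun f hf => ?_
  rw [lintegral_map hf hm1, lintegral_map hf hm2]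
  conv_lhs => rw [← map_update_prod_pi γ j]
  have hf1 : Measurable fun ω : ι → Ω => f (ω j, fun i => h (ω i)) := hf.comp hm1
  have hf1' : Measurable fun q : Ω × (ι → Ω) =>
      f (Function.update q.2 j q.1 j, fun i => h (Function.update q.2 j q.1 i)) :=
    hf1.comp (measurable_update_pair j)
  have hf2 : Measurable fun q : Ω × (ι → α) => f (q.1, Function.update q.2 j (h q.1)) :=
    hf.comp hm2
  rw [lintegral_map hf1 (measurable_update_pair j),
    lintegral_prod _ hf1'.aemeasurable,
    lintegral_prod _ hf2.aemeasurable]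
  refine lintegral_congr fun y => ?_
  have e : ∀ z : ι → Ω, (fun i => h (Function.update z j y i))
      = Function.update (fun i => h (z i)) j (h y) := fun z => by
    ext i
    by_cases hi : i = j
    · subst hi; simp
    · simp [hi]
  have hg : Measurable fun w : ι → α => f (y, w) := by fun_prop
  have hu : Measurable fun w : ι → α => Function.update w j (h y) :=
    (measurable_update_pair j).comp (measurable_const.prodMk measurable_id)
  have hgu : Measurable fun w : ι → α => f (y, Function.update w j (h y)) := hg.comp hu
  calc ∫⁻ z, f (Function.update z j y j, fun i => h (Function.update z j y i)) ∂(Measure.pi γ)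
      = ∫⁻ z, f (y, Function.update (fun i => h (z i)) j (h y)) ∂(Measure.pi γ) := by
        simp_rw [e, Function.update_self]
    _ = ∫⁻ w, f (y, w) ∂((Measure.pi fun i => (γ i).map h).map
          (fun w => Function.update w j (h y))) := by
        rw [lintegral_map hg hu, ← Measure.pi_map_pi (fun i => hh.aemeasurable),
          lintegral_map hgu hm3]
    _ = ∫⁻ w, f (y, w) ∂((Measure.pi ν).map (fun w => Function.update w j (h y))) := by
        rw [map_update_pi, map_update_pi]
        congr 2
        ext1 i
        by_cases hi : i = j
        · subst hi; simp
        · simp [hi, hν i hi]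
    _ = _ := by rw [lintegral_map hg hu]

/-- A product of functions of independent coordinates integrates to the product. -/
lemma lintegral_pi_prod {α : ι → Type*} [∀ i, MeasurableSpace (α i)]
    (ν : ∀ i, Measure (α i)) [∀ i, IsProbabilityMeasure (ν i)] {f : ∀ i, α i → ENNReal}
    (hf : ∀ i, Measurable (f i)) :
    ∫⁻ x, ∏ i, f i (x i) ∂(Measure.pi ν) = ∏ i, ∫⁻ a, f i a ∂(ν i) := by
  have hind := ProbabilityTheory.iIndepFun_pi (μ := ν) (X := f) fun i => (hf i).aemeasurable
  rw [ProbabilityTheory.lintegral_prod_eq_prod_lintegral_of_indepFun Finset.univ _ hind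
    fun i => (hf i).comp (measurable_pi_apply i)]
  refine Finset.prod_congr rfl fun i _ => ?_
  exact (measurePreserving_eval ν i).lintegral_comp (hf i)

end Pi

/-! ### The random matching in a random weighted graph -/

section VcgLaw

instance {r : ℕ} : MeasurableSpace (Equiv.Perm (Fin r)) := ⊤

instance {r : ℕ} : DiscreteMeasurableSpace (Equiv.Perm (Fin r)) := ⟨fun _ => trivial⟩

variable {Y : Type*} [MeasurableSpace Y] {r : ℕ}

lemma measurable_maxMatchings {w : Y → Fin r → Fin r → ℝ} (hw : Measurable w) :
    Measurable fun y => maxMatchings (w y) := by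
  have hwt : ∀ ν : CompletedMatching r, Measurable fun y => matchingWeight (w y) ν := fun ν => by
    unfold matchingWeight; fun_prop
  refine measurable_finset_iff.2 fun μ => measurableSet_setOfPred.1 ?_
  have : {y | μ ∈ maxMatchings (w y)}
      = ⋂ ν, {y | matchingWeight (w y) ν ≤ matchingWeight (w y) μ} := by
    ext y; simp [mem_maxMatchings]
  rw [this]
  exact .iInter fun ν => measurableSet_le (hwt ν) (hwt μ)

lemma measurable_vcgPrice {w : Y → Fin r → Fin r → ℝ} (hw : Measurable w)
    (μ : CompletedMatching r) (i : Fin r) : Measurable fun y => vcgPrice (w y) μ i := by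
  have hwt : ∀ ν : CompletedMatching r, Measurable fun y => matchingWeight (w y) ν := fun ν => by
    unfold matchingWeight; fun_prop
  have h1 : Measurable fun y => maxWeightWithout (w y) i := by
    have h2 : (fun y => maxWeightWithout (w y) i)
        = ({ν | i ∉ ν.2} : Finset (CompletedMatching r)).sup' ⟨(1, ∅), by simp⟩
          (fun ν y => matchingWeight (w y) ν) := by
      funext y
      exact (Finset.sup'_apply (C := fun _ : Y => ℝ) ⟨(1, ∅), by simp⟩
        (fun ν y => matchingWeight (w y) ν) y).symm
    rw [h2]
    exact Finset.measurable_sup' _ fun ν _ => hwt ν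
  exact h1.sub (Finset.measurable_sum _ fun l _ => by fun_prop)

/-- The law of a random weighted graph, with state `y` of law `ν` and weights `w y`, together with
a uniformly random element of its completed maximum-weight matchings. -/
noncomputable def vcgLaw (ν : Measure Y) {w : Y → Fin r → Fin r → ℝ} (hw : Measurable w) :
    Measure (Y × CompletedMatching r) :=
  ν.compProd (uniformChoice (fun y => maxMatchings (w y)) (measurable_maxMatchings hw))

instance (ν : Measure Y) [IsProbabilityMeasure ν] {w : Y → Fin r → Fin r → ℝ} (hw : Measurable w) :
    IsProbabilityMeasure (vcgLaw ν hw) := by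
  have := isMarkovKernel_uniformChoice (measurable_maxMatchings hw)
    fun y => maxMatchings_nonempty (w y)
  unfold vcgLaw
  infer_instance

lemma lintegral_vcgLaw (ν : Measure Y) [SFinite ν] {w : Y → Fin r → Fin r → ℝ} (hw : Measurable w)
    {f : Y × CompletedMatching r → ENNReal} (hf : Measurable f) :
    ∫⁻ z, f z ∂(vcgLaw ν hw)
      = ∫⁻ y, (∑ μ ∈ maxMatchings (w y), f (y, μ)) / (maxMatchings (w y)).card ∂ν := by
  rw [vcgLaw, Measure.lintegral_compProd hf]
  simp_rw [uniformChoice_apply, lintegral_uniformOn]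

lemma measurable_average_maxMatchings {w : Y → Fin r → Fin r → ℝ} (hw : Measurable w)
    {f : Y × CompletedMatching r → ENNReal} (hf : Measurable f) :
    Measurable fun y => (∑ μ ∈ maxMatchings (w y), f (y, μ)) / (maxMatchings (w y)).card := by
  have := hf.lintegral_kernel_prod_right'
    (κ := uniformChoice (fun y => maxMatchings (w y)) (measurable_maxMatchings hw))
  simpa only [uniformChoice_apply, lintegral_uniformOn] using this

lemma integral_vcgLaw (ν : Measure Y) [SFinite ν] {w : Y → Fin r → Fin r → ℝ} (hw : Measurable w)
    {f : Y × CompletedMatching r → ℝ} (hf : Integrable f (vcgLaw ν hw)) :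
    ∫ z, f z ∂(vcgLaw ν hw)
      = ∫ y, (maxMatchings (w y)).expect (fun μ => f (y, μ)) ∂ν := by
  unfold vcgLaw at hf ⊢
  rw [Measure.integral_compProd hf]
  simp_rw [uniformChoice_apply, integral_uniformOn]

lemma integrable_expect_of_vcgLaw (ν : Measure Y) [SFinite ν] {w : Y → Fin r → Fin r → ℝ}
    (hw : Measurable w) {f : Y × CompletedMatching r → ℝ} (hf : Integrable f (vcgLaw ν hw)) :
    Integrable (fun y => (maxMatchings (w y)).expect (fun μ => f (y, μ))) ν := by
  unfold vcgLaw at hf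
  have := Integrable.integral_compProd hf
  simpa only [ProbabilityTheory.Kernel.prodMkLeft_apply, ProbabilityTheory.Kernel.const_apply,
    uniformChoice_apply, integral_uniformOn] using this

lemma map_fst_vcgLaw (ν : Measure Y) [SFinite ν] {w : Y → Fin r → Fin r → ℝ} (hw : Measurable w) :
    (vcgLaw ν hw).map Prod.fst = ν := by
  have := isMarkovKernel_uniformChoice (measurable_maxMatchings hw)
    fun y => maxMatchings_nonempty (w y)
  exact Measure.fst_compProd ν _

/-- Almost surely the random matching has maximum weight. -/
lemma ae_vcgLaw_mem (ν : Measure Y) [SFinite ν] {w : Y → Fin r → Fin r → ℝ} (hw : Measurable w) :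
    ∀ᵐ z ∂(vcgLaw ν hw), z.2 ∈ maxMatchings (w z.1) := by
  have hm : MeasurableSet {z : Y × CompletedMatching r | z.2 ∈ maxMatchings (w z.1)}ᶜ := by
    refine MeasurableSet.compl ?_
    have : {z : Y × CompletedMatching r | z.2 ∈ maxMatchings (w z.1)}
        = ⋃ μ, {y | μ ∈ maxMatchings (w y)} ×ˢ {μ} := by
      ext z; simp
    rw [this]
    refine .iUnion fun μ => .prod ?_ (.singleton μ)
    exact measurableSet_setOfPred.2 (measurable_finset_iff.1 (measurable_maxMatchings hw) μ)
  rw [ae_iff]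
  change vcgLaw ν hw {z | z.2 ∈ maxMatchings (w z.1)}ᶜ = 0
  rw [← lintegral_indicator_one hm, lintegral_vcgLaw ν hw (measurable_one.indicator hm)]
  refine (lintegral_congr fun y => ?_).trans lintegral_zero
  rw [Finset.sum_eq_zero, ENNReal.zero_div]
  intro μ hμ
  simp [hμ]

lemma map_vcgLaw {Y' : Type*} [MeasurableSpace Y'] {ν : Measure Y} {ν' : Measure Y'} [SFinite ν]
    [SFinite ν'] {w : Y → Fin r → Fin r → ℝ} (hw : Measurable w)
    {w' : Y' → Fin r → Fin r → ℝ} (hw' : Measurable w') {T : Y → Y'}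
    (hT : MeasurePreserving T ν ν') (h : ∀ y, w' (T y) = w y) :
    (vcgLaw ν hw).map (fun z => (T z.1, z.2)) = vcgLaw ν' hw' :=
  map_compProd_uniformChoice _ _ hT fun y => by rw [h]

lemma measurable_partner {V : Type*} [MeasurableSpace V] {s : Y → Fin r → V} (hs : Measurable s)
    (i : Fin r) : Measurable fun z : Y × CompletedMatching r => s z.1 (z.2.1 i) :=
  measurable_from_prod_countable_left fun μ => (measurable_pi_apply (μ.1 i)).comp hs

lemma measurableSet_matched (i : Fin r) :
    MeasurableSet {z : Y × CompletedMatching r | i ∈ z.2.2} :=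
  measurable_snd (MeasurableSet.of_discrete (s := {μ : CompletedMatching r | i ∈ μ.2}))

/-- The partner of a fixed left node is one of the `r` right nodes, whence its law is at most `r`
times their common law. -/
lemma map_partner_le {V : Type*} [MeasurableSpace V] (ν : Measure Y) [SFinite ν]
    {w : Y → Fin r → Fin r → ℝ} (hw : Measurable w) {s : Y → Fin r → V} (hs : Measurable s)
    {ρ : Measure V} (hρ : ∀ l, ν.map (fun y => s y l) = ρ) (i : Fin r) :
    (vcgLaw ν hw).map (fun z => s z.1 (z.2.1 i)) ≤ (r : ENNReal) • ρ := by
  refine Measure.le_iff.2 fun A hA => ?_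
  rw [Measure.map_apply (measurable_partner hs i) hA]
  have hsub : (fun z : Y × CompletedMatching r => s z.1 (z.2.1 i)) ⁻¹' A
      ⊆ ⋃ l : Fin r, Prod.fst ⁻¹' ((fun y => s y l) ⁻¹' A) := by
    intro z hz
    exact Set.mem_iUnion.2 ⟨z.2.1 i, hz⟩
  have hml : ∀ l, Measurable fun y => s y l := fun l => (measurable_pi_apply l).comp hs
  refine (measure_mono hsub).trans ((measure_iUnion_le _).trans ?_)
  rw [tsum_fintype]
  have : ∀ l, vcgLaw ν hw (Prod.fst ⁻¹' ((fun y => s y l) ⁻¹' A)) = ρ A := fun l => by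
    rw [← Measure.map_apply measurable_fst (hml l hA), map_fst_vcgLaw,
      ← Measure.map_apply (hml l) hA, hρ]
  simp [this]

end VcgLaw

section Exchangeable

variable {L R : Type*} [MeasurableSpace L] [MeasurableSpace R] {r : ℕ}

/-- The weights of the complete bipartite graph on sampled types, if the weight of an edge is a
function `g` of the types of its ends. -/
def typeWeight (g : L → R → ℝ) (r : ℕ) (y : (Fin r → L) × (Fin r → R)) (i l : Fin r) : ℝ :=
  g (y.1 i) (y.2 l)

lemma measurable_typeWeight {g : L → R → ℝ} (hg : Measurable fun q : L × R => g q.1 q.2) (r : ℕ) :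
    Measurable (typeWeight g r) := by
  refine measurable_pi_iff.2 fun i => measurable_pi_iff.2 fun l => ?_
  have : Measurable fun y : (Fin r → L) × (Fin r → R) => (y.1 i, y.2 l) := by fun_prop
  exact hg.comp this

/-- What a left node sees: her own type, the type of her partner, and whether the maximum-weight
matching uses her. -/
def slot (i : Fin r) (z : ((Fin r → L) × (Fin r → R)) × CompletedMatching r) : L × R × Prop :=
  (z.1.1 i, z.1.2 (z.2.1 i), i ∈ z.2.2)

lemma measurable_slot (i : Fin r) : Measurable (slot (L := L) (R := R) i) := by
  refine Measurable.prodMk (by fun_prop) (Measurable.prodMk ?_ ?_)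
  · exact measurable_partner (Y := (Fin r → L) × (Fin r → R)) measurable_snd i
  · exact measurableSet_setOfPred.1 (measurableSet_matched i)

/-- If the types on the left are i.i.d., then all left nodes have the same prospects. -/
lemma map_slot_eq (lam : Measure L) [IsProbabilityMeasure lam] (ρ : Measure R)
    [IsProbabilityMeasure ρ] {g : L → R → ℝ} (hg : Measurable fun q : L × R => g q.1 q.2) (i j : Fin r) :
    (vcgLaw ((Measure.pi fun _ : Fin r => lam).prod (Measure.pi fun _ : Fin r => ρ))
        (measurable_typeWeight hg r)).map (slot i)
      = (vcgLaw ((Measure.pi fun _ : Fin r => lam).prod (Measure.pi fun _ : Fin r => ρ))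
        (measurable_typeWeight hg r)).map (slot j) := by
  set σ : Equiv.Perm (Fin r) := Equiv.swap i j
  have hσ : MeasurePreserving (fun a : Fin r → L => fun i => a (σ i))
      (Measure.pi fun _ : Fin r => lam) (Measure.pi fun _ : Fin r => lam) := by
    have := (measurePreserving_piCongrLeft (fun _ : Fin r => lam) σ).symm
    convert this using 1
    rfl
  have hT := hσ.prod (MeasurePreserving.id (Measure.pi fun _ : Fin r => ρ))
  refine Measure.ext_of_lintegral _ fun f hf => ?_
  have hfs : ∀ i, Measurable
      fun z : ((Fin r → L) × (Fin r → R)) × CompletedMatching r => f (slot i z) :=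
    fun i => hf.comp (measurable_slot i)
  rw [lintegral_map hf (measurable_slot i), lintegral_map hf (measurable_slot j),
    lintegral_vcgLaw _ _ (hfs i), lintegral_vcgLaw _ _ (hfs j), ← hT.lintegral_comp]
  · refine lintegral_congr fun y => ?_
    have hw : typeWeight g r (Prod.map (fun a : Fin r → L => fun i => a (σ i)) id y)
        = fun i => typeWeight g r y (σ i) := rfl
    rw [hw, maxMatchings_relabel, Finset.sum_map, Finset.card_map]
    congr 1
    refine Finset.sum_congr rfl fun μ _ => ?_
    simp [slot, σ]
  · exact measurable_average_maxMatchings (measurable_typeWeight hg r)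
      (hfs i)

/-- If moreover the types on the right are i.i.d., then the partner of a left node has the same law
as every right type: averaging over the left nodes turns her into a uniformly random right node. -/
lemma map_partner_eq (lam : Measure L) [IsProbabilityMeasure lam] (ρ : Measure R)
    [IsProbabilityMeasure ρ] {g : L → R → ℝ} (hg : Measurable fun q : L × R => g q.1 q.2) (i : Fin r) :
    (vcgLaw ((Measure.pi fun _ : Fin r => lam).prod (Measure.pi fun _ : Fin r => ρ))
        (measurable_typeWeight hg r)).map (fun z => z.1.2 (z.2.1 i)) = ρ := by
  set γ := vcgLaw ((Measure.pi fun _ : Fin r => lam).prod (Measure.pi fun _ : Fin r => ρ))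
    (measurable_typeWeight hg r) with hγ
  have hm : ∀ l : Fin r, Measurable
      fun z : ((Fin r → L) × (Fin r → R)) × CompletedMatching r => z.1.2 (z.2.1 l) :=
    fun l => measurable_partner (Y := (Fin r → L) × (Fin r → R)) measurable_snd l
  refine Measure.ext_of_lintegral _ fun f hf => ?_
  have hsym : ∀ l : Fin r, ∫⁻ z, f (z.1.2 (z.2.1 l)) ∂γ = ∫⁻ z, f (z.1.2 (z.2.1 i)) ∂γ := fun l => by
    have hF : Measurable fun q : L × R × Prop => f q.2.1 := by fun_prop
    have h1 := lintegral_map (μ := γ) hF (measurable_slot l)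
    have h2 := lintegral_map (μ := γ) hF (measurable_slot i)
    rw [hγ, map_slot_eq lam ρ hg l i, ← hγ] at h1
    exact h1.symm.trans h2
  have hl : ∀ l : Fin r, ∫⁻ z, f (z.1.2 l) ∂γ = ∫⁻ s, f s ∂ρ := fun l => by
    have h1 : MeasurePreserving (fun y : (Fin r → L) × (Fin r → R) => y.2 l)
        ((Measure.pi fun _ : Fin r => lam).prod (Measure.pi fun _ : Fin r => ρ)) ρ :=
      (measurePreserving_eval _ l).comp measurePreserving_snd
    have h2 : MeasurePreserving Prod.fst γ _ :=
      ⟨measurable_fst, map_fst_vcgLaw _ (measurable_typeWeight hg r)⟩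
    exact (h1.comp h2).lintegral_comp hf
  have hfm : ∀ l : Fin r, Measurable fun z : ((Fin r → L) × (Fin r → R)) × CompletedMatching r =>
      f (z.1.2 (z.2.1 l)) := fun l => hf.comp (hm l)
  have hsum : ∑ l : Fin r, ∫⁻ z, f (z.1.2 (z.2.1 l)) ∂γ = ∑ l : Fin r, ∫⁻ z, f (z.1.2 l) ∂γ := by
    rw [← lintegral_finsetSum _ fun l _ => hfm l,
      ← lintegral_finsetSum _ fun l _ => by fun_prop]
    refine lintegral_congr fun z => ?_
    exact Equiv.sum_comp z.2.1 (fun l => f (z.1.2 l))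
  simp only [hsym, hl, Finset.sum_const, Finset.card_univ, Fintype.card_fin, nsmul_eq_mul] at hsum
  rw [lintegral_map hf (hm i)]
  have hr : (r : ENNReal) ≠ 0 := by
    have := i.pos
    exact_mod_cast this.ne'
  exact (ENNReal.mul_right_inj hr (ENNReal.natCast_ne_top r)).1 hsum

end Exchangeable

/-! ### Interim outcomes -/

lemma ofReal_integral_le {α : Type*} [MeasurableSpace α] (μ : Measure α) (f : α → ℝ) :
    ENNReal.ofReal (∫ a, f a ∂μ) ≤ ∫⁻ a, ENNReal.ofReal (f a) ∂μ := by
  by_cases hf : Integrable f μ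
  · rw [integral_eq_lintegral_pos_part_sub_lintegral_neg_part hf]
    refine (ENNReal.ofReal_le_ofReal (sub_le_self _ ENNReal.toReal_nonneg)).trans ?_
    exact ENNReal.ofReal_toReal_le
  · simp [integral_undef hf]

namespace Mechanism

variable {m n : ℕ} {M : Mechanism m n} {D : Fin m → Measure (BidderValuation n)}

lemma measurable_apply_bundle (S : Finset (Fin n)) :
    Measurable fun v : BidderValuation n => v.1 S :=
  (measurable_pi_apply S).comp measurable_subtype_coe

lemma measurable_interimValue [∀ j, IsProbabilityMeasure (D j)]
    (hM : ∀ a, Measurable fun v => M.lottery v a) (j : Fin m) :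
    Measurable fun q : BidderValuation n × BidderValuation n => M.interimValue D j q.1 q.2 := by
  have h : Measurable fun q : (BidderValuation n × BidderValuation n) × Profile m n =>
      ∑ a, M.lottery (Function.update q.2 j q.1.2) a * q.1.1.1 (a.1 j) := by
    refine Finset.measurable_sum _ fun a _ => Measurable.mul ?_ ?_
    · exact (hM a).comp ((measurable_update_pair j).comp
        ((measurable_snd.comp measurable_fst).prodMk measurable_snd))
    · exact (measurable_apply_bundle _).comp (measurable_fst.comp measurable_fst)
  exact h.stronglyMeasurable.integral_prod_right'.measurable

lemma measurable_interimPay [∀ j, IsProbabilityMeasure (D j)] {j : Fin m}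
    (hM : Measurable fun v => M.pay v j) :
    Measurable fun t => M.interimPay D j t := by
  have h : Measurable fun q : BidderValuation n × Profile m n =>
      M.pay (Function.update q.2 j q.1) j := hM.comp (measurable_update_pair j)
  exact h.stronglyMeasurable.integral_prod_right'.measurable

lemma lottery_nonneg {T : Fin m → Set (BidderValuation n)} (hM : M.IsWellPosed D T)
    (v : Profile m n) (a : Allocation m n) : 0 ≤ M.lottery v a := (hM.lottery_mem v).1 a

lemma sum_lottery {T : Fin m → Set (BidderValuation n)} (hM : M.IsWellPosed D T)
    (v : Profile m n) : ∑ a, M.lottery v a = 1 := (hM.lottery_mem v).2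

lemma scalePrices_interimPay (c : ℝ) (j : Fin m) (t : BidderValuation n) :
    (M.scalePrices c).interimPay D j t = c * M.interimPay D j t :=
  integral_const_mul _ _

end Mechanism

/-! ### The joint law of the phase-1 randomness -/

section Joint

open Mechanism

variable {m n k : ℕ} {N : Mechanism m n} {D Dp : Fin m → Measure (BidderValuation n)}
  [∀ j, IsProbabilityMeasure (D j)] [∀ j, IsProbabilityMeasure (Dp j)]

lemma measurable_edgeWeight (hl : ∀ a, Measurable fun v => N.lottery v a)
    (hp : ∀ j, Measurable fun v => N.pay v j) (j : Fin m) :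
    Measurable fun q : BidderValuation n × Draw k n => edgeWeight N D j q.1 q.2 := by
  refine measurable_pi_iff.2 fun i => measurable_pi_iff.2 fun l => ?_
  unfold edgeWeight
  have h1 : Measurable fun q : BidderValuation n × Draw k n =>
      ((Fin.cons q.1 q.2.1 : Fin (k + 1) → BidderValuation n) i) := by
    induction i using Fin.cases with
    | zero => simpa using measurable_fst
    | succ i => simp only [Fin.cons_succ]; fun_prop
  have h2 : Measurable fun q : BidderValuation n × Draw k n => q.2.2 l := by fun_prop
  exact ((measurable_interimValue hl j).comp (h1.prodMk h2)).sub
    ((measurable_interimPay (hp j)).comp h2)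

/-- The law of the draws of one bidder. -/
noncomputable def bidderDrawLaw (D Dp : Fin m → Measure (BidderValuation n)) (k : ℕ) (j : Fin m) :
    Measure (Draw k n) :=
  (Measure.pi fun _ : Fin k => Dp j).prod (Measure.pi fun _ : Fin (k + 1) => D j)

instance (j : Fin m) : IsProbabilityMeasure (bidderDrawLaw D Dp k j) := by
  unfold bidderDrawLaw; infer_instance

lemma drawLaw_eq : drawLaw D Dp k = Measure.pi (bidderDrawLaw D Dp k) := rfl

instance : IsProbabilityMeasure (drawLaw D Dp k) := by rw [drawLaw_eq]; infer_instance

/-- What phase 1 reveals about one bidder: her report, her draws and her matching. -/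
abbrev BidderState (k n : ℕ) : Type :=
  (BidderValuation n × Draw k n) × CompletedMatching (k + 1)

/-- The surrogate that represents the bidder. -/
def BidderState.surrogate (ω : BidderState k n) : BidderValuation n := ω.1.2.2 (ω.2.1 0)

lemma measurable_surrogate : Measurable (BidderState.surrogate (k := k) (n := n)) :=
  measurable_partner (Y := BidderValuation n × Draw k n) (measurable_snd.comp measurable_snd) 0

/-- The law of the state of bidder `j` if her report has law `β`. -/
noncomputable def bidderLaw (Dp : Fin m → Measure (BidderValuation n))
    (hl : ∀ a, Measurable fun v => N.lottery v a) (hp : ∀ j, Measurable fun v => N.pay v j)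
    (D : Fin m → Measure (BidderValuation n)) [∀ j, IsProbabilityMeasure (D j)]
    (k : ℕ) (j : Fin m) (β : Measure (BidderValuation n)) :
    Measure (BidderState k n) :=
  vcgLaw (β.prod (bidderDrawLaw D Dp k j)) (measurable_edgeWeight (D := D) hl hp j)

variable (hl : ∀ a, Measurable fun v => N.lottery v a) (hp : ∀ j, Measurable fun v => N.pay v j)

instance (j : Fin m) (β : Measure (BidderValuation n)) [IsProbabilityMeasure β] :
    IsProbabilityMeasure (bidderLaw Dp hl hp D k j β) := by
  unfold bidderLaw; infer_instance

lemma mem_vcgMatchings {v : Profile m n} {x : Fin m → Draw k n}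
    {μ : Fin m → CompletedMatching (k + 1)} :
    μ ∈ vcgMatchings N D v x ↔ ∀ j, μ j ∈ maxMatchings (edgeWeight N D j (v j) (x j)) :=
  Fintype.mem_piFinset

lemma vcgMatchings_nonempty (v : Profile m n) (x : Fin m → Draw k n) :
    (vcgMatchings N D v x).Nonempty :=
  Fintype.piFinset_nonempty.2 fun _ => maxMatchings_nonempty _

include hl hp in
lemma measurable_vcgMatchings :
    Measurable fun q : Profile m n × (Fin m → Draw k n) => vcgMatchings N D q.1 q.2 := by
  refine measurable_finset_iff.2 fun μ => measurableSet_setOfPred.1 ?_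
  simp only [mem_vcgMatchings]
  rw [Set.ofPred_forall]
  refine .iInter fun j => ?_
  have h1 : Measurable fun q : Profile m n × (Fin m → Draw k n) => (q.1 j, q.2 j) := by fun_prop
  have h2 := (measurable_maxMatchings (measurable_edgeWeight (D := D) (k := k) hl hp j)).comp h1
  exact measurableSet_setOfPred.2 (measurable_finset_iff.1 h2 (μ j))

/-- The kernel that selects the matchings of all bidders. -/
noncomputable def vcgKernel :
    ProbabilityTheory.Kernel (Profile m n × (Fin m → Draw k n))
      (Fin m → CompletedMatching (k + 1)) :=
  uniformChoice (fun q => vcgMatchings N D q.1 q.2) (measurable_vcgMatchings hl hp)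

instance : ProbabilityTheory.IsFiniteKernel (vcgKernel (D := D) (k := k) hl hp) := by
  unfold vcgKernel; infer_instance

/-- The joint law of reports, draws and matchings if the reports have law `ρ`. -/
noncomputable def jointLaw (D Dp : Fin m → Measure (BidderValuation n))
    [∀ j, IsProbabilityMeasure (D j)] (k : ℕ)
    (ρ : Measure (Profile m n)) :
    Measure ((Profile m n × (Fin m → Draw k n)) × (Fin m → CompletedMatching (k + 1))) :=
  (ρ.prod (drawLaw D Dp k)).compProd (vcgKernel (D := D) hl hp)

/-- The states of all bidders. -/
def bidderStates (z : (Profile m n × (Fin m → Draw k n)) × (Fin m → CompletedMatching (k + 1)))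
    (j : Fin m) : BidderState k n := ((z.1.1 j, z.1.2 j), z.2 j)

lemma measurable_bidderStates : Measurable (bidderStates (m := m) (n := n) (k := k)) := by
  unfold bidderStates; fun_prop

/-- The states of different bidders are independent. -/
lemma map_bidderStates (B : Fin m → Measure (BidderValuation n)) [∀ j, IsProbabilityMeasure (B j)] :
    (jointLaw hl hp D Dp k (Measure.pi B)).map bidderStates
      = Measure.pi fun j => bidderLaw Dp hl hp D k j (B j) := by
  refine (Measure.pi_eq fun S hS => ?_).symm
  rw [Measure.map_apply measurable_bidderStates (.univ_pi hS), jointLaw,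
    Measure.compProd_apply (measurable_bidderStates (.univ_pi hS))]
  set g : ∀ j : Fin m, BidderValuation n × Draw k n → ENNReal := fun j q =>
    uniformChoice (fun q : BidderValuation n × Draw k n => maxMatchings (edgeWeight N D j q.1 q.2))
      (measurable_maxMatchings (measurable_edgeWeight hl hp j)) q (Prod.mk q ⁻¹' S j) with hg
  have hgm : ∀ j, Measurable (g j) := fun j =>
    ProbabilityTheory.Kernel.measurable_kernel_prodMk_left (hS j)
  have h1 : ∀ q : Profile m n × (Fin m → Draw k n),
      vcgKernel (D := D) (k := k) hl hp q (Prod.mk q ⁻¹' (bidderStates ⁻¹' Set.univ.pi S))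
        = ∏ j, g j (q.1 j, q.2 j) := by
    intro q
    have e : (Prod.mk q ⁻¹' (bidderStates ⁻¹' Set.univ.pi S))
        = Set.univ.pi fun j => Prod.mk (q.1 j, q.2 j) ⁻¹' S j := by
      ext μ; simp [bidderStates]
    rw [e, vcgKernel, uniformChoice_apply, vcgMatchings, Fintype.coe_piFinset,
      ProbabilityTheory.uniformOn_pi, Measure.pi_pi]
    rfl
  simp_rw [h1]
  have hgj : ∀ j, Measurable fun q : Profile m n × (Fin m → Draw k n) => g j (q.1 j, q.2 j) :=
    fun j => (hgm j).comp (by fun_prop)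
  rw [lintegral_prod _ (Finset.measurable_prod _ fun j _ => hgj j).aemeasurable]
  have h2 : ∀ v : Profile m n, ∫⁻ x, ∏ j, g j (v j, x j) ∂(drawLaw D Dp k)
      = ∏ j, ∫⁻ x, g j (v j, x) ∂(bidderDrawLaw D Dp k j) := fun v => by
    rw [drawLaw_eq]
    exact lintegral_pi_prod (bidderDrawLaw D Dp k) (f := fun j x => g j (v j, x))
      fun j => (hgm j).comp (by fun_prop)
  simp_rw [h2]
  rw [lintegral_pi_prod B (f := fun j t => ∫⁻ x, g j (t, x) ∂(bidderDrawLaw D Dp k j))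
    fun j => (hgm j).lintegral_prod_right']
  refine Finset.prod_congr rfl fun j _ => ?_
  rw [bidderLaw, vcgLaw, Measure.compProd_apply (hS j), lintegral_prod _ (hgm j).aemeasurable]

/-- The average over phase 1 of a function of the states of the bidders. -/
noncomputable def phaseOneAverage (N : Mechanism m n) (D Dp : Fin m → Measure (BidderValuation n))
    (G : (Fin m → BidderState k n) → ℝ) (v : Profile m n) : ℝ :=
  ∫ x, (vcgMatchings N D v x).expect (fun μ => G (bidderStates ((v, x), μ))) ∂(drawLaw D Dp k)

lemma expect_eq_integral_vcgKernel (G : (Fin m → BidderState k n) → ℝ)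
    (q : Profile m n × (Fin m → Draw k n)) :
    (vcgMatchings N D q.1 q.2).expect (fun μ => G (bidderStates (q, μ)))
      = ∫ μ, G (bidderStates (q, μ)) ∂(vcgKernel (D := D) hl hp q) := by
  rw [vcgKernel, uniformChoice_apply, integral_uniformOn]

include hl hp in
lemma measurable_phaseOneAverage {G : (Fin m → BidderState k n) → ℝ} (hG : Measurable G) :
    Measurable (phaseOneAverage N D Dp G) := by
  have h1 : StronglyMeasurable fun q : Profile m n × (Fin m → Draw k n) =>
      ∫ μ, G (bidderStates (q, μ)) ∂(vcgKernel (D := D) hl hp q) :=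
    (hG.comp measurable_bidderStates).stronglyMeasurable.integral_kernel_prod_right'
  simp_rw [← expect_eq_integral_vcgKernel] at h1
  exact h1.integral_prod_right'.measurable

section

variable (B : Fin m → Measure (BidderValuation n)) [∀ j, IsProbabilityMeasure (B j)]
  {G : (Fin m → BidderState k n) → ℝ}

lemma integrable_jointLaw (hG : Integrable G (Measure.pi fun j => bidderLaw Dp hl hp D k j (B j))) :
    Integrable (fun z => G (bidderStates z)) (jointLaw hl hp D Dp k (Measure.pi B)) := by
  rw [← map_bidderStates] at hG
  exact hG.comp_measurable measurable_bidderStates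

lemma integrable_expect
    (hG : Integrable G (Measure.pi fun j => bidderLaw Dp hl hp D k j (B j))) :
    Integrable (fun q : Profile m n × (Fin m → Draw k n) =>
      (vcgMatchings N D q.1 q.2).expect (fun μ => G (bidderStates (q, μ))))
      ((Measure.pi B).prod (drawLaw D Dp k)) := by
  have h := Integrable.integral_compProd (integrable_jointLaw hl hp B hG)
  simpa only [ProbabilityTheory.Kernel.prodMkLeft_apply, ProbabilityTheory.Kernel.const_apply,
    ← expect_eq_integral_vcgKernel] using h

lemma integrable_phaseOneAverage
    (hG : Integrable G (Measure.pi fun j => bidderLaw Dp hl hp D k j (B j))) :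
    Integrable (phaseOneAverage N D Dp G) (Measure.pi B) :=
  (integrable_expect hl hp B hG).integral_prod_left

lemma integral_phaseOneAverage
    (hG : Integrable G (Measure.pi fun j => bidderLaw Dp hl hp D k j (B j))) :
    ∫ v, phaseOneAverage N D Dp G v ∂(Measure.pi B)
      = ∫ ω, G ω ∂(Measure.pi fun j => bidderLaw Dp hl hp D k j (B j)) := by
  have h := integrable_jointLaw hl hp B hG
  rw [← map_bidderStates, integral_map measurable_bidderStates.aemeasurable
    (by rw [map_bidderStates]; exact hG.aestronglyMeasurable), jointLaw,
    Measure.integral_compProd h]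
  simp_rw [← expect_eq_integral_vcgKernel]
  rw [integral_prod _ (integrable_expect hl hp B hG)]
  rfl

/-- The negative part of an average over phase 1 is at most the average of the negative part. -/
lemma lintegral_neg_phaseOneAverage_le (hG : Measurable G) :
    ∫⁻ v, ENNReal.ofReal (-phaseOneAverage N D Dp G v) ∂(Measure.pi B)
      ≤ ∫⁻ ω, ENNReal.ofReal (-G ω) ∂(Measure.pi fun j => bidderLaw Dp hl hp D k j (B j)) := by
  have hm : Measurable fun z : (Profile m n × (Fin m → Draw k n)) ×
      (Fin m → CompletedMatching (k + 1)) => ENNReal.ofReal (-G (bidderStates z)) :=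
    (hG.comp measurable_bidderStates).neg.ennreal_ofReal
  have hG' : Measurable fun ω => ENNReal.ofReal (-G ω) := hG.neg.ennreal_ofReal
  rw [← map_bidderStates, lintegral_map hG' measurable_bidderStates, jointLaw,
    Measure.lintegral_compProd hm, lintegral_prod _ (hm.lintegral_kernel_prod_right').aemeasurable]
  refine lintegral_mono fun v => ?_
  rw [phaseOneAverage, ← integral_neg]
  refine (ofReal_integral_le _ _).trans (lintegral_mono fun x => ?_)
  dsimp only
  rw [expect_eq_integral_vcgKernel hl hp G (v, x), ← integral_neg]
  exact ofReal_integral_le _ _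

end

end Joint

/-! ### Reduction of one bidder's prospects to her own state -/

section Reduction

open Mechanism

variable {m n k : ℕ} {N : Mechanism m n} {D Dp : Fin m → Measure (BidderValuation n)}
  [∀ j, IsProbabilityMeasure (D j)] [∀ j, IsProbabilityMeasure (Dp j)]

/-- The weight of an edge of the graph of bidder `j` as a function of the types of its ends. -/
noncomputable def edgeUtility (N : Mechanism m n) (D : Fin m → Measure (BidderValuation n))
    (j : Fin m) (t s : BidderValuation n) : ℝ :=
  N.interimValue D j t s - N.interimPay D j s

lemma measurable_edgeUtility (hl : ∀ a, Measurable fun v => N.lottery v a)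
    (hp : ∀ j, Measurable fun v => N.pay v j) (j : Fin m) :
    Measurable fun q : BidderValuation n × BidderValuation n => edgeUtility N D j q.1 q.2 :=
  (measurable_interimValue hl j).sub ((measurable_interimPay (hp j)).comp measurable_snd)

/-- The report and the draws of a bidder, read off from i.i.d. left types `y.1` that carry a
valuation `f (y.1 i)`, and the right types. -/
def drawOfTypes {L : Type*} (f : L → BidderValuation n)
    (y : (Fin (k + 1) → L) × (Fin (k + 1) → BidderValuation n)) :
    BidderValuation n × Draw k n :=
  (f (y.1 0), (fun i => f (y.1 i.succ), y.2))

lemma edgeWeight_drawOfTypes {L : Type*} (f : L → BidderValuation n) (j : Fin m)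
    (y : (Fin (k + 1) → L) × (Fin (k + 1) → BidderValuation n)) :
    edgeWeight N D j (drawOfTypes f y).1 (drawOfTypes f y).2
      = typeWeight (fun a s => edgeUtility N D j (f a) s) (k + 1) y := by
  ext i l
  induction i using Fin.cases <;> rfl

lemma measurePreserving_drawOfTypes {L : Type*} [MeasurableSpace L] {lam : Measure L}
    [IsProbabilityMeasure lam] {f : L → BidderValuation n} {j : Fin m}
    (hf : MeasurePreserving f lam (Dp j)) :
    MeasurePreserving (drawOfTypes (k := k) f)
      ((Measure.pi fun _ : Fin (k + 1) => lam).prod (Measure.pi fun _ : Fin (k + 1) => D j))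
      ((Dp j).prod (bidderDrawLaw D Dp k j)) := by
  have h1 := measurePreserving_piFinSuccAbove (fun _ : Fin (k + 1) => lam) 0
  have h2 : MeasurePreserving (fun a : Fin k → L => fun i => f (a i))
      (Measure.pi fun _ => lam) (Measure.pi fun _ => Dp j) :=
    measurePreserving_pi _ _ fun _ => hf
  have h3 := ((hf.prod h2).comp h1).prod
    (MeasurePreserving.id (Measure.pi fun _ : Fin (k + 1) => D j))
  exact (measurePreserving_prodAssoc _ _ _).comp h3

variable (hl : ∀ a, Measurable fun v => N.lottery v a) (hp : ∀ j, Measurable fun v => N.pay v j)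

include hl hp in
lemma measurable_edgeUtility_comp {L : Type*} [MeasurableSpace L] {f : L → BidderValuation n}
    (hf : Measurable f) (j : Fin m) :
    Measurable fun q : L × BidderValuation n => edgeUtility N D j (f q.1) q.2 := by
  have h1 : Measurable fun q : BidderValuation n × BidderValuation n =>
      edgeUtility N D j q.1 q.2 := measurable_edgeUtility hl hp j
  have h2 : Measurable fun q : L × BidderValuation n => (f q.1, q.2) := by fun_prop
  have h3 := h1.comp h2
  exact h3

/-- If a bidder's report has the law of her replicas, then her state is obtained from i.i.d. left
types; these may carry more information than their valuation. -/
lemma map_drawOfTypes {L : Type*} [MeasurableSpace L] {lam : Measure L}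
    [IsProbabilityMeasure lam] {f : L → BidderValuation n} {j : Fin m}
    (hf : MeasurePreserving f lam (Dp j)) :
    (vcgLaw ((Measure.pi fun _ : Fin (k + 1) => lam).prod (Measure.pi fun _ : Fin (k + 1) => D j))
      (measurable_typeWeight (g := fun a s => edgeUtility N D j (f a) s)
        (measurable_edgeUtility_comp (D := D) hl hp hf.measurable j) (k + 1))).map (fun z => (drawOfTypes f z.1, z.2))
      = bidderLaw Dp hl hp D k j (Dp j) :=
  map_vcgLaw _ _ (measurePreserving_drawOfTypes hf) fun y => edgeWeight_drawOfTypes f j y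

/-- A truthful bidder is represented by a surrogate with the law of the surrogates. -/
lemma map_surrogate (j : Fin m) :
    (bidderLaw Dp hl hp D k j (Dp j)).map BidderState.surrogate = D j := by
  have hid := MeasurePreserving.id (Dp j)
  have hm : Measurable fun z : ((Fin (k + 1) → BidderValuation n) ×
      (Fin (k + 1) → BidderValuation n)) × CompletedMatching (k + 1) =>
      ((drawOfTypes id z.1, z.2) : BidderState k n) :=
    ((measurePreserving_drawOfTypes (D := D) hid).measurable.comp measurable_fst).prodMk
      measurable_snd
  rw [← map_drawOfTypes hl hp hid, Measure.map_map measurable_surrogate hm]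
  exact map_partner_eq (Dp j) (D j) (g := fun a s => edgeUtility N D j (id a) s)
    (measurable_edgeUtility_comp hl hp measurable_id j) 0

lemma map_surrogate_le (j : Fin m) (β : Measure (BidderValuation n)) [IsProbabilityMeasure β] :
    (bidderLaw Dp hl hp D k j β).map BidderState.surrogate
      ≤ ((k + 1 : ℕ) : ENNReal) • D j := by
  refine map_partner_le _ _ (s := fun y : BidderValuation n × Draw k n => y.2.2)
    (measurable_snd.comp measurable_snd) (fun l => ?_) 0
  have h : MeasurePreserving (fun y : BidderValuation n × Draw k n => y.2.2 l)
      (β.prod (bidderDrawLaw D Dp k j)) (D j) :=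
    ((measurePreserving_eval (fun _ : Fin (k + 1) => D j) l).comp
      measurePreserving_snd).comp measurePreserving_snd
  exact h.map_eq

lemma map_surrogate_absolutelyContinuous (j : Fin m) (β : Measure (BidderValuation n))
    [IsProbabilityMeasure β] :
    (bidderLaw Dp hl hp D k j β).map BidderState.surrogate ≪ D j :=
  (map_surrogate_le hl hp j β).absolutelyContinuous.trans Measure.smul_absolutelyContinuous

lemma ae_surrogate (j : Fin m) (β : Measure (BidderValuation n)) [IsProbabilityMeasure β]
    {P : BidderValuation n → Prop} (h : ∀ᵐ s ∂(D j), P s) :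
    ∀ᵐ ω ∂(bidderLaw Dp hl hp D k j β), P ω.surrogate :=
  ae_of_ae_map measurable_surrogate.aemeasurable
    ((map_surrogate_absolutelyContinuous hl hp j β).ae_le h)

lemma integrable_comp_surrogate (j : Fin m) (β : Measure (BidderValuation n))
    [IsProbabilityMeasure β] {f : BidderValuation n → ℝ} (hf : Integrable f (D j)) :
    Integrable (fun ω => f ω.surrogate) (bidderLaw Dp hl hp D k j β) := by
  have h1 : Integrable f (((k + 1 : ℕ) : ENNReal) • D j) :=
    hf.smul_measure (ENNReal.natCast_ne_top _)
  exact (h1.mono_measure (map_surrogate_le hl hp j β)).comp_measurable measurable_surrogate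

/-- If the other bidders are truthful, bidder `j` faces a profile of surrogates whose coordinates
other than `j` are independent of her own state and distributed according to `D`. -/
lemma map_state_surrogates (j : Fin m) (B : Fin m → Measure (BidderValuation n))
    [∀ i, IsProbabilityMeasure (B i)] (hB : ∀ i, i ≠ j → B i = Dp i) :
    (Measure.pi fun i => bidderLaw Dp hl hp D k i (B i)).map
        (fun ω => (ω j, fun i => (ω i).surrogate))
      = ((bidderLaw Dp hl hp D k j (B j)).prod (Measure.pi D)).map
        (fun q => (q.1, Function.update q.2 j q.1.surrogate)) :=
  map_eval_comp_pi _ D measurable_surrogate j fun i hi => by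
    have : ∀ (β : Measure (BidderValuation n)) [IsProbabilityMeasure β], β = Dp i →
        (bidderLaw Dp hl hp D k i β).map BidderState.surrogate = D i := by
      rintro β _ rfl
      exact map_surrogate hl hp i
    exact this _ (hB i hi)

lemma measurable_state_surrogates (j : Fin m) :
    Measurable fun ω : Fin m → BidderState k n => (ω j, fun i => (ω i).surrogate) :=
  (measurable_pi_apply j).prodMk
    (measurable_pi_iff.2 fun i => measurable_surrogate.comp (measurable_pi_apply i))

lemma measurable_state_update (j : Fin m) :
    Measurable fun q : BidderState k n × Profile m n =>
      (q.1, Function.update q.2 j q.1.surrogate) :=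
  measurable_fst.prodMk ((measurable_update_pair j).comp
    ((measurable_surrogate.comp measurable_fst).prodMk measurable_snd))

section

variable {j : Fin m} {B : Fin m → Measure (BidderValuation n)} [∀ i, IsProbabilityMeasure (B i)]
  (hB : ∀ i, i ≠ j → B i = Dp i) {F : BidderState k n × Profile m n → ℝ} (hF : Measurable F)

include hB hF

lemma integrable_state_surrogates_iff :
    Integrable (fun ω : Fin m → BidderState k n => F (ω j, fun i => (ω i).surrogate))
        (Measure.pi fun i => bidderLaw Dp hl hp D k i (B i))
      ↔ Integrable (fun q => F (q.1, Function.update q.2 j q.1.surrogate))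
        ((bidderLaw Dp hl hp D k j (B j)).prod (Measure.pi D)) := by
  have h1 := integrable_map_measure (f := fun ω : Fin m → BidderState k n =>
      (ω j, fun i => (ω i).surrogate)) (g := F)
    (μ := Measure.pi fun i => bidderLaw Dp hl hp D k i (B i))
    hF.aestronglyMeasurable (measurable_state_surrogates j).aemeasurable
  have h2 := integrable_map_measure (f := fun q : BidderState k n × Profile m n =>
      (q.1, Function.update q.2 j q.1.surrogate)) (g := F)
    (μ := (bidderLaw Dp hl hp D k j (B j)).prod (Measure.pi D))
    hF.aestronglyMeasurable (measurable_state_update j).aemeasurable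
  rw [map_state_surrogates hl hp j B hB] at h1
  exact h1.symm.trans h2

lemma integral_state_surrogates :
    ∫ ω, F (ω j, fun i => (ω i).surrogate) ∂(Measure.pi fun i => bidderLaw Dp hl hp D k i (B i))
      = ∫ q, F (q.1, Function.update q.2 j q.1.surrogate)
        ∂((bidderLaw Dp hl hp D k j (B j)).prod (Measure.pi D)) := by
  rw [← integral_map (measurable_state_update j).aemeasurable hF.aestronglyMeasurable,
    ← map_state_surrogates hl hp j B hB,
    integral_map (measurable_state_surrogates j).aemeasurable hF.aestronglyMeasurable]

end

/-- The state of a bidder with report `t`, as an average over her draws. -/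
lemma integral_bidderLaw_dirac {j : Fin m} (t : BidderValuation n) {f : BidderState k n → ℝ}
    (hf : Integrable f (bidderLaw Dp hl hp D k j (Measure.dirac t))) :
    Integrable (fun x => (maxMatchings (edgeWeight N D j t x)).expect fun μ => f ((t, x), μ))
        (bidderDrawLaw D Dp k j) ∧
      ∫ ω, f ω ∂(bidderLaw Dp hl hp D k j (Measure.dirac t))
        = ∫ x, (maxMatchings (edgeWeight N D j t x)).expect (fun μ => f ((t, x), μ))
          ∂(bidderDrawLaw D Dp k j) := by
  have h1 := integrable_expect_of_vcgLaw _ _ hf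
  have h2 := integral_vcgLaw _ _ hf
  have hm : Measurable (Prod.mk t : Draw k n → BidderValuation n × Draw k n) := by fun_prop
  rw [Measure.dirac_prod] at h1 h2
  refine ⟨h1.comp_measurable hm, ?_⟩
  rw [bidderLaw, Measure.dirac_prod, h2, integral_map hm.aemeasurable h1.aestronglyMeasurable]

end Reduction

/-! ### The interim outcomes of the replica–surrogate mechanism -/

namespace Mechanism

variable {m n : ℕ} {M : Mechanism m n} {D : Fin m → Measure (BidderValuation n)}
  {T : Fin m → Set (BidderValuation n)}

/-- The expected value of a lottery to a bidder with valuation `u`. -/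
def lotteryValue (M : Mechanism m n) (j : Fin m) (u : BidderValuation n) (v : Profile m n) : ℝ :=
  ∑ a, M.lottery v a * u.1 (a.1 j)

lemma lotteryValue_nonneg (hM : M.IsWellPosed D T) (j : Fin m) (u : BidderValuation n)
    (v : Profile m n) : 0 ≤ M.lotteryValue j u v :=
  Finset.sum_nonneg fun a _ => mul_nonneg (lottery_nonneg hM v a) (u.2.2 _)

lemma lotteryValue_le (hM : M.IsWellPosed D T) (j : Fin m) (u : BidderValuation n)
    (v : Profile m n) : M.lotteryValue j u v ≤ ∑ S, u.1 S := by
  have : ∀ a : Allocation m n, u.1 (a.1 j) ≤ ∑ S, u.1 S := fun a =>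
    Finset.single_le_sum (fun S _ => u.2.2 S) (Finset.mem_univ _)
  calc M.lotteryValue j u v ≤ ∑ a, M.lottery v a * ∑ S, u.1 S :=
        Finset.sum_le_sum fun a _ => mul_le_mul_of_nonneg_left (this a) (lottery_nonneg hM v a)
    _ = _ := by rw [← Finset.sum_mul, sum_lottery hM, one_mul]

lemma measurable_lotteryValue (hM : M.IsWellPosed D T) (j : Fin m) :
    Measurable fun q : BidderValuation n × Profile m n => M.lotteryValue j q.1 q.2 := by
  refine Finset.measurable_sum _ fun a _ => Measurable.mul ?_ ?_
  · exact (hM.measurable_lottery a).comp measurable_snd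
  · exact (measurable_apply_bundle _).comp measurable_fst

lemma abs_lotteryValue_le (hM : M.IsWellPosed D T) (j : Fin m) (u : BidderValuation n)
    (v : Profile m n) : |M.lotteryValue j u v| ≤ ∑ S, u.1 S := by
  rw [abs_of_nonneg (lotteryValue_nonneg hM j u v)]
  exact lotteryValue_le hM j u v

lemma measurable_update_const (j : Fin m) (t : BidderValuation n) :
    Measurable fun w : Profile m n => Function.update w j t :=
  (measurable_update_pair j).comp (measurable_const.prodMk measurable_id)

lemma interimValue_eq (j : Fin m) (u t : BidderValuation n) :
    M.interimValue D j u t = ∫ w, M.lotteryValue j u (Function.update w j t) ∂(Measure.pi D) := rfl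

variable [∀ j, IsProbabilityMeasure (D j)]

lemma integrable_lotteryValue (hM : M.IsWellPosed D T) (j : Fin m) (u t : BidderValuation n) :
    Integrable (fun w => M.lotteryValue j u (Function.update w j t)) (Measure.pi D) :=
  Integrable.of_bound (((measurable_lotteryValue hM j).comp
    (measurable_const.prodMk (measurable_update_const j t))).aestronglyMeasurable) (∑ S, u.1 S)
    (.of_forall fun _ => abs_lotteryValue_le hM j u _)

lemma interimValue_le (hM : M.IsWellPosed D T) (j : Fin m) (u t : BidderValuation n) :
    M.interimValue D j u t ≤ ∑ S, u.1 S := by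
  rw [interimValue_eq]
  calc _ ≤ ∫ w, (∑ S, u.1 S) ∂(Measure.pi D) :=
        integral_mono (integrable_lotteryValue hM j u t) (integrable_const _)
          fun _ => lotteryValue_le hM j u _
    _ = _ := by simp

/-- The expected negative part of the payment of bidder `j` with report `t`. -/
noncomputable def interimNegPay (M : Mechanism m n) (D : Fin m → Measure (BidderValuation n))
    (j : Fin m) (t : BidderValuation n) : ℝ :=
  ∫ w, max (-M.pay (Function.update w j t) j) 0 ∂(Measure.pi D)

lemma interimNegPay_nonneg (j : Fin m) (t : BidderValuation n) : 0 ≤ M.interimNegPay D j t :=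
  integral_nonneg fun _ => le_max_right _ _

lemma integrable_interimNegPay (hM : M.IsWellPosed D T) (j : Fin m) :
    Integrable (M.interimNegPay D j) (D j) := by
  have hm : Measurable fun v : Profile m n => max (-M.pay v j) 0 :=
    (hM.measurable_pay j).neg.max measurable_const
  have h1 : Integrable (fun v => max (-M.pay v j) 0) (Measure.pi D) := by
    refine ⟨hm.aestronglyMeasurable, ?_⟩
    refine lt_of_le_of_lt (lintegral_mono fun v => ?_) (hM.lintegral_neg_pay j)
    rw [Real.enorm_eq_ofReal (le_max_right _ _), ENNReal.ofReal_max]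
    simp
  rw [← map_update_prod_pi D j] at h1
  exact (h1.comp_measurable (measurable_update_pair j)).integral_prod_left

end Mechanism

section Outcomes

open Mechanism

variable {m n k : ℕ} {M : Mechanism m n} {D Dp : Fin m → Measure (BidderValuation n)}
  [∀ j, IsProbabilityMeasure (D j)] [∀ j, IsProbabilityMeasure (Dp j)]
  {T : Fin m → Set (BidderValuation n)} {ε : ℝ}

lemma measurable_scaled_lottery (hM : M.IsWellPosed D T) (c : ℝ) :
    ∀ a, Measurable fun v => (M.scalePrices c).lottery v a := hM.measurable_lottery

lemma measurable_scaled_pay (hM : M.IsWellPosed D T) (c : ℝ) :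
    ∀ j, Measurable fun v => (M.scalePrices c).pay v j :=
  fun j => (hM.measurable_pay j).const_mul c

/-- The state law of a bidder in the replica–surrogate mechanism. -/
noncomputable def stateLaw (Dp : Fin m → Measure (BidderValuation n)) (hM : M.IsWellPosed D T)
    (ε : ℝ) (k : ℕ) (j : Fin m) (β : Measure (BidderValuation n)) : Measure (BidderState k n) :=
  bidderLaw (N := M.scalePrices (1 - ε)) Dp (measurable_scaled_lottery hM _)
    (measurable_scaled_pay hM _) D k j β

instance (hM : M.IsWellPosed D T) (j : Fin m) (β : Measure (BidderValuation n))
    [IsProbabilityMeasure β] : IsProbabilityMeasure (stateLaw Dp hM ε k j β) := by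
  unfold stateLaw; infer_instance

/-- The VCG price of bidder `j` in a given state. -/
noncomputable def stateVcgPrice (M : Mechanism m n) (D : Fin m → Measure (BidderValuation n))
    (ε : ℝ) (j : Fin m) (ω : BidderState k n) : ℝ :=
  vcgPrice (edgeWeight (M.scalePrices (1 - ε)) D j ω.1.1 ω.1.2) ω.2 0

lemma measurable_stateVcgPrice (hM : M.IsWellPosed D T) (j : Fin m) :
    Measurable (stateVcgPrice (k := k) M D ε j) :=
  measurable_from_prod_countable_left fun μ => measurable_vcgPrice
    (measurable_edgeWeight (measurable_scaled_lottery hM _) (measurable_scaled_pay hM _) j) μ 0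

/-- What bidder `j` pays, given her state and the reports of all surrogates. -/
noncomputable def statePay (M : Mechanism m n) (D : Fin m → Measure (BidderValuation n)) (ε : ℝ)
    (j : Fin m) (q : BidderState k n × Profile m n) : ℝ :=
  if 0 ∈ q.1.2.2 then stateVcgPrice M D ε j q.1 + (1 - ε) * M.pay q.2 j else 0

lemma measurableSet_state_matched {α : Type*} [MeasurableSpace α] :
    MeasurableSet {q : BidderState k n × α | (0 : Fin (k + 1)) ∈ q.1.2.2} :=
  measurable_fst (measurableSet_matched (Y := BidderValuation n × Draw k n) 0)

lemma measurable_statePay (hM : M.IsWellPosed D T) (j : Fin m) :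
    Measurable (statePay (k := k) M D ε j) :=
  Measurable.ite measurableSet_state_matched
    (((measurable_stateVcgPrice hM j).comp measurable_fst).add
      (((hM.measurable_pay j).comp measurable_snd).const_mul _)) measurable_const

/-- What the outcome is worth to bidder `j` with valuation `u`, given her state and the reports of
all surrogates. -/
noncomputable def stateValue (M : Mechanism m n) (j : Fin m) (u : BidderValuation n)
    (q : BidderState k n × Profile m n) : ℝ :=
  if 0 ∈ q.1.2.2 then M.lotteryValue j u q.2 else 0

lemma measurable_stateValue (hM : M.IsWellPosed D T) (j : Fin m) (u : BidderValuation n) :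
    Measurable (stateValue (k := k) M j u) :=
  Measurable.ite measurableSet_state_matched
    ((measurable_lotteryValue hM j).comp (measurable_const.prodMk measurable_snd))
    measurable_const

lemma abs_stateValue_le (hM : M.IsWellPosed D T) (j : Fin m) (u : BidderValuation n)
    (q : BidderState k n × Profile m n) : |stateValue M j u q| ≤ ∑ S, u.1 S := by
  unfold stateValue
  split_ifs
  · exact abs_lotteryValue_le hM j u _
  · simpa using Finset.sum_nonneg fun S _ => u.2.2 S

lemma replicaSurrogate_pay (v : Profile m n) (j : Fin m) :
    (replicaSurrogate M D Dp ε k).pay v j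
      = phaseOneAverage (k := k) (M.scalePrices (1 - ε)) D Dp
        (fun ω => statePay M D ε j (ω j, fun i => (ω i).surrogate)) v := by
  simp only [replicaSurrogate, phaseOneAverage, matchedBidders, Finset.mem_filter,
    Finset.mem_univ, true_and]
  rfl

/-- The probability of the allocation `a`, given the states of all bidders. -/
noncomputable def stateLottery (M : Mechanism m n) (a : Allocation m n)
    (ω : Fin m → BidderState k n) : ℝ :=
  ∑ b with restrictAllocation (matchedBidders fun j => (ω j).2) b = a,
    M.lottery (fun i => (ω i).surrogate) b

lemma replicaSurrogate_lottery (v : Profile m n) (a : Allocation m n) :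
    (replicaSurrogate M D Dp ε k).lottery v a
      = phaseOneAverage (k := k) (M.scalePrices (1 - ε)) D Dp (stateLottery M a) v := rfl

lemma measurable_stateLottery (hM : M.IsWellPosed D T) (a : Allocation m n) :
    Measurable (stateLottery (k := k) M a) := by
  have h1 : ∀ b, Measurable fun ω : Fin m → BidderState k n =>
      M.lottery (fun i => (ω i).surrogate) b := fun b =>
    (hM.measurable_lottery b).comp
      (measurable_pi_iff.2 fun i => measurable_surrogate.comp (measurable_pi_apply i))
  have h2 : Measurable fun ω : Fin m → BidderState k n => fun j => (ω j).2 := by fun_prop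
  unfold stateLottery
  simp_rw [Finset.sum_filter]
  refine Finset.measurable_sum _ fun b _ => Measurable.ite ?_ (h1 b) measurable_const
  exact h2 (MeasurableSet.of_discrete (s := {μ : Fin m → CompletedMatching (k + 1) |
    restrictAllocation (matchedBidders μ) b = a}))

lemma stateLottery_nonneg (hM : M.IsWellPosed D T) (a : Allocation m n)
    (ω : Fin m → BidderState k n) : 0 ≤ stateLottery M a ω :=
  Finset.sum_nonneg fun b _ => lottery_nonneg hM _ b

lemma sum_stateLottery_mul (ω : Fin m → BidderState k n) (f : Allocation m n → ℝ) :
    ∑ a, stateLottery M a ω * f a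
      = ∑ b, M.lottery (fun i => (ω i).surrogate) b
        * f (restrictAllocation (matchedBidders fun j => (ω j).2) b) := by
  simp only [stateLottery, Finset.sum_mul]
  refine Eq.trans ?_ (Finset.sum_fiberwise Finset.univ
    (restrictAllocation (matchedBidders fun j => (ω j).2)) _)
  refine Finset.sum_congr rfl fun a _ => Finset.sum_congr rfl fun b hb => ?_
  rw [(Finset.mem_filter.1 hb).2]

lemma sum_stateLottery (hM : M.IsWellPosed D T) (ω : Fin m → BidderState k n) :
    ∑ a, stateLottery M a ω = 1 := by
  have := sum_stateLottery_mul (M := M) ω fun _ => 1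
  simpa [sum_lottery hM] using this

lemma stateLottery_le_one (hM : M.IsWellPosed D T) (a : Allocation m n)
    (ω : Fin m → BidderState k n) : stateLottery M a ω ≤ 1 := by
  rw [← sum_stateLottery hM ω]
  exact Finset.single_le_sum (fun a _ => stateLottery_nonneg hM a ω) (Finset.mem_univ a)

lemma sum_stateLottery_mul_value (j : Fin m) (u : BidderValuation n)
    (ω : Fin m → BidderState k n) :
    ∑ a, stateLottery M a ω * u.1 (a.1 j)
      = stateValue M j u (ω j, fun i => (ω i).surrogate) := by
  rw [sum_stateLottery_mul]
  unfold stateValue lotteryValue restrictAllocation matchedBidders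
  by_cases h : (0 : Fin (k + 1)) ∈ (ω j).2.2
  · simp [h]
  · simp [h, u.2.1]

lemma integrable_expect_stateLottery (hM : M.IsWellPosed D T) (v : Profile m n)
    (a : Allocation m n) :
    Integrable (fun x : Fin m → Draw k n => (vcgMatchings (M.scalePrices (1 - ε)) D v x).expect
      fun μ => stateLottery M a (bidderStates ((v, x), μ))) (drawLaw D Dp k) := by
  have hm : StronglyMeasurable fun q : Profile m n × (Fin m → Draw k n) =>
      ∫ μ, stateLottery M a (bidderStates (q, μ)) ∂(vcgKernel (N := M.scalePrices (1 - ε)) (D := D)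
        (measurable_scaled_lottery hM _) (measurable_scaled_pay hM _) q) :=
    ((measurable_stateLottery hM a).comp
      measurable_bidderStates).stronglyMeasurable.integral_kernel_prod_right'
  simp_rw [← expect_eq_integral_vcgKernel] at hm
  refine Integrable.of_bound (hm.comp_measurable measurable_prodMk_left).aestronglyMeasurable 1
    (.of_forall fun x => ?_)
  rw [Real.norm_of_nonneg (Finset.expect_nonneg fun μ _ => stateLottery_nonneg hM a _)]
  exact Finset.expect_le (vcgMatchings_nonempty _ _) fun μ _ => stateLottery_le_one hM a _

lemma sum_replicaSurrogate_lottery_mul (hM : M.IsWellPosed D T) (v : Profile m n)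
    (f : Allocation m n → ℝ) :
    ∑ a, (replicaSurrogate M D Dp ε k).lottery v a * f a
      = phaseOneAverage (k := k) (M.scalePrices (1 - ε)) D Dp
        (fun ω => ∑ a, stateLottery M a ω * f a) v := by
  simp only [replicaSurrogate_lottery, phaseOneAverage]
  simp_rw [Finset.expect_sum_comm, ← Finset.expect_mul]
  rw [integral_finsetSum _ fun a _ => (integrable_expect_stateLottery hM v a).mul_const _]
  simp_rw [integral_mul_const]

lemma replicaSurrogate_lottery_mem (hM : M.IsWellPosed D T) (v : Profile m n) :
    (replicaSurrogate M D Dp ε k).lottery v ∈ stdSimplex ℝ (Allocation m n) := by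
  refine ⟨fun a => ?_, ?_⟩
  · rw [replicaSurrogate_lottery]
    exact integral_nonneg fun x => Finset.expect_nonneg fun μ _ => stateLottery_nonneg hM a _
  · have := sum_replicaSurrogate_lottery_mul (Dp := Dp) (ε := ε) (k := k) hM v fun _ => 1
    simp only [mul_one, sum_stateLottery hM, phaseOneAverage] at this
    rw [this]
    simp_rw [Finset.expect_const (vcgMatchings_nonempty _ _)]
    simp

end Outcomes

/-! ### Incentive compatibility and individual rationality -/

section Interim

open Mechanism

variable {m n k : ℕ} {M : Mechanism m n} {D Dp : Fin m → Measure (BidderValuation n)}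
  [∀ j, IsProbabilityMeasure (D j)] [∀ j, IsProbabilityMeasure (Dp j)]
  {T : Fin m → Set (BidderValuation n)} {ε : ℝ}

/-- Averages over phase 1 and the reports of the bidders other than `j`, who are truthful, reduce to
averages over the state of bidder `j` and an independent profile drawn from `D`. -/
lemma average_eq_integral_stateLaw (hM : M.IsWellPosed D T) {j : Fin m}
    (B : Fin m → Measure (BidderValuation n)) [∀ i, IsProbabilityMeasure (B i)]
    (hB : ∀ i, i ≠ j → B i = Dp i) {F : BidderState k n × Profile m n → ℝ} (hF : Measurable F)
    (hint : Integrable (fun q => F (q.1, Function.update q.2 j q.1.surrogate))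
      ((stateLaw Dp hM ε k j (B j)).prod (Measure.pi D))) :
    Integrable (phaseOneAverage (k := k) (M.scalePrices (1 - ε)) D Dp
        fun ω => F (ω j, fun i => (ω i).surrogate)) (Measure.pi B) ∧
      ∫ v, phaseOneAverage (k := k) (M.scalePrices (1 - ε)) D Dp
          (fun ω => F (ω j, fun i => (ω i).surrogate)) v ∂(Measure.pi B)
        = ∫ ω, ∫ w, F (ω, Function.update w j ω.surrogate) ∂(Measure.pi D)
          ∂(stateLaw Dp hM ε k j (B j)) := by
  have hl := measurable_scaled_lottery hM (1 - ε)
  have hp := measurable_scaled_pay hM (1 - ε)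
  have h1 := (integrable_state_surrogates_iff hl hp hB hF).2 hint
  refine ⟨integrable_phaseOneAverage hl hp B h1, ?_⟩
  rw [integral_phaseOneAverage hl hp B h1, integral_state_surrogates hl hp hB hF]
  exact integral_prod _ hint

lemma average_eq_integral_stateLaw_dirac (hM : M.IsWellPosed D T) (j : Fin m)
    (t : BidderValuation n) {F : BidderState k n × Profile m n → ℝ} (hF : Measurable F)
    (hint : Integrable (fun q => F (q.1, Function.update q.2 j q.1.surrogate))
      ((stateLaw Dp hM ε k j (Measure.dirac t)).prod (Measure.pi D))) :
    Integrable (fun w => phaseOneAverage (k := k) (M.scalePrices (1 - ε)) D Dp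
        (fun ω => F (ω j, fun i => (ω i).surrogate)) (Function.update w j t)) (Measure.pi Dp) ∧
      ∫ w, phaseOneAverage (k := k) (M.scalePrices (1 - ε)) D Dp
          (fun ω => F (ω j, fun i => (ω i).surrogate)) (Function.update w j t) ∂(Measure.pi Dp)
        = ∫ ω, ∫ w, F (ω, Function.update w j ω.surrogate) ∂(Measure.pi D)
          ∂(stateLaw Dp hM ε k j (Measure.dirac t)) := by
  have h := average_eq_integral_stateLaw (k := k) (ε := ε) hM
    (Function.update Dp j (Measure.dirac t))
    (fun i hi => Function.update_of_ne hi _ _) hF (by rwa [Function.update_self])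
  rw [Function.update_self, ← map_update_pi] at h
  refine ⟨h.1.comp_measurable (measurable_update_const j t), ?_⟩
  rw [← h.2, integral_map (measurable_update_const j t).aemeasurable h.1.aestronglyMeasurable]

/-- The expected payment of bidder `j` given her state. -/
noncomputable def stateInterimPay (M : Mechanism m n) (D : Fin m → Measure (BidderValuation n))
    (ε : ℝ) (j : Fin m) (ω : BidderState k n) : ℝ :=
  if 0 ∈ ω.2.2 then stateVcgPrice M D ε j ω + (1 - ε) * M.interimPay D j ω.surrogate else 0

/-- The expected value of her outcome to a bidder `j` with valuation `u`, given her state. -/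
noncomputable def stateInterimValue (M : Mechanism m n) (D : Fin m → Measure (BidderValuation n))
    (j : Fin m) (u : BidderValuation n) (ω : BidderState k n) : ℝ :=
  if 0 ∈ ω.2.2 then M.interimValue D j u ω.surrogate else 0

lemma integral_statePay (hM : M.IsWellPosed D T) {j : Fin m} {ω : BidderState k n}
    (hω : ω.surrogate ∈ T j) :
    ∫ w, statePay M D ε j (ω, Function.update w j ω.surrogate) ∂(Measure.pi D)
      = stateInterimPay M D ε j ω := by
  unfold statePay stateInterimPay
  dsimp only
  split_ifs with h
  · rw [integral_add (integrable_const _) ((hM.integrable_pay j _ hω).const_mul _),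
      integral_const_mul]
    simp [interimPay]
  · simp

lemma integral_stateValue (j : Fin m) (u : BidderValuation n) (ω : BidderState k n) :
    ∫ w, stateValue M j u (ω, Function.update w j ω.surrogate) ∂(Measure.pi D)
      = stateInterimValue M D j u ω := by
  unfold stateValue stateInterimValue
  dsimp only
  split_ifs with h
  · rfl
  · simp

lemma ae_stateLaw_surrogate_mem (hM : M.IsWellPosed D T) (hT : ∀ j, ∀ᵐ v ∂(D j), v ∈ T j)
    (j : Fin m) (β : Measure (BidderValuation n)) [IsProbabilityMeasure β] :
    ∀ᵐ ω ∂(stateLaw Dp hM ε k j β), ω.surrogate ∈ T j :=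
  ae_surrogate _ _ j β (hT j)

lemma ae_stateLaw_mem (hM : M.IsWellPosed D T) (j : Fin m) (β : Measure (BidderValuation n))
    [IsProbabilityMeasure β] :
    ∀ᵐ ω ∂(stateLaw Dp hM ε k j β),
      ω.2 ∈ maxMatchings (edgeWeight (M.scalePrices (1 - ε)) D j ω.1.1 ω.1.2) := by
  unfold stateLaw bidderLaw
  have h := ae_vcgLaw_mem (β.prod (bidderDrawLaw D Dp k j)) (measurable_edgeWeight (D := D) (k := k)
    (measurable_scaled_lottery hM (1 - ε)) (measurable_scaled_pay hM (1 - ε)) j)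
  exact h

lemma ae_stateLaw_dirac (hM : M.IsWellPosed D T) (j : Fin m) (t : BidderValuation n) :
    ∀ᵐ ω ∂(stateLaw Dp hM ε k j (Measure.dirac t)), ω.1.1 = t := by
  have h1 : MeasurePreserving (fun ω : BidderState k n => ω.1.1)
      (stateLaw Dp hM ε k j (Measure.dirac t)) (Measure.dirac t) :=
    measurePreserving_fst.comp ⟨measurable_fst, map_fst_vcgLaw _
      (measurable_edgeWeight (D := D) (k := k) (measurable_scaled_lottery hM (1 - ε))
        (measurable_scaled_pay hM (1 - ε)) j)⟩
  refine ae_of_ae_map (p := fun a => a = t) h1.measurable.aemeasurable ?_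
  rw [h1.map_eq, ae_dirac_eq]
  rfl

/-- A matched bidder with report `t` pays at most the value of her surrogate's outcome to her: the
VCG price makes up for what the surrogate's price leaves. -/
lemma stateVcgPrice_add_le {j : Fin m} {ω : BidderState k n}
    (hω : ω.2 ∈ maxMatchings (edgeWeight (M.scalePrices (1 - ε)) D j ω.1.1 ω.1.2))
    (h0 : 0 ∈ ω.2.2) :
    stateVcgPrice M D ε j ω + (1 - ε) * M.interimPay D j ω.surrogate
      ≤ M.interimValue D j ω.1.1 ω.surrogate := by
  have h := vcgPrice_le hω h0
  have e : edgeWeight (M.scalePrices (1 - ε)) D j ω.1.1 ω.1.2 0 (ω.2.1 0)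
      = M.interimValue D j ω.1.1 ω.surrogate - (1 - ε) * M.interimPay D j ω.surrogate := by
    rw [← scalePrices_interimPay]; rfl
  rw [e] at h
  unfold stateVcgPrice
  linarith

/-- For a fixed report the payment is integrable: its expectation given the state is bounded, and
the negative part of the surrogate's payment is integrable. -/
lemma integrable_statePay_dirac (hM : M.IsWellPosed D T) (hT : ∀ j, ∀ᵐ v ∂(D j), v ∈ T j)
    (hε1 : ε ≤ 1) (j : Fin m) (t : BidderValuation n) :
    Integrable (fun q : BidderState k n × Profile m n =>
        statePay M D ε j (q.1, Function.update q.2 j q.1.surrogate))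
      ((stateLaw Dp hM ε k j (Measure.dirac t)).prod (Measure.pi D)) := by
  have hm : Measurable fun q : BidderState k n × Profile m n =>
      statePay M D ε j (q.1, Function.update q.2 j q.1.surrogate) :=
    (measurable_statePay hM j).comp (measurable_state_update j)
  have hT' := ae_stateLaw_surrogate_mem (Dp := Dp) (ε := ε) (k := k) hM hT j (Measure.dirac t)
  have hmem := ae_stateLaw_mem (Dp := Dp) (ε := ε) (k := k) hM j (Measure.dirac t)
  have hdir := ae_stateLaw_dirac (Dp := Dp) (ε := ε) (k := k) hM j t
  have hn : Integrable (fun ω => M.interimNegPay D j ω.surrogate)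
      (stateLaw Dp hM ε k j (Measure.dirac t)) :=
    integrable_comp_surrogate _ _ j _ (integrable_interimNegPay hM j)
  rw [integrable_prod_iff hm.aestronglyMeasurable]
  constructor
  · filter_upwards [hT'] with ω hω
    unfold statePay
    dsimp only
    split_ifs
    · exact (integrable_const _).add ((hM.integrable_pay j _ hω).const_mul _)
    · exact integrable_zero _ _ _
  · refine Integrable.mono' (g := fun ω => ∑ S, t.1 S
        + 2 * (1 - ε) * M.interimNegPay D j ω.surrogate)
      ((integrable_const _).add (hn.const_mul _))
      hm.norm.stronglyMeasurable.integral_prod_right'.aestronglyMeasurable ?_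
    filter_upwards [hT', hmem, hdir] with ω hω hωm hωt
    rw [Real.norm_of_nonneg (integral_nonneg fun _ => norm_nonneg _)]
    have hsum : 0 ≤ ∑ S, t.1 S := Finset.sum_nonneg fun S _ => t.2.2 S
    have hneg : 0 ≤ M.interimNegPay D j ω.surrogate := interimNegPay_nonneg j _
    have hε : 0 ≤ 1 - ε := by linarith
    unfold statePay
    dsimp only
    split_ifs with h0
    · have hle := stateVcgPrice_add_le hωm h0
      have hval := interimValue_le hM j ω.1.1 ω.surrogate
      rw [hωt] at hle hval
      have hc : 0 ≤ stateVcgPrice M D ε j ω := vcgPrice_nonneg _ _ _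
      have hP := hM.integrable_pay j _ hω
      have hPn : Integrable (fun w => max (-M.pay (Function.update w j ω.surrogate) j) 0)
          (Measure.pi D) := hP.neg.pos_part
      have hPs : Integrable (fun w => M.pay (Function.update w j ω.surrogate) j
          + 2 * max (-M.pay (Function.update w j ω.surrogate) j) 0) (Measure.pi D) :=
        hP.add (hPn.const_mul 2)
      calc ∫ w, ‖stateVcgPrice M D ε j ω
              + (1 - ε) * M.pay (Function.update w j ω.surrogate) j‖ ∂(Measure.pi D)
          ≤ ∫ w, (stateVcgPrice M D ε j ω
              + (1 - ε) * (M.pay (Function.update w j ω.surrogate) j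
                + 2 * max (-M.pay (Function.update w j ω.surrogate) j) 0)) ∂(Measure.pi D) := by
            refine integral_mono
              ((integrable_const _).add (hP.const_mul _)).norm
              ((integrable_const _).add (hPs.const_mul _)) fun w => ?_
            refine (norm_add_le _ _).trans ?_
            rw [Real.norm_of_nonneg hc, norm_mul, Real.norm_of_nonneg hε]
            refine add_le_add le_rfl (mul_le_mul_of_nonneg_left ?_ hε)
            rw [Real.norm_eq_abs]
            rcases le_total 0 (M.pay (Function.update w j ω.surrogate) j) with h | h
            · rw [abs_of_nonneg h, max_eq_right (by linarith)]; linarith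
            · rw [abs_of_nonpos h, max_eq_left (by linarith)]; linarith
        _ = stateVcgPrice M D ε j ω + (1 - ε) * (M.interimPay D j ω.surrogate
              + 2 * M.interimNegPay D j ω.surrogate) := by
            rw [integral_add (integrable_const _) (hPs.const_mul _),
              integral_const_mul, integral_add hP (hPn.const_mul 2), integral_const_mul]
            simp [interimPay, interimNegPay]
        _ ≤ _ := by linarith
    · simp only [norm_zero, integral_zero]
      positivity

lemma integrable_stateValue (hM : M.IsWellPosed D T) (j : Fin m) (u : BidderValuation n)
    (β : Measure (BidderValuation n)) [IsProbabilityMeasure β] :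
    Integrable (fun q : BidderState k n × Profile m n =>
        stateValue M j u (q.1, Function.update q.2 j q.1.surrogate))
      ((stateLaw Dp hM ε k j β).prod (Measure.pi D)) :=
  Integrable.of_bound ((measurable_stateValue hM j u).comp
    (measurable_state_update j)).aestronglyMeasurable (∑ S, u.1 S)
    (.of_forall fun _ => abs_stateValue_le hM j u _)

/-- Interim payments in the replica–surrogate mechanism. -/
lemma replicaSurrogate_interimPay (hM : M.IsWellPosed D T) (hT : ∀ j, ∀ᵐ v ∂(D j), v ∈ T j)
    (hε1 : ε ≤ 1) (j : Fin m) (t : BidderValuation n) :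
    Integrable (stateInterimPay M D ε j) (stateLaw Dp hM ε k j (Measure.dirac t)) ∧
      (replicaSurrogate M D Dp ε k).interimPay Dp j t
        = ∫ ω, stateInterimPay M D ε j ω ∂(stateLaw Dp hM ε k j (Measure.dirac t)) := by
  have hint := integrable_statePay_dirac (Dp := Dp) (k := k) hM hT hε1 j t
  have hae : ∀ᵐ ω ∂(stateLaw Dp hM ε k j (Measure.dirac t)),
      ∫ w, statePay M D ε j (ω, Function.update w j ω.surrogate) ∂(Measure.pi D)
        = stateInterimPay M D ε j ω := by
    filter_upwards [ae_stateLaw_surrogate_mem (Dp := Dp) (ε := ε) (k := k) hM hT j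
      (Measure.dirac t)] with ω hω using integral_statePay hM hω
  refine ⟨hint.integral_prod_left.congr hae, ?_⟩
  unfold interimPay
  simp_rw [replicaSurrogate_pay]
  rw [(average_eq_integral_stateLaw_dirac hM j t (measurable_statePay hM j) hint).2]
  exact integral_congr_ae hae

/-- Interim values in the replica–surrogate mechanism. -/
lemma replicaSurrogate_interimValue (hM : M.IsWellPosed D T) (j : Fin m)
    (u t : BidderValuation n) :
    Integrable (stateInterimValue M D j u) (stateLaw Dp hM ε k j (Measure.dirac t)) ∧
      (replicaSurrogate M D Dp ε k).interimValue Dp j u t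
        = ∫ ω, stateInterimValue M D j u ω ∂(stateLaw Dp hM ε k j (Measure.dirac t)) := by
  have hint := integrable_stateValue (Dp := Dp) (ε := ε) (k := k) hM j u (Measure.dirac t)
  have h1 := hint.integral_prod_left
  simp only [integral_stateValue] at h1
  refine ⟨h1, ?_⟩
  unfold interimValue
  simp_rw [sum_replicaSurrogate_lottery_mul hM, sum_stateLottery_mul_value]
  rw [(average_eq_integral_stateLaw_dirac hM j t (measurable_stateValue hM j u) hint).2]
  simp only [integral_stateValue]

/-- The utility in the replica–surrogate mechanism of a bidder with valuation `u` and report `t` is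
her expected utility in the VCG matching. -/
lemma replicaSurrogate_utility (hM : M.IsWellPosed D T) (hT : ∀ j, ∀ᵐ v ∂(D j), v ∈ T j)
    (hε1 : ε ≤ 1) (j : Fin m) (u t : BidderValuation n) :
    Integrable (fun x : Draw k n => (maxMatchings (edgeWeight (M.scalePrices (1 - ε)) D j t x)).expect
        fun μ => if 0 ∈ μ.2 then edgeWeight (M.scalePrices (1 - ε)) D j u x 0 (μ.1 0)
          - vcgPrice (edgeWeight (M.scalePrices (1 - ε)) D j t x) μ 0 else 0)
        (bidderDrawLaw D Dp k j) ∧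
      (replicaSurrogate M D Dp ε k).interimValue Dp j u t
          - (replicaSurrogate M D Dp ε k).interimPay Dp j t
        = ∫ x, (maxMatchings (edgeWeight (M.scalePrices (1 - ε)) D j t x)).expect
          (fun μ => if 0 ∈ μ.2 then edgeWeight (M.scalePrices (1 - ε)) D j u x 0 (μ.1 0)
            - vcgPrice (edgeWeight (M.scalePrices (1 - ε)) D j t x) μ 0 else 0)
          ∂(bidderDrawLaw D Dp k j) := by
  obtain ⟨i1, e1⟩ := replicaSurrogate_interimPay (Dp := Dp) (k := k) hM hT hε1 j t
  obtain ⟨i2, e2⟩ := replicaSurrogate_interimValue (Dp := Dp) (ε := ε) (k := k) hM j u t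
  have key := integral_bidderLaw_dirac (measurable_scaled_lottery hM (1 - ε))
    (measurable_scaled_pay hM (1 - ε)) t (i2.sub i1)
  rw [e1, e2, ← integral_sub i2 i1]
  have heq : ∀ (x : Draw k n) (μ : CompletedMatching (k + 1)),
      (stateInterimValue M D j u - stateInterimPay M D ε j : BidderState k n → ℝ) ((t, x), μ)
        = if 0 ∈ μ.2 then edgeWeight (M.scalePrices (1 - ε)) D j u x 0 (μ.1 0)
            - vcgPrice (edgeWeight (M.scalePrices (1 - ε)) D j t x) μ 0 else 0 := by
    intro x μ
    simp only [Pi.sub_apply, stateInterimValue, stateInterimPay]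
    split_ifs with h
    · have e : edgeWeight (M.scalePrices (1 - ε)) D j u x 0 (μ.1 0)
          = M.interimValue D j u (x.2 (μ.1 0)) - (1 - ε) * M.interimPay D j (x.2 (μ.1 0)) := by
        rw [← scalePrices_interimPay]; rfl
      rw [e]
      unfold stateVcgPrice BidderState.surrogate
      ring
    · simp
  simp only [heq] at key
  exact key

lemma edgeWeight_congr_report (N : Mechanism m n) (j : Fin m) (t u : BidderValuation n)
    (x : Draw k n) : ∀ l, l ≠ 0 → edgeWeight N D j t x l = edgeWeight N D j u x l := by
  intro l hl
  obtain ⟨i, rfl⟩ := Fin.exists_succ_eq.2 hl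
  rfl

lemma replicaSurrogate_isBIC (hM : M.IsWellPosed D T) (hT : ∀ j, ∀ᵐ v ∂(D j), v ∈ T j)
    (hε1 : ε ≤ 1) : (replicaSurrogate M D Dp ε k).IsBIC Dp (fun _ => Set.univ) := by
  intro j u _ t _
  obtain ⟨i1, e1⟩ := replicaSurrogate_utility (Dp := Dp) (k := k) hM hT hε1 j u t
  obtain ⟨i2, e2⟩ := replicaSurrogate_utility (Dp := Dp) (k := k) hM hT hε1 j u u
  rw [e1, e2]
  refine integral_mono i1 i2 fun x => ?_
  obtain ⟨μ₀, hμ₀⟩ := maxMatchings_nonempty (edgeWeight (M.scalePrices (1 - ε)) D j u x)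
  have h1 := Finset.expect_le (maxMatchings_nonempty (edgeWeight (M.scalePrices (1 - ε)) D j t x))
    fun ν _ => vcg_utility_le hμ₀ (edgeWeight_congr_report (M.scalePrices (1 - ε)) j t u x) ν
  refine h1.trans (Finset.le_expect ⟨μ₀, hμ₀⟩ fun μ hμ => ?_)
  rw [vcg_utility_eq hμ]
  have := mem_maxMatchings.1 hμ μ₀
  linarith

lemma replicaSurrogate_isIR (hM : M.IsWellPosed D T) (hT : ∀ j, ∀ᵐ v ∂(D j), v ∈ T j)
    (hε1 : ε ≤ 1) : (replicaSurrogate M D Dp ε k).IsIR Dp (fun _ => Set.univ) := by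
  intro j u _
  obtain ⟨_, e2⟩ := replicaSurrogate_utility (Dp := Dp) (k := k) hM hT hε1 j u u
  rw [e2]
  refine integral_nonneg fun x => Finset.expect_nonneg fun μ hμ => ?_
  rw [vcg_utility_eq hμ]
  exact sub_nonneg.2 (maxWeightWithout_le hμ 0)

/-! ### Well-posedness -/

lemma measurable_statePay_profile (hM : M.IsWellPosed D T) (j : Fin m) :
    Measurable fun ω : Fin m → BidderState k n =>
      statePay M D ε j (ω j, fun i => (ω i).surrogate) :=
  (measurable_statePay hM j).comp (measurable_state_surrogates j)

lemma ofReal_neg_statePay_le (hε : 0 ≤ 1 - ε) (j : Fin m) (q : BidderState k n × Profile m n) :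
    ENNReal.ofReal (-statePay M D ε j q)
      ≤ ENNReal.ofReal (1 - ε) * ENNReal.ofReal (-M.pay q.2 j) := by
  rw [← ENNReal.ofReal_mul hε]
  unfold statePay
  split_ifs
  · refine ENNReal.ofReal_le_ofReal ?_
    have : 0 ≤ stateVcgPrice M D ε j q.1 := vcgPrice_nonneg _ _ _
    linarith
  · simp

/-- Under truthful play the profile of the surrogates has the law `D`. -/
lemma measurePreserving_surrogates (hM : M.IsWellPosed D T) :
    MeasurePreserving (fun ω : Fin m → BidderState k n => fun i => (ω i).surrogate)
      (Measure.pi fun j => stateLaw Dp hM ε k j (Dp j)) (Measure.pi D) :=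
  measurePreserving_pi _ _ fun i =>
    ⟨measurable_surrogate, map_surrogate (measurable_scaled_lottery hM (1 - ε))
      (measurable_scaled_pay hM (1 - ε)) i⟩

lemma lintegral_neg_statePay_lt_top (hM : M.IsWellPosed D T) (hε : 0 ≤ 1 - ε) (j : Fin m) :
    ∫⁻ ω : Fin m → BidderState k n,
      ENNReal.ofReal (-statePay M D ε j (ω j, fun i => (ω i).surrogate))
      ∂(Measure.pi fun j => stateLaw Dp hM ε k j (Dp j)) < ⊤ := by
  refine (lintegral_mono fun ω => ofReal_neg_statePay_le hε j _).trans_lt ?_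
  have hm : Measurable fun v : Profile m n => ENNReal.ofReal (-M.pay v j) :=
    (hM.measurable_pay j).neg.ennreal_ofReal
  have h1 := (measurePreserving_surrogates (Dp := Dp) (ε := ε) (k := k) hM).lintegral_comp hm
  have hm' : Measurable fun ω : Fin m → BidderState k n =>
      ENNReal.ofReal (-M.pay (fun i => (ω i).surrogate) j) :=
    hm.comp (measurePreserving_surrogates (Dp := Dp) (ε := ε) (k := k) hM).measurable
  dsimp only
  rw [lintegral_const_mul _ hm', h1]
  exact ENNReal.mul_lt_top ENNReal.ofReal_lt_top (hM.lintegral_neg_pay j)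

lemma measurable_replicaSurrogate_pay (hM : M.IsWellPosed D T) (j : Fin m) :
    Measurable fun v => (replicaSurrogate M D Dp ε k).pay v j := by
  simp_rw [replicaSurrogate_pay]
  exact measurable_phaseOneAverage (measurable_scaled_lottery hM _) (measurable_scaled_pay hM _)
    (measurable_statePay_profile hM j)

lemma replicaSurrogate_lintegral_neg_pay (hM : M.IsWellPosed D T) (hε : 0 ≤ 1 - ε) (j : Fin m) :
    ∫⁻ v, ENNReal.ofReal (-(replicaSurrogate M D Dp ε k).pay v j) ∂(Measure.pi Dp) < ⊤ := by
  simp_rw [replicaSurrogate_pay]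
  exact (lintegral_neg_phaseOneAverage_le (measurable_scaled_lottery hM _)
    (measurable_scaled_pay hM _) Dp (measurable_statePay_profile hM j)).trans_lt
    (lintegral_neg_statePay_lt_top hM hε j)

lemma replicaSurrogate_isWellPosed (hM : M.IsWellPosed D T) (hT : ∀ j, ∀ᵐ v ∂(D j), v ∈ T j)
    (hε1 : ε ≤ 1) : (replicaSurrogate M D Dp ε k).IsWellPosed Dp (fun _ => Set.univ) where
  lottery_mem := replicaSurrogate_lottery_mem hM
  measurable_lottery a := by
    simp_rw [replicaSurrogate_lottery]
    exact measurable_phaseOneAverage (measurable_scaled_lottery hM _)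
      (measurable_scaled_pay hM _) (measurable_stateLottery hM a)
  measurable_pay := measurable_replicaSurrogate_pay hM
  integrable_pay j t _ := by
    simp_rw [replicaSurrogate_pay]
    exact (average_eq_integral_stateLaw_dirac hM j t (measurable_statePay hM j)
      (integrable_statePay_dirac hM hT hε1 j t)).1
  lintegral_neg_pay := replicaSurrogate_lintegral_neg_pay hM (by linarith)

end Interim

/-! ### Pairing i.i.d. samples -/

section Pairing

/-- Points on the right can be injectively paired with points on the left of the same class, up to
the points outside the classes in `F` and the discrepancies between the class sizes. -/
lemma exists_classPairing {κ : Type*} [DecidableEq κ] {r : ℕ} (f g : Fin r → κ) (F : Finset κ) :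
    ∃ (good : Finset (Fin r)) (β : Fin r → Fin r), Set.InjOn β good ∧
      (∀ l ∈ good, f (β l) = g l) ∧
      ((goodᶜ.card : ℕ) : ℝ) ≤ ((Finset.univ.filter fun l => g l ∉ F).card : ℝ)
        + ∑ c ∈ F, |((Finset.univ.filter fun l => g l = c).card : ℝ)
          - ((Finset.univ.filter fun i => f i = c).card : ℝ)| := by
  have h : ∀ c : κ, ∃ (s : Finset (Fin r)) (β : Fin r → Fin r), Set.InjOn β s ∧
      (∀ l ∈ s, g l = c ∧ f (β l) = c) ∧
      (((Finset.univ.filter fun l => g l = c) \ s).card : ℝ)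
        ≤ |((Finset.univ.filter fun l => g l = c).card : ℝ)
          - ((Finset.univ.filter fun i => f i = c).card : ℝ)| := by
    intro c
    set R := Finset.univ.filter fun l => g l = c with hR
    set L := Finset.univ.filter fun i => f i = c with hL
    obtain ⟨s, hs, hcard⟩ := Finset.exists_subset_card_eq (min_le_left R.card L.card)
    obtain ⟨e⟩ : Nonempty (s ↪ L) := Function.Embedding.nonempty_of_card_le (by
      simp only [Fintype.card_coe, hcard]; exact min_le_right _ _)
    refine ⟨s, fun l => if hl : l ∈ s then e ⟨l, hl⟩ else l, ?_, ?_, ?_⟩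
    · intro a ha b hb hab
      rw [Finset.mem_coe] at ha hb
      simp only [ha, hb, dif_pos] at hab
      simpa using e.injective (Subtype.ext hab)
    · intro l hl
      refine ⟨(Finset.mem_filter.1 (hs hl)).2, ?_⟩
      simp only [hl, dif_pos]
      exact (Finset.mem_filter.1 (e ⟨l, hl⟩).2).2
    · rw [Finset.card_sdiff_of_subset hs, hcard, Nat.cast_sub (min_le_left _ _), Nat.cast_min]
      rcases le_total (R.card : ℝ) L.card with h | h
      · rw [min_eq_left h]; simp
      · rw [min_eq_right h]; exact le_abs_self _
  choose s β hinj hs hcard using h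
  refine ⟨F.biUnion s, fun l => β (g l) l, ?_, ?_, ?_⟩
  · intro a ha b hb hab
    simp only [Finset.coe_biUnion, Set.mem_iUnion, Finset.mem_coe] at ha hb
    obtain ⟨c, -, ha⟩ := ha
    obtain ⟨c', -, hb⟩ := hb
    have ea := (hs c a ha).1
    have eb := (hs c' b hb).1
    simp only [ea, eb] at hab
    have h1 := (hs c a ha).2
    have h2 := (hs c' b hb).2
    rw [hab, h2] at h1
    subst h1
    exact hinj _ ha hb hab
  · intro l hl
    obtain ⟨c, -, hl⟩ := Finset.mem_biUnion.1 hl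
    simp only [(hs c l hl).1, (hs c l hl).2]
  · have hsub : (F.biUnion s)ᶜ ⊆ (Finset.univ.filter fun l => g l ∉ F) ∪
        F.biUnion fun c => (Finset.univ.filter fun l => g l = c) \ s c := by
      intro l hl
      simp only [Finset.mem_compl, Finset.mem_biUnion, not_exists, not_and] at hl
      by_cases hF : g l ∈ F
      · refine Finset.mem_union_right _ (Finset.mem_biUnion.2 ⟨g l, hF, ?_⟩)
        simp [hl _ hF]
      · exact Finset.mem_union_left _ (by simp [hF])
    have h1 := (Finset.card_le_card hsub).trans ((Finset.card_union_le _ _).trans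
      (add_le_add le_rfl Finset.card_biUnion_le))
    calc ((F.biUnion s)ᶜ.card : ℝ) ≤ ((Finset.univ.filter fun l => g l ∉ F).card : ℝ)
          + ∑ c ∈ F, (((Finset.univ.filter fun l => g l = c) \ s c).card : ℝ) := by
            exact_mod_cast h1
      _ ≤ _ := add_le_add le_rfl (Finset.sum_le_sum fun c _ => hcard c)

variable {α : Type*} [MeasurableSpace α]

lemma card_filter_eq_sum_indicator {r : ℕ} (A : Set α) [DecidablePred (· ∈ A)] (x : Fin r → α) :
    ((Finset.univ.filter fun i => x i ∈ A).card : ℝ) = ∑ i, A.indicator 1 (x i) := by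
  rw [Finset.card_filter]
  push_cast
  refine Finset.sum_congr rfl fun i _ => ?_
  by_cases h : x i ∈ A <;> simp [h]

lemma memLp_indicator_one {ν : Measure α} [IsProbabilityMeasure ν] {A : Set α}
    (hA : MeasurableSet A) (p : ENNReal) : MemLp (A.indicator (1 : α → ℝ)) p ν :=
  (memLp_const (1 : ℝ)).indicator hA

/-- The number of points of an i.i.d. sample in a set deviates from its mean by at most `√r` in the
mean. -/
lemma integral_abs_count_sub_le (ν : Measure α) [IsProbabilityMeasure ν] {A : Set α}
    (hA : MeasurableSet A) (r : ℕ) :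
    Integrable (fun x : Fin r → α => |∑ i, A.indicator 1 (x i) - r * ν.real A|)
        (Measure.pi fun _ => ν) ∧
      ∫ x, |∑ i, A.indicator (1 : α → ℝ) (x i) - r * ν.real A| ∂(Measure.pi fun _ : Fin r => ν)
        ≤ √r := by
  set P := Measure.pi fun _ : Fin r => ν with hP
  have hone : ∀ i : Fin r, MemLp (fun x : Fin r → α => A.indicator (1 : α → ℝ) (x i)) 2 P := fun i =>
    (memLp_indicator_one hA 2).comp_measurePreserving (measurePreserving_eval _ i)
  have hsum : MemLp (fun x : Fin r → α => ∑ i, A.indicator (1 : α → ℝ) (x i)) 2 P :=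
    memLp_finsetSum _ fun i _ => hone i
  have hmean1 : ∀ i : Fin r, ∫ x, A.indicator (1 : α → ℝ) (x i) ∂P = ν.real A := fun i => by
    have h := (measurePreserving_eval (fun _ : Fin r => ν) i)
    have h2 : ∫ x, A.indicator (1 : α → ℝ) (Function.eval i x) ∂P
        = ∫ a, A.indicator (1 : α → ℝ) a ∂ν := by
      rw [← h.map_eq, integral_map h.measurable.aemeasurable]
      rw [h.map_eq]
      exact (memLp_indicator_one hA 2).aestronglyMeasurable
    exact h2.trans (integral_indicator_one hA)
  have hmean : ∫ x, ∑ i, A.indicator (1 : α → ℝ) (x i) ∂P = r * ν.real A := by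
    rw [integral_finsetSum _ fun i _ => (hone i).integrable one_le_two]
    simp [hmean1]
  have hdev : MemLp (fun x : Fin r → α => ∑ i, A.indicator (1 : α → ℝ) (x i) - r * ν.real A) 2 P :=
    hsum.sub (memLp_const _)
  have hi : Integrable (fun x : Fin r → α => |∑ i, A.indicator (1 : α → ℝ) (x i) - r * ν.real A|) P :=
    (hdev.integrable one_le_two).abs
  refine ⟨hi, ?_⟩
  have hvar1 : ∀ i : Fin r, ProbabilityTheory.variance (A.indicator (1 : α → ℝ)) ν ≤ 1 := fun i => by
    refine (ProbabilityTheory.variance_le_expectation_sq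
      (memLp_indicator_one hA 2).aestronglyMeasurable).trans ?_
    have : (A.indicator (1 : α → ℝ)) ^ 2 = A.indicator 1 := by
      ext a; by_cases h : a ∈ A <;> simp [h]
    rw [this, integral_indicator_one hA]
    exact measureReal_le_one
  have hvar : ProbabilityTheory.variance (fun x : Fin r → α => ∑ i, A.indicator (1 : α → ℝ) (x i)) P
      ≤ r := by
    have := ProbabilityTheory.variance_sum_pi (μ := fun _ : Fin r => ν)
      (X := fun _ => A.indicator (1 : α → ℝ)) fun i => memLp_indicator_one hA 2
    have e : (fun x : Fin r → α => ∑ i, A.indicator (1 : α → ℝ) (x i))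
        = ∑ i, fun x : Fin r → α => A.indicator (1 : α → ℝ) (x i) := by
      ext x; simp
    rw [e, hP, this]
    calc ∑ i : Fin r, ProbabilityTheory.variance (A.indicator (1 : α → ℝ)) ν
        ≤ ∑ i : Fin r, (1 : ℝ) := Finset.sum_le_sum fun i _ => hvar1 i
      _ = r := by simp
  have hsq : ∫ x, (∑ i, A.indicator (1 : α → ℝ) (x i) - r * ν.real A) ^ 2 ∂P ≤ r := by
    rw [ProbabilityTheory.variance_eq_integral hsum.aestronglyMeasurable.aemeasurable, hmean]
      at hvar
    exact hvar
  -- Nonnegativity of the variance of `|X|`, with `X` the deviation.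
  have hv := ProbabilityTheory.variance_nonneg
    (fun x : Fin r → α => |∑ i, A.indicator (1 : α → ℝ) (x i) - r * ν.real A|) P
  have habs : MemLp (fun x : Fin r → α => |∑ i, A.indicator (1 : α → ℝ) (x i) - r * ν.real A|) 2 P :=
    hdev.abs
  rw [ProbabilityTheory.variance_eq_sub habs] at hv
  refine Real.le_sqrt_of_sq_le ?_
  have e : ∫ x, ((fun x : Fin r → α => |∑ i, A.indicator (1 : α → ℝ) (x i) - r * ν.real A|) ^ 2) x ∂P
      = ∫ x, (∑ i, A.indicator (1 : α → ℝ) (x i) - r * ν.real A) ^ 2 ∂P := by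
    simp [sq_abs]
  rw [e] at hv
  linarith

end Pairing

/-! ### The revenue from one bidder -/

section Cells

variable {n : ℕ}

/-- The cell of a valuation in the grid of mesh `h`. -/
noncomputable def cell (h : ℝ) (v : BidderValuation n) : Finset (Fin n) → ℕ := fun S => ⌊v.1 S / h⌋₊

lemma measurable_cell (h : ℝ) : Measurable (cell (n := n) h) := by
  refine measurable_pi_iff.2 fun S => ?_
  exact ((Mechanism.measurable_apply_bundle S).div_const h).nat_floor

lemma abs_sub_le_of_cell_eq {h : ℝ} (hh : 0 < h) {u v : BidderValuation n} (huv : cell h u = cell h v)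
    (S : Finset (Fin n)) : |u.1 S - v.1 S| ≤ h := by
  have e : ⌊u.1 S / h⌋₊ = ⌊v.1 S / h⌋₊ := congrFun huv S
  have hu := div_nonneg (u.2.2 S) hh.le
  have hv := div_nonneg (v.2.2 S) hh.le
  have h1 := Nat.floor_le hu
  have h2 := Nat.lt_floor_add_one (u.1 S / h)
  have h3 := Nat.floor_le hv
  have h4 := Nat.lt_floor_add_one (v.1 S / h)
  rw [e] at h1 h2
  have h5 : |u.1 S / h - v.1 S / h| ≤ 1 := abs_le.2 ⟨by linarith, by linarith⟩
  rw [← sub_div, abs_div, abs_of_pos hh, div_le_one hh] at h5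
  exact h5

/-- Finitely many cells carry almost all of a probability measure. -/
lemma exists_finset_cells (ν : Measure (BidderValuation n)) [IsProbabilityMeasure ν] (h : ℝ)
    {η : ℝ} (hη : 0 < η) :
    ∃ F : Finset (Finset (Fin n) → ℕ), ν.real {v | cell h v ∉ F} < η := by
  set A : ℕ → Set (BidderValuation n) := fun K =>
    {v | cell h v ∉ Fintype.piFinset fun _ : Finset (Fin n) => Finset.range K} with hA
  have hmeas : ∀ K, MeasurableSet (A K) := fun K =>
    measurable_cell h (MeasurableSet.of_discrete (s := ((Fintype.piFinset
      fun _ : Finset (Fin n) => Finset.range K : Finset (Finset (Fin n) → ℕ)) :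
        Set (Finset (Fin n) → ℕ))ᶜ))
  have hmono : Antitone A := by
    intro K K' hK v hv
    simp only [hA, Fintype.mem_piFinset, Finset.mem_range, not_forall, Set.mem_ofPred_eq] at hv ⊢
    obtain ⟨S, hS⟩ := hv
    exact ⟨S, fun h' => hS (h'.trans_le hK)⟩
  have hempty : ⋂ K : ℕ, A K = ∅ := by
    refine Set.eq_empty_of_forall_notMem fun v hv => ?_
    have := Set.mem_iInter.1 hv (∑ S, cell h v S + 1)
    simp only [hA, Fintype.mem_piFinset, Finset.mem_range, Set.mem_ofPred_eq] at this
    exact this fun S => Nat.lt_succ_of_le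
      (Finset.single_le_sum (f := cell h v) (fun _ _ => Nat.zero_le _) (Finset.mem_univ S))
  have hlim := tendsto_measure_iInter_atTop (μ := ν)
    (fun K => (hmeas K).nullMeasurableSet) hmono ⟨0, measure_ne_top _ _⟩
  rw [hempty, measure_empty] at hlim
  have hlim' := (ENNReal.tendsto_toReal ENNReal.zero_ne_top).comp hlim
  obtain ⟨K, hK⟩ := (hlim'.eventually (gt_mem_nhds (by simpa using hη))).exists
  exact ⟨_, hK⟩

end Cells

section OneBidder

open Mechanism

variable {m n k : ℕ} {M : Mechanism m n} {D Dp : Fin m → Measure (BidderValuation n)}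
  [∀ j, IsProbabilityMeasure (D j)] [∀ j, IsProbabilityMeasure (Dp j)]
  {T : Fin m → Set (BidderValuation n)} {ε : ℝ}

lemma interimValue_sub (hM : M.IsWellPosed D T) (j : Fin m) (u u' s : BidderValuation n) :
    M.interimValue D j u s - M.interimValue D j u' s
      = ∫ w, ∑ a, M.lottery (Function.update w j s) a * (u.1 (a.1 j) - u'.1 (a.1 j))
        ∂(Measure.pi D) := by
  rw [interimValue_eq, interimValue_eq, ← integral_sub (integrable_lotteryValue hM j u s)
    (integrable_lotteryValue hM j u' s)]
  simp only [lotteryValue, mul_sub, Finset.sum_sub_distrib]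

lemma interimValue_mono (hM : M.IsWellPosed D T) (j : Fin m) {u u' : BidderValuation n}
    (h : ∀ S, u'.1 S ≤ u.1 S) (s : BidderValuation n) :
    M.interimValue D j u' s ≤ M.interimValue D j u s := by
  rw [← sub_nonneg, interimValue_sub hM]
  exact integral_nonneg fun w => Finset.sum_nonneg fun a _ =>
    mul_nonneg (lottery_nonneg hM _ a) (sub_nonneg.2 (h _))

lemma interimValue_le_add (hM : M.IsWellPosed D T) (j : Fin m) {u u' : BidderValuation n} {h : ℝ}
    (huu : ∀ S, u.1 S ≤ u'.1 S + h) (s : BidderValuation n) :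
    M.interimValue D j u s ≤ M.interimValue D j u' s + h := by
  have hle : ∀ v, M.lotteryValue j u v ≤ M.lotteryValue j u' v + h := fun v => by
    have : M.lotteryValue j u' v + h = ∑ a, M.lottery v a * (u'.1 (a.1 j) + h) := by
      simp only [lotteryValue, mul_add, Finset.sum_add_distrib, ← Finset.sum_mul, sum_lottery hM,
        one_mul]
    rw [this]
    exact Finset.sum_le_sum fun a _ => mul_le_mul_of_nonneg_left (huu _) (lottery_nonneg hM v a)
  have hi := integrable_lotteryValue hM j u' s
  calc M.interimValue D j u s
      ≤ ∫ w, (M.lotteryValue j u' (Function.update w j s) + h) ∂(Measure.pi D) :=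
        integral_mono (integrable_lotteryValue hM j u s) (hi.add (integrable_const h))
          fun w => hle _
    _ = _ := by
      rw [integral_add hi (integrable_const h), interimValue_eq]
      simp

/-- The interim price of bidder `j`, truncated at `N`. -/
noncomputable def truncatedPay (M : Mechanism m n) (D : Fin m → Measure (BidderValuation n))
    (j : Fin m) (N : ℝ) (s : BidderValuation n) : ℝ := min (M.interimPay D j s) N

lemma neg_interimNegPay_le (hM : M.IsWellPosed D T) {j : Fin m} {s : BidderValuation n}
    (hs : s ∈ T j) : -M.interimNegPay D j s ≤ M.interimPay D j s := by
  unfold interimNegPay interimPay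
  rw [← integral_neg]
  have hP := hM.integrable_pay j s hs
  refine integral_mono hP.neg.pos_part.neg hP fun w => ?_
  have := le_max_left (-M.pay (Function.update w j s) j) 0
  dsimp only
  linarith

lemma integrable_truncatedPay (hM : M.IsWellPosed D T) (hT : ∀ j, ∀ᵐ v ∂(D j), v ∈ T j)
    (j : Fin m) (N : ℝ) : Integrable (truncatedPay M D j N) (D j) := by
  have hm : Measurable (truncatedPay M D j N) :=
    (measurable_interimPay (hM.measurable_pay j)).min measurable_const
  refine Integrable.mono' ((integrable_interimNegPay hM j).add (integrable_const |N|))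
    hm.aestronglyMeasurable ?_
  filter_upwards [hT j] with s hs
  have h1 := neg_interimNegPay_le hM hs
  have h2 : 0 ≤ M.interimNegPay D j s := interimNegPay_nonneg j s
  rw [Real.norm_eq_abs, Pi.add_apply, truncatedPay]
  refine abs_le.2 ⟨?_, (min_le_right _ _).trans (by linarith [le_abs_self N])⟩
  rcases min_cases (M.interimPay D j s) N with ⟨h, _⟩ | ⟨h, _⟩ <;> rw [h]
  · linarith [abs_nonneg N]
  · linarith [neg_abs_le N]

/-- A left type of bidder `j` in the analysis is a coupled pair `a = (v⁺, v)`: `v⁺` is the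
valuation of the bidder or replica and `v` is her shadow, which has the law of the surrogates. The
excess is what the outcome of `s` is worth more to `v⁺` than to `v`. -/
noncomputable def excess (M : Mechanism m n) (D : Fin m → Measure (BidderValuation n)) (j : Fin m)
    (a : BidderValuation n × BidderValuation n) (s : BidderValuation n) : ℝ :=
  M.interimValue D j a.1 s - M.interimValue D j a.2 s

/-- The sampled coupled left types and surrogates of a bidder, with the chosen matching. -/
abbrev ShadowState (k n : ℕ) : Type :=
  ((Fin (k + 1) → BidderValuation n × BidderValuation n) × (Fin (k + 1) → BidderValuation n))
    × CompletedMatching (k + 1)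

/-- An upper bound for the number of surrogates without a partner whose shadow is in the same cell,
only the cells in `F` being considered. -/
noncomputable def unpaired (h : ℝ) (F : Finset (Finset (Fin n) → ℕ))
    (y : (Fin (k + 1) → BidderValuation n × BidderValuation n) × (Fin (k + 1) → BidderValuation n)) :
    ℝ :=
  ((Finset.univ.filter fun l => cell h (y.2 l) ∉ F).card : ℝ)
    + ∑ c ∈ F, |((Finset.univ.filter fun l => cell h (y.2 l) = c).card : ℝ)
      - ((Finset.univ.filter fun i => cell h (y.1 i).2 = c).card : ℝ)|

/-- The surrogates that the maximum-weight matching uses pay almost as much as all surrogates: the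
paired surrogates fulfil the hypotheses of `sum_good_sub_sum_matched_le` because truthful reporting
is optimal and individually rational for the shadows. -/
lemma matched_pay_ge (hM : M.IsWellPosed D T) (hBIC : M.IsBIC D T) (hIR : M.IsIR D T)
    (hε0 : 0 < ε) (j : Fin m) {h N : ℝ} (hh : 0 < h) (hN : 0 ≤ N)
    (F : Finset (Finset (Fin n) → ℕ)) (z : ShadowState k n)
    (hz : z.2 ∈ maxMatchings (typeWeight
      (fun a s => edgeUtility (M.scalePrices (1 - ε)) D j (Prod.fst a) s) (k + 1) z.1))
    (hzT : ∀ l, z.1.2 l ∈ T j) (hzle : ∀ i S, (z.1.1 i).2.1 S ≤ (z.1.1 i).1.1 S) :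
    ∑ l, truncatedPay M D j N (z.1.2 l) - N * unpaired h F z.1
        - (2 * h * (k + 1 : ℕ) + ∑ i ∈ z.2.2, excess M D j (z.1.1 i) (z.1.2 (z.2.1 i))) / ε
      ≤ ∑ i ∈ z.2.2, M.interimPay D j (z.1.2 (z.2.1 i)) := by
  classical
  obtain ⟨⟨a, s⟩, μ⟩ := z
  dsimp only at *
  obtain ⟨good, β, hβ, hcell, hcard⟩ :=
    exists_classPairing (fun i => cell h (a i).2) (fun l => cell h (s l)) F
  have hclose : ∀ l ∈ good, ∀ S, |(a (β l)).2.1 S - (s l).1 S| ≤ h := fun l hl S =>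
    abs_sub_le_of_cell_eq hh (hcell l hl) S
  have hw : ∀ i l, typeWeight
      (fun a s => edgeUtility (M.scalePrices (1 - ε)) D j (Prod.fst a) s) (k + 1) (a, s) i l
      = M.interimValue D j (a i).1 (s l) - (1 - ε) * M.interimPay D j (s l) := fun i l => by
    rw [← scalePrices_interimPay]; rfl
  have hexc : ∀ i l, 0 ≤ excess M D j (a i) (s l) := fun i l =>
    sub_nonneg.2 (interimValue_mono hM j (hzle i) _)
  have key := sum_good_sub_sum_matched_le hz (fun l => M.interimPay D j (s l))
    (fun l => M.interimValue D j (s l) (s l) - M.interimPay D j (s l))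
    (fun i l => excess M D j (a i) (s l)) hexc (fun l => hIR j _ (hzT l)) hh.le hε0.le good β hβ
    (fun l hl => by
      have h1 := interimValue_le_add hM j (u := s l) (u' := (a (β l)).2) (h := h)
        (fun S => by linarith [(abs_le.1 (hclose l hl S)).1]) (s l)
      have h2 := interimValue_mono hM j (hzle (β l)) (s l)
      rw [hw]
      linarith)
    (fun l hl l' => by
      have h1 := interimValue_le_add hM j (u := (a (β l)).2) (u' := s l) (h := h)
        (fun S => by linarith [(abs_le.1 (hclose l hl S)).2]) (s l')
      have h2 := hBIC j _ (hzT l) _ (hzT l')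
      rw [hw]
      unfold excess
      linarith)
  have hcount : ((goodᶜ.card : ℕ) : ℝ) ≤ unpaired h F (a, s) := hcard
  have htrunc : ∑ l, truncatedPay M D j N (s l) - N * (goodᶜ.card : ℝ)
      ≤ ∑ l ∈ good, M.interimPay D j (s l) - ∑ l ∈ goodᶜ, max (-M.interimPay D j (s l)) 0 := by
    rw [← Finset.sum_add_sum_compl good]
    have h1 : ∑ l ∈ good, truncatedPay M D j N (s l) ≤ ∑ l ∈ good, M.interimPay D j (s l) :=
      Finset.sum_le_sum fun l _ => min_le_left _ _
    have h2 : ∑ l ∈ goodᶜ, truncatedPay M D j N (s l)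
        ≤ ∑ l ∈ goodᶜ, (N - max (-M.interimPay D j (s l)) 0) := by
      refine Finset.sum_le_sum fun l _ => ?_
      unfold truncatedPay
      rcases le_total 0 (M.interimPay D j (s l)) with hp | hp
      · rw [max_eq_right (by linarith)]; linarith [min_le_right (M.interimPay D j (s l)) N]
      · rw [max_eq_left (by linarith)]; linarith [min_le_left (M.interimPay D j (s l)) N]
    rw [Finset.sum_sub_distrib, Finset.sum_const, nsmul_eq_mul] at h2
    linarith
  have hNb := mul_le_mul_of_nonneg_left hcount hN
  rw [← le_div_iff₀' hε0] at key
  linarith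

end OneBidder

/-! ### The expected price of a matched surrogate -/

lemma integral_comp_of_measurePreserving {α β : Type*} [MeasurableSpace α] [MeasurableSpace β]
    {μ : Measure α} {ν : Measure β} {T : α → β} (hT : MeasurePreserving T μ ν) {f : β → ℝ}
    (hf : AEStronglyMeasurable f ν) : ∫ a, f (T a) ∂μ = ∫ b, f b ∂ν := by
  rw [← hT.map_eq] at hf ⊢
  rw [integral_map hT.measurable.aemeasurable hf]

section Shadow

open Mechanism

variable {m n k : ℕ} {M : Mechanism m n} {D Dp : Fin m → Measure (BidderValuation n)}
  [∀ j, IsProbabilityMeasure (D j)] [∀ j, IsProbabilityMeasure (Dp j)]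
  {T : Fin m → Set (BidderValuation n)} {ε : ℝ}

/-- The law of the shadow state of bidder `j`, if left types are sampled from the coupling `c`. -/
noncomputable def shadowLaw (hM : M.IsWellPosed D T) (ε : ℝ) (k : ℕ) (j : Fin m)
    (c : Measure (BidderValuation n × BidderValuation n)) : Measure (ShadowState k n) :=
  vcgLaw ((Measure.pi fun _ : Fin (k + 1) => c).prod (Measure.pi fun _ : Fin (k + 1) => D j))
    (measurable_typeWeight
      (g := fun a s => edgeUtility (M.scalePrices (1 - ε)) D j (Prod.fst a) s)
      (measurable_edgeUtility_comp (D := D) (measurable_scaled_lottery hM (1 - ε))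
        (measurable_scaled_pay hM (1 - ε)) measurable_fst j) (k + 1))

variable {c : Measure (BidderValuation n × BidderValuation n)} [IsProbabilityMeasure c]

instance (hM : M.IsWellPosed D T) (j : Fin m) : IsProbabilityMeasure (shadowLaw hM ε k j c) := by
  unfold shadowLaw; infer_instance

lemma measurePreserving_shadow_fst (hM : M.IsWellPosed D T) (j : Fin m) :
    MeasurePreserving Prod.fst (shadowLaw hM ε k j c)
      ((Measure.pi fun _ : Fin (k + 1) => c).prod (Measure.pi fun _ : Fin (k + 1) => D j)) := by
  refine ⟨measurable_fst, ?_⟩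
  unfold shadowLaw
  exact map_fst_vcgLaw _ _

lemma measurePreserving_shadow_right (hM : M.IsWellPosed D T) (j : Fin m) :
    MeasurePreserving (fun z : ShadowState k n => z.1.2) (shadowLaw hM ε k j c)
      (Measure.pi fun _ : Fin (k + 1) => D j) :=
  measurePreserving_snd.comp (measurePreserving_shadow_fst hM j)

lemma measurePreserving_shadow_left (hM : M.IsWellPosed D T) (j : Fin m) :
    MeasurePreserving (fun z : ShadowState k n => z.1.1) (shadowLaw hM ε k j c)
      (Measure.pi fun _ : Fin (k + 1) => c) :=
  measurePreserving_fst.comp (measurePreserving_shadow_fst hM j)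

section

variable {F : (BidderValuation n × BidderValuation n) × BidderValuation n × Prop → ℝ}

lemma integrable_slot_iff (hM : M.IsWellPosed D T) (j : Fin m) (hF : Measurable F)
    (i : Fin (k + 1)) :
    Integrable (fun z => F (slot i z)) (shadowLaw hM ε k j c)
      ↔ Integrable (fun z => F (slot 0 z)) (shadowLaw hM ε k j c) := by
  have h1 := integrable_map_measure (μ := shadowLaw hM ε k j c) hF.aestronglyMeasurable
    (measurable_slot i).aemeasurable
  have h2 := integrable_map_measure (μ := shadowLaw hM ε k j c) hF.aestronglyMeasurable
    (measurable_slot (0 : Fin (k + 1))).aemeasurable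
  unfold shadowLaw at *
  rw [map_slot_eq c (D j) (measurable_edgeUtility_comp (D := D) (measurable_scaled_lottery hM (1 - ε))
    (measurable_scaled_pay hM (1 - ε)) measurable_fst j) i 0] at h1
  exact h1.symm.trans h2

lemma integral_slot (hM : M.IsWellPosed D T) (j : Fin m) (hF : Measurable F) (i : Fin (k + 1)) :
    ∫ z, F (slot i z) ∂(shadowLaw hM ε k j c) = ∫ z, F (slot 0 z) ∂(shadowLaw hM ε k j c) := by
  have h1 := integral_map (μ := shadowLaw hM ε k j c) (measurable_slot i).aemeasurable
    (hF.aestronglyMeasurable)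
  have h2 := integral_map (μ := shadowLaw hM ε k j c) (measurable_slot (0 : Fin (k + 1))).aemeasurable
    (hF.aestronglyMeasurable)
  unfold shadowLaw at *
  rw [map_slot_eq c (D j) (measurable_edgeUtility_comp (D := D) (measurable_scaled_lottery hM (1 - ε))
    (measurable_scaled_pay hM (1 - ε)) measurable_fst j) i 0] at h1
  exact h1.symm.trans h2

end

open Classical in
/-- The interim price of the surrogate of a left node, if the node is matched. -/
noncomputable def slotPay (M : Mechanism m n) (D : Fin m → Measure (BidderValuation n)) (j : Fin m)
    (q : (BidderValuation n × BidderValuation n) × BidderValuation n × Prop) : ℝ :=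
  if q.2.2 then M.interimPay D j q.2.1 else 0

open Classical in
/-- The excess of a left node for the outcome of her surrogate, if the node is matched. -/
noncomputable def slotExcess (M : Mechanism m n) (D : Fin m → Measure (BidderValuation n))
    (j : Fin m) (q : (BidderValuation n × BidderValuation n) × BidderValuation n × Prop) : ℝ :=
  if q.2.2 then excess M D j q.1 q.2.1 else 0

lemma measurable_slotPay (hM : M.IsWellPosed D T) (j : Fin m) : Measurable (slotPay M D j) := by
  refine Measurable.ite (measurableSet_setOfPred.2 (measurable_snd.comp measurable_snd)) ?_
    measurable_const
  exact (measurable_interimPay (hM.measurable_pay j)).comp (measurable_fst.comp measurable_snd)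

lemma measurable_excess (hM : M.IsWellPosed D T) (j : Fin m) :
    Measurable fun q : (BidderValuation n × BidderValuation n) × BidderValuation n =>
      excess M D j q.1 q.2 := by
  have h := measurable_interimValue (D := D) hM.measurable_lottery j
  have h1 := h.comp (f := fun q : (BidderValuation n × BidderValuation n) × BidderValuation n =>
    (q.1.1, q.2)) (by fun_prop)
  have h2 := h.comp (f := fun q : (BidderValuation n × BidderValuation n) × BidderValuation n =>
    (q.1.2, q.2)) (by fun_prop)
  have h3 := h1.sub h2
  exact h3

lemma measurable_slotExcess (hM : M.IsWellPosed D T) (j : Fin m) :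
    Measurable (slotExcess M D j) := by
  refine Measurable.ite (measurableSet_setOfPred.2 (measurable_snd.comp measurable_snd)) ?_
    measurable_const
  have h := (measurable_excess (D := D) hM j).comp
    (f := fun q : (BidderValuation n × BidderValuation n) × BidderValuation n × Prop =>
      (q.1, q.2.1)) (by fun_prop)
  exact h

/-- A bound for `unpaired` in terms of the deviations of counts from their means. -/
lemma unpaired_le (h : ℝ) (F : Finset (Finset (Fin n) → ℕ)) (q : (Finset (Fin n) → ℕ) → ℝ)
    (y : (Fin (k + 1) → BidderValuation n × BidderValuation n) × (Fin (k + 1) → BidderValuation n)) :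
    unpaired h F y ≤ ∑ l, {v | cell h v ∉ F}.indicator 1 (y.2 l)
      + ∑ c ∈ F, (|∑ l, {v | cell h v = c}.indicator 1 (y.2 l) - q c|
        + |∑ i, {v | cell h v = c}.indicator 1 ((y.1 i).2) - q c|) := by
  classical
  unfold unpaired
  refine add_le_add (le_of_eq ?_) (Finset.sum_le_sum fun c _ => ?_)
  · rw [← card_filter_eq_sum_indicator {v | cell h v ∉ F}]
    congr
  · rw [← card_filter_eq_sum_indicator {v | cell h v = c},
      ← card_filter_eq_sum_indicator {v | cell h v = c} (fun i => (y.1 i).2)]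
    refine le_trans (le_of_eq ?_) (abs_sub_le _ (q c) _ |>.trans
      (add_le_add le_rfl (abs_sub_comm _ _).le))
    congr

/-- In the mean only few surrogates are unpaired. -/
lemma integral_unpaired_bound (hM : M.IsWellPosed D T) (j : Fin m) (hc : c.map Prod.snd = D j)
    (h : ℝ) (F : Finset (Finset (Fin n) → ℕ)) :
    ∃ U : ShadowState k n → ℝ, (∀ z, unpaired h F z.1 ≤ U z) ∧
      Integrable U (shadowLaw hM ε k j c) ∧
      ∫ z, U z ∂(shadowLaw hM ε k j c)
        ≤ (k + 1 : ℕ) * (D j).real {v | cell h v ∉ F} + 2 * F.card * √(k + 1 : ℕ) := by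
  set γ := shadowLaw hM ε k j c with hγ
  set A : (Finset (Fin n) → ℕ) → Set (BidderValuation n) := fun e => {v | cell h v = e} with hA
  have hAm : ∀ e, MeasurableSet (A e) := fun e => measurable_cell h (.singleton e)
  have hBm : MeasurableSet {v : BidderValuation n | cell h v ∉ F} :=
    measurable_cell h (MeasurableSet.of_discrete (s := {e | e ∉ F}))
  have hR := measurePreserving_shadow_right (ε := ε) (k := k) (c := c) hM j
  have hsnd : MeasurePreserving (fun a : Fin (k + 1) → BidderValuation n × BidderValuation n =>
      fun i => (a i).2) (Measure.pi fun _ => c) (Measure.pi fun _ => D j) :=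
    measurePreserving_pi _ _ fun _ => ⟨measurable_snd, hc⟩
  have hL := hsnd.comp (measurePreserving_shadow_left (ε := ε) (k := k) (c := c) hM j)
  have hdev := fun e => integral_abs_count_sub_le (D j) (hAm e) (k + 1)
  have i1 : ∀ l : Fin (k + 1), Integrable (fun z : ShadowState k n =>
      {v | cell h v ∉ F}.indicator (1 : BidderValuation n → ℝ) (z.1.2 l)) γ := fun l => by
    have h1 := (measurePreserving_eval (fun _ : Fin (k + 1) => D j) l).comp hR
    exact h1.integrable_comp_of_integrable ((memLp_indicator_one hBm 1).integrable le_rfl)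
  have e1 : ∀ l : Fin (k + 1), ∫ z : ShadowState k n,
      {v | cell h v ∉ F}.indicator (1 : BidderValuation n → ℝ) (z.1.2 l) ∂γ
        = (D j).real {v | cell h v ∉ F} := fun l => by
    have h1 := (measurePreserving_eval (fun _ : Fin (k + 1) => D j) l).comp hR
    have h2 := integral_comp_of_measurePreserving h1
      (memLp_indicator_one (ν := D j) hBm 1).aestronglyMeasurable
    exact h2.trans (integral_indicator_one hBm)
  have i2 : ∀ e, Integrable (fun z : ShadowState k n => |∑ l, (A e).indicator
      (1 : BidderValuation n → ℝ) (z.1.2 l) - (k + 1 : ℕ) * (D j).real (A e)|) γ := fun e =>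
    hR.integrable_comp_of_integrable (hdev e).1
  have i3 : ∀ e, Integrable (fun z : ShadowState k n => |∑ i, (A e).indicator
      (1 : BidderValuation n → ℝ) ((z.1.1 i).2) - (k + 1 : ℕ) * (D j).real (A e)|) γ := fun e =>
    hL.integrable_comp_of_integrable (hdev e).1
  have e2 : ∀ e, ∫ z : ShadowState k n, |∑ l, (A e).indicator
      (1 : BidderValuation n → ℝ) (z.1.2 l) - (k + 1 : ℕ) * (D j).real (A e)| ∂γ
        ≤ √(k + 1 : ℕ) := fun e =>
    (integral_comp_of_measurePreserving hR (hdev e).1.aestronglyMeasurable).trans_le (hdev e).2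
  have e3 : ∀ e, ∫ z : ShadowState k n, |∑ i, (A e).indicator
      (1 : BidderValuation n → ℝ) ((z.1.1 i).2) - (k + 1 : ℕ) * (D j).real (A e)| ∂γ
        ≤ √(k + 1 : ℕ) := fun e =>
    (integral_comp_of_measurePreserving hL (hdev e).1.aestronglyMeasurable).trans_le (hdev e).2
  have i23 : ∀ e, Integrable (fun z : ShadowState k n => |∑ l, (A e).indicator
      (1 : BidderValuation n → ℝ) (z.1.2 l) - (k + 1 : ℕ) * (D j).real (A e)|
        + |∑ i, (A e).indicator (1 : BidderValuation n → ℝ) ((z.1.1 i).2)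
          - (k + 1 : ℕ) * (D j).real (A e)|) γ := fun e => (i2 e).add (i3 e)
  have s1 : Integrable (fun z : ShadowState k n => ∑ l,
      {v | cell h v ∉ F}.indicator (1 : BidderValuation n → ℝ) (z.1.2 l)) γ :=
    integrable_finsetSum _ fun l _ => i1 l
  have s2 : Integrable (fun z : ShadowState k n => ∑ e ∈ F, (|∑ l, (A e).indicator
      (1 : BidderValuation n → ℝ) (z.1.2 l) - (k + 1 : ℕ) * (D j).real (A e)|
        + |∑ i, (A e).indicator (1 : BidderValuation n → ℝ) ((z.1.1 i).2)
          - (k + 1 : ℕ) * (D j).real (A e)|)) γ :=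
    integrable_finsetSum _ fun e _ => i23 e
  refine ⟨fun z => ∑ l, {v | cell h v ∉ F}.indicator (1 : BidderValuation n → ℝ) (z.1.2 l)
      + ∑ e ∈ F, (|∑ l, (A e).indicator (1 : BidderValuation n → ℝ) (z.1.2 l)
          - (k + 1 : ℕ) * (D j).real (A e)|
        + |∑ i, (A e).indicator (1 : BidderValuation n → ℝ) ((z.1.1 i).2)
          - (k + 1 : ℕ) * (D j).real (A e)|),
    fun z => unpaired_le h F (fun e => (k + 1 : ℕ) * (D j).real (A e)) z.1, s1.add s2, ?_⟩
  rw [integral_add s1 s2, integral_finsetSum _ fun l _ => i1 l,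
    integral_finsetSum _ fun e _ => i23 e]
  refine add_le_add (le_of_eq ?_) ?_
  · simp only [e1]; simp
  · calc _ ≤ ∑ e ∈ F, (√(k + 1 : ℕ) + √(k + 1 : ℕ)) := Finset.sum_le_sum fun e _ => by
          rw [integral_add (i2 e) (i3 e)]
          exact add_le_add (e2 e) (e3 e)
      _ = _ := by rw [Finset.sum_const, nsmul_eq_mul]; ring

/-- The expected interim price of the surrogate of a matched bidder is, up to small errors, at least
the expected truncated interim price less the discounted expected excess. -/
lemma integral_slotPay_ge (hM : M.IsWellPosed D T) (hT : ∀ j, ∀ᵐ v ∂(D j), v ∈ T j)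
    (hBIC : M.IsBIC D T) (hIR : M.IsIR D T) (hε0 : 0 < ε) (j : Fin m)
    (hc : c.map Prod.snd = D j) (hle : ∀ᵐ a ∂c, ∀ S, a.2.1 S ≤ a.1.1 S)
    (hP : Integrable (fun z => slotPay M D j (slot 0 z)) (shadowLaw hM ε k j c))
    (hX : Integrable (fun z => slotExcess M D j (slot 0 z)) (shadowLaw hM ε k j c))
    {h N : ℝ} (hh : 0 < h) (hN : 0 ≤ N) (F : Finset (Finset (Fin n) → ℕ)) :
    ∫ s, truncatedPay M D j N s ∂(D j)
        - N * ((D j).real {v | cell h v ∉ F} + 2 * F.card / √(k + 1 : ℕ))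
        - (2 * h + ∫ z, slotExcess M D j (slot 0 z) ∂(shadowLaw hM ε k j c)) / ε
      ≤ ∫ z, slotPay M D j (slot 0 z) ∂(shadowLaw hM ε k j c) := by
  obtain ⟨U, hU, hUi, hUint⟩ := integral_unpaired_bound (ε := ε) (k := k) hM j hc h F
  set γ := shadowLaw hM ε k j c with hγ
  have hR := measurePreserving_shadow_right (ε := ε) (k := k) (c := c) hM j
  have hL := measurePreserving_shadow_left (ε := ε) (k := k) (c := c) hM j
  have hPi := fun i => (integrable_slot_iff (k := k) (ε := ε) (c := c) hM j
    (measurable_slotPay hM j) i).2 hP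
  have hXi := fun i => (integrable_slot_iff (k := k) (ε := ε) (c := c) hM j
    (measurable_slotExcess hM j) i).2 hX
  have htr := integrable_truncatedPay hM hT j N
  have hev := fun l => (measurePreserving_eval (fun _ : Fin (k + 1) => D j) l).comp hR
  have htri : ∀ l : Fin (k + 1),
      Integrable (fun z : ShadowState k n => truncatedPay M D j N (z.1.2 l)) γ := fun l =>
    (hev l).integrable_comp_of_integrable htr
  have htre : ∀ l : Fin (k + 1), ∫ z : ShadowState k n, truncatedPay M D j N (z.1.2 l) ∂γ
      = ∫ s, truncatedPay M D j N s ∂(D j) := fun l =>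
    integral_comp_of_measurePreserving (hev l) htr.aestronglyMeasurable
  have hae : ∀ᵐ z ∂γ, ∑ l, truncatedPay M D j N (z.1.2 l) - N * U z
      - (2 * h * (k + 1 : ℕ) + ∑ i, slotExcess M D j (slot i z)) / ε
      ≤ ∑ i, slotPay M D j (slot i z) := by
    have a1 : ∀ᵐ z ∂γ, z.2 ∈ maxMatchings (typeWeight
        (fun a s => edgeUtility (M.scalePrices (1 - ε)) D j (Prod.fst a) s) (k + 1) z.1) := by
      rw [hγ]; unfold shadowLaw; exact ae_vcgLaw_mem _ _
    have a2 : ∀ᵐ z ∂γ, ∀ l, z.1.2 l ∈ T j :=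
      ae_all_iff.2 fun l => (hev l).quasiMeasurePreserving.ae (hT j)
    have a3 : ∀ᵐ z ∂γ, ∀ i S, (z.1.1 i).2.1 S ≤ (z.1.1 i).1.1 S :=
      ae_all_iff.2 fun i => ((measurePreserving_eval (fun _ : Fin (k + 1) => c) i).comp
        hL).quasiMeasurePreserving.ae hle
    filter_upwards [a1, a2, a3] with z z1 z2 z3
    have key := matched_pay_ge hM hBIC hIR hε0 j hh hN F z z1 z2 z3
    have e1 : ∑ i ∈ z.2.2, M.interimPay D j (z.1.2 (z.2.1 i)) = ∑ i, slotPay M D j (slot i z) := by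
      rw [← Fintype.sum_ite_mem]
      refine Finset.sum_congr rfl fun i _ => ?_
      unfold slotPay
      by_cases hi : i ∈ z.2.2
      · rw [if_pos hi, if_pos (show (slot i z).2.2 from hi)]; rfl
      · rw [if_neg hi, if_neg (show ¬(slot i z).2.2 from hi)]
    have e2 : ∑ i ∈ z.2.2, excess M D j (z.1.1 i) (z.1.2 (z.2.1 i))
        = ∑ i, slotExcess M D j (slot i z) := by
      rw [← Fintype.sum_ite_mem]
      refine Finset.sum_congr rfl fun i _ => ?_
      unfold slotExcess
      by_cases hi : i ∈ z.2.2
      · rw [if_pos hi, if_pos (show (slot i z).2.2 from hi)]; rfl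
      · rw [if_neg hi, if_neg (show ¬(slot i z).2.2 from hi)]
    rw [e1, e2] at key
    have := mul_le_mul_of_nonneg_left (hU z) hN
    linarith
  have hsX : Integrable (fun z => ∑ i, slotExcess M D j (slot i z)) γ :=
    integrable_finsetSum _ fun i _ => hXi i
  have hsT : Integrable (fun z : ShadowState k n => ∑ l, truncatedPay M D j N (z.1.2 l)) γ :=
    integrable_finsetSum _ fun l _ => htri l
  have hsTU : Integrable (fun z : ShadowState k n =>
      ∑ l, truncatedPay M D j N (z.1.2 l) - N * U z) γ := hsT.sub (hUi.const_mul N)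
  have hcX : Integrable (fun z : ShadowState k n =>
      (2 * h * (k + 1 : ℕ) + ∑ i, slotExcess M D j (slot i z)) / ε) γ :=
    ((integrable_const (2 * h * (k + 1 : ℕ))).add hsX).div_const ε
  have hint := integral_mono_ae (hsTU.sub hcX) (integrable_finsetSum _ fun i _ => hPi i) hae
  rw [integral_finsetSum _ fun i _ => hPi i, integral_sub' hsTU hcX,
    integral_sub hsT (hUi.const_mul N), integral_div, integral_const_mul] at hint
  have hi1 : ∫ z, (2 * h * (k + 1 : ℕ) + ∑ i, slotExcess M D j (slot i z)) ∂γ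
      = (k + 1 : ℕ) * (2 * h + ∫ z, slotExcess M D j (slot 0 z) ∂γ) := by
    rw [integral_add (integrable_const _) hsX, integral_finsetSum _ fun i _ => hXi i]
    simp only [hγ, integral_slot hM j (measurable_slotExcess hM j)]
    simp
    ring
  have hi2 : ∑ i : Fin (k + 1), ∫ z, slotPay M D j (slot i z) ∂γ
      = (k + 1 : ℕ) * ∫ z, slotPay M D j (slot 0 z) ∂γ := by
    simp only [hγ, integral_slot hM j (measurable_slotPay hM j)]
    simp
  have hi3 : ∫ z : ShadowState k n, ∑ l, truncatedPay M D j N (z.1.2 l) ∂γ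
      = (k + 1 : ℕ) * ∫ s, truncatedPay M D j N s ∂(D j) := by
    rw [integral_finsetSum _ fun l _ => htri l]
    simp only [htre]
    simp
  rw [hi1, hi2, hi3] at hint
  have hr : (0 : ℝ) < (k + 1 : ℕ) := by positivity
  have hNU := mul_le_mul_of_nonneg_left hUint hN
  have hsqrt : √((k + 1 : ℕ) : ℝ) = (k + 1 : ℕ) * (1 / √((k + 1 : ℕ) : ℝ)) := by
    rw [mul_one_div, Real.div_sqrt]
  refine le_of_mul_le_mul_left ?_ hr
  calc _ = (k + 1 : ℕ) * ∫ s, truncatedPay M D j N s ∂(D j)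
        - N * ((k + 1 : ℕ) * (D j).real {v | cell h v ∉ F}
          + 2 * F.card * ((k + 1 : ℕ) * (1 / √((k + 1 : ℕ) : ℝ))))
        - (k + 1 : ℕ) * (2 * h + ∫ z, slotExcess M D j (slot 0 z) ∂γ) / ε := by ring
    _ ≤ _ := by
      rw [← hsqrt]
      linarith

end Shadow

/-! ### The total excess is at most the expected welfare of the differences -/

section Welfare

open Mechanism

variable {m n k : ℕ} {M : Mechanism m n} {D Dp : Fin m → Measure (BidderValuation n)}
  [∀ j, IsProbabilityMeasure (D j)] [∀ j, IsProbabilityMeasure (Dp j)]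
  {T : Fin m → Set (BidderValuation n)} {ε : ℝ}
  {C : Fin m → Measure (BidderValuation n × BidderValuation n)} [∀ j, IsProbabilityMeasure (C j)]

/-- The partner of the left node `0`. -/
def ShadowState.partner (z : ShadowState k n) : BidderValuation n := z.1.2 (z.2.1 0)

lemma measurable_shadow_partner : Measurable (ShadowState.partner (k := k) (n := n)) :=
  measurable_partner (Y := (Fin (k + 1) → BidderValuation n × BidderValuation n)
    × (Fin (k + 1) → BidderValuation n)) measurable_snd 0

/-- The largest welfare of a feasible allocation. -/
noncomputable def optimalWelfare (d : Fin m → Finset (Fin n) → ℝ) : ℝ :=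
  ⨆ a : Allocation m n, ∑ j, d j (a.1 j)

lemma measurable_optimalWelfare : Measurable (optimalWelfare (m := m) (n := n)) := by
  unfold optimalWelfare
  refine Measurable.iSup fun a => Finset.measurable_sum _ fun j _ => ?_
  exact (measurable_pi_apply (a.1 j)).comp (measurable_pi_apply j)

lemma measurable_difference : Measurable fun (c : BidderValuation n × BidderValuation n)
    (S : Finset (Fin n)) => c.1.1 S - c.2.1 S :=
  measurable_pi_iff.2 fun S => ((measurable_apply_bundle S).comp measurable_fst).sub
    ((measurable_apply_bundle S).comp measurable_snd)

lemma measurePreserving_shadow_differences (hM : M.IsWellPosed D T) :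
    MeasurePreserving
      (fun (ω : Fin m → ShadowState k n) j S => ((ω j).1.1 0).1.1 S - ((ω j).1.1 0).2.1 S)
      (Measure.pi fun j => shadowLaw hM ε k j (C j))
      (Measure.pi fun j => differenceLaw (C j)) := by
  have hp : ∀ j, IsProbabilityMeasure (differenceLaw (C j)) := fun j =>
    Measure.isProbabilityMeasure_map measurable_difference.aemeasurable
  refine measurePreserving_pi _ _ (f := fun j (z : ShadowState k n) S =>
    (z.1.1 0).1.1 S - (z.1.1 0).2.1 S) fun j => ?_
  have h1 := (measurePreserving_eval (fun _ : Fin (k + 1) => C j) 0).comp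
    (measurePreserving_shadow_left (ε := ε) (k := k) (c := C j) hM j)
  have h2 : MeasurePreserving (fun (c : BidderValuation n × BidderValuation n)
      (S : Finset (Fin n)) => c.1.1 S - c.2.1 S) (C j) (differenceLaw (C j)) :=
    ⟨measurable_difference, rfl⟩
  have h3 := h2.comp h1
  exact h3

lemma measurePreserving_shadow_partner (hM : M.IsWellPosed D T) (j : Fin m)
    (c : Measure (BidderValuation n × BidderValuation n)) [IsProbabilityMeasure c] :
    MeasurePreserving ShadowState.partner (shadowLaw hM ε k j c) (D j) := by
  refine ⟨measurable_shadow_partner, ?_⟩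
  unfold shadowLaw
  exact map_partner_eq c (D j) (measurable_edgeUtility_comp (D := D)
    (measurable_scaled_lottery hM (1 - ε)) (measurable_scaled_pay hM (1 - ε)) measurable_fst j) 0

/-- What the difference `a.1 - a.2` is worth on average at the lottery drawn for the profile `w`. -/
noncomputable def lotteryExcess (M : Mechanism m n) (j : Fin m)
    (q : (BidderValuation n × BidderValuation n) × Profile m n) : ℝ :=
  ∑ b, M.lottery q.2 b * (q.1.1.1 (b.1 j) - q.1.2.1 (b.1 j))

lemma measurable_lotteryExcess (hM : M.IsWellPosed D T) (j : Fin m) :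
    Measurable (lotteryExcess M j) := by
  unfold lotteryExcess
  refine Finset.measurable_sum _ fun b _ => ?_
  refine ((hM.measurable_lottery b).comp measurable_snd).mul (Measurable.sub ?_ ?_)
  · exact (measurable_apply_bundle _).comp (measurable_fst.comp measurable_fst)
  · exact (measurable_apply_bundle _).comp (measurable_snd.comp measurable_fst)

lemma ofReal_slotExcess_le (hM : M.IsWellPosed D T) (j : Fin m) (z : ShadowState k n) :
    ENNReal.ofReal (slotExcess M D j (slot 0 z))
      ≤ ∫⁻ w, ENNReal.ofReal (lotteryExcess M j
          (z.1.1 0, Function.update w j z.partner)) ∂(Measure.pi D) := by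
  have h : ENNReal.ofReal (excess M D j (z.1.1 0) z.partner)
      ≤ ∫⁻ w, ENNReal.ofReal (lotteryExcess M j
          (z.1.1 0, Function.update w j z.partner)) ∂(Measure.pi D) := by
    unfold excess
    rw [interimValue_sub hM]
    exact ofReal_integral_le _ fun w => lotteryExcess M j
      (z.1.1 0, Function.update w j z.partner)
  unfold slotExcess
  split_ifs
  · exact h
  · simp

/-- The partners of the other bidders are independent of the state of bidder `j` and distributed
like truthful bidders. -/
lemma lintegral_shadow_partners (hM : M.IsWellPosed D T) (j : Fin m)
    {G : ShadowState k n × Profile m n → ENNReal} (hG : Measurable G) :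
    ∫⁻ ω : Fin m → ShadowState k n, G (ω j, fun i => (ω i).partner)
        ∂(Measure.pi fun j => shadowLaw hM ε k j (C j))
      = ∫⁻ z, ∫⁻ w, G (z, Function.update w j z.partner) ∂(Measure.pi D)
        ∂(shadowLaw hM ε k j (C j)) := by
  have hq : Measurable fun q : ShadowState k n × Profile m n =>
      (q.1, Function.update q.2 j q.1.partner) :=
    measurable_fst.prodMk ((measurable_update_pair (α := BidderValuation n) j).comp
      ((measurable_shadow_partner.comp measurable_fst).prodMk measurable_snd))
  have hω : Measurable fun ω : Fin m → ShadowState k n => (ω j, fun i => (ω i).partner) :=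
    (measurable_pi_apply j).prodMk
      (measurable_pi_iff.2 fun i => measurable_shadow_partner.comp (measurable_pi_apply i))
  have e := map_eval_comp_pi (fun j => shadowLaw hM ε k j (C j)) D
    measurable_shadow_partner j fun i _ => (measurePreserving_shadow_partner hM i (C i)).map_eq
  have hmq : Measurable fun q : ShadowState k n × Profile m n =>
      G (q.1, Function.update q.2 j q.1.partner) := hG.comp hq
  rw [← lintegral_map hG hω, e, lintegral_map hG hq]
  exact lintegral_prod _ hmq.aemeasurable

/-- The expected excess of one bidder is at most what her difference is worth to her on average at
the lottery drawn for the profile of all surrogates. -/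
lemma lintegral_slotExcess_le (hM : M.IsWellPosed D T) (j : Fin m) :
    ∫⁻ z, ENNReal.ofReal (slotExcess M D j (slot 0 z)) ∂(shadowLaw hM ε k j (C j))
      ≤ ∫⁻ ω : Fin m → ShadowState k n,
        ENNReal.ofReal (lotteryExcess M j ((ω j).1.1 0, fun i => (ω i).partner))
        ∂(Measure.pi fun j => shadowLaw hM ε k j (C j)) := by
  have hm : Measurable fun q : ShadowState k n × Profile m n =>
      ENNReal.ofReal (lotteryExcess M j (q.1.1.1 0, q.2)) :=
    ((measurable_lotteryExcess hM j).comp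
      (f := fun q : ShadowState k n × Profile m n => (q.1.1.1 0, q.2))
      (by fun_prop)).ennreal_ofReal
  have e := lintegral_shadow_partners (ε := ε) (C := C) hM j hm
  exact (lintegral_mono fun z => ofReal_slotExcess_le hM j z).trans e.ge

lemma expectedWelfare_eq (hM : M.IsWellPosed D T) :
    expectedWelfare (fun j => differenceLaw (C j))
      = ∫⁻ ω : Fin m → ShadowState k n, ENNReal.ofReal (optimalWelfare
        fun j S => ((ω j).1.1 0).1.1 S - ((ω j).1.1 0).2.1 S)
        ∂(Measure.pi fun j => shadowLaw hM ε k j (C j)) := by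
  have hm : Measurable fun d : Fin m → Finset (Fin n) → ℝ => ENNReal.ofReal (optimalWelfare d) :=
    measurable_optimalWelfare.ennreal_ofReal
  have h := (measurePreserving_shadow_differences (ε := ε) (k := k) (C := C) hM).lintegral_comp hm
  exact h.symm

lemma sum_ofReal_lotteryExcess_le (hM : M.IsWellPosed D T)
    (a : Fin m → BidderValuation n × BidderValuation n) (ha : ∀ j S, (a j).2.1 S ≤ (a j).1.1 S)
    (w : Profile m n) :
    ∑ j, ENNReal.ofReal (lotteryExcess M j (a j, w))
      ≤ ENNReal.ofReal (optimalWelfare fun j S => (a j).1.1 S - (a j).2.1 S) := by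
  have h0 : ∀ j, 0 ≤ lotteryExcess M j (a j, w) := fun j => Finset.sum_nonneg fun b _ =>
    mul_nonneg (lottery_nonneg hM _ b) (sub_nonneg.2 (ha _ _))
  rw [← ENNReal.ofReal_sum_of_nonneg fun j _ => h0 j]
  refine ENNReal.ofReal_le_ofReal ?_
  unfold lotteryExcess
  rw [Finset.sum_comm]
  calc ∑ b, ∑ j, M.lottery w b * ((a j).1.1 (b.1 j) - (a j).2.1 (b.1 j))
      ≤ ∑ b, M.lottery w b * optimalWelfare fun j S => (a j).1.1 S - (a j).2.1 S :=
        Finset.sum_le_sum fun b _ => by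
          rw [← Finset.mul_sum]
          exact mul_le_mul_of_nonneg_left
            (le_ciSup (f := fun b : Allocation m n => ∑ j, ((a j).1.1 (b.1 j) - (a j).2.1 (b.1 j)))
              (Set.finite_range _).bddAbove b) (lottery_nonneg hM w b)
    _ = _ := by rw [← Finset.sum_mul, sum_lottery hM, one_mul]

/-- The excesses of all bidders for their own shares of one random allocation add up to at most the
optimal welfare of the differences. -/
lemma sum_lintegral_slotExcess_le (hM : M.IsWellPosed D T)
    (hle : ∀ j, ∀ᵐ a ∂(C j), ∀ S, a.2.1 S ≤ a.1.1 S) :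
    ∑ j, ∫⁻ z, ENNReal.ofReal (slotExcess M D j (slot 0 z)) ∂(shadowLaw hM ε k j (C j))
      ≤ expectedWelfare (fun j => differenceLaw (C j)) := by
  refine (Finset.sum_le_sum fun j _ => lintegral_slotExcess_le hM j).trans ?_
  have hm : ∀ j, Measurable fun ω : Fin m → ShadowState k n =>
      ENNReal.ofReal (lotteryExcess M j ((ω j).1.1 0, fun i => (ω i).partner)) := fun j =>
    ((measurable_lotteryExcess hM j).comp
      (f := fun ω : Fin m → ShadowState k n => ((ω j).1.1 0, fun i => (ω i).partner))
      (Measurable.prodMk (by fun_prop) (measurable_pi_iff.2 fun i =>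
        measurable_shadow_partner.comp (measurable_pi_apply i)))).ennreal_ofReal
  rw [← lintegral_finsetSum _ fun j _ => hm j, expectedWelfare_eq (ε := ε) (k := k) hM]
  have hae : ∀ᵐ ω ∂(Measure.pi fun j => shadowLaw hM ε k j (C j)),
      ∀ j S, ((ω j).1.1 0).2.1 S ≤ ((ω j).1.1 0).1.1 S :=
    ae_all_iff.2 fun j => by
      have h1 := ((measurePreserving_eval (fun _ : Fin (k + 1) => C j) 0).comp
        (measurePreserving_shadow_left (ε := ε) (k := k) (c := C j) hM j)).comp
        (measurePreserving_eval (fun j => shadowLaw hM ε k j (C j)) j)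
      exact h1.quasiMeasurePreserving.ae (hle j)
  refine lintegral_mono_ae ?_
  filter_upwards [hae] with ω hω
  exact sum_ofReal_lotteryExcess_le hM (fun j => (ω j).1.1 0) hω _

lemma slotExcess_nonneg (hM : M.IsWellPosed D T) (j : Fin m)
    {c : Measure (BidderValuation n × BidderValuation n)} [IsProbabilityMeasure c]
    (hle : ∀ᵐ a ∂c, ∀ S, a.2.1 S ≤ a.1.1 S) :
    ∀ᵐ z ∂(shadowLaw hM ε k j c), 0 ≤ slotExcess M D j (slot 0 z) := by
  have h1 := (measurePreserving_eval (fun _ : Fin (k + 1) => c) 0).comp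
    (measurePreserving_shadow_left (ε := ε) (k := k) (c := c) hM j)
  filter_upwards [h1.quasiMeasurePreserving.ae hle] with z hz
  unfold slotExcess
  split_ifs
  · exact sub_nonneg.2 (interimValue_mono hM j hz _)
  · exact le_rfl

/-- If the expected welfare of the differences is finite, then all excesses are integrable, and
their integrals add up to at most the expected welfare. -/
lemma integrable_slotExcess (hM : M.IsWellPosed D T)
    (hle : ∀ j, ∀ᵐ a ∂(C j), ∀ S, a.2.1 S ≤ a.1.1 S)
    (hV : expectedWelfare (fun j => differenceLaw (C j)) ≠ ⊤) :
    (∀ j, Integrable (fun z => slotExcess M D j (slot 0 z)) (shadowLaw hM ε k j (C j))) ∧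
      ∑ j, ∫ z, slotExcess M D j (slot 0 z) ∂(shadowLaw hM ε k j (C j))
        ≤ (expectedWelfare (fun j => differenceLaw (C j))).toReal := by
  have hsum := sum_lintegral_slotExcess_le (ε := ε) (k := k) hM hle
  have hfin : ∀ j, ∫⁻ z, ENNReal.ofReal (slotExcess M D j (slot 0 z))
      ∂(shadowLaw hM ε k j (C j)) ≠ ⊤ := fun j =>
    ENNReal.sum_ne_top.1 (ne_top_of_le_ne_top hV hsum) j (Finset.mem_univ j)
  have hmeas : ∀ j, Measurable fun z : ShadowState k n => slotExcess M D j (slot 0 z) := fun j =>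
    (measurable_slotExcess hM j).comp (measurable_slot 0)
  have hpos := fun j => slotExcess_nonneg (ε := ε) (k := k) hM j (hle j)
  refine ⟨fun j => (lintegral_ofReal_ne_top_iff_integrable (hmeas j).aestronglyMeasurable
    (hpos j)).1 (hfin j), ?_⟩
  have e : ∀ j, ∫ z, slotExcess M D j (slot 0 z) ∂(shadowLaw hM ε k j (C j))
      = (∫⁻ z, ENNReal.ofReal (slotExcess M D j (slot 0 z))
        ∂(shadowLaw hM ε k j (C j))).toReal := fun j =>
    integral_eq_lintegral_of_nonneg_ae (hpos j) (hmeas j).aestronglyMeasurable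
  simp only [e]
  rw [← ENNReal.toReal_sum fun j _ => hfin j]
  exact ENNReal.toReal_mono hV hsum

end Welfare

/-! ### Revenue and interim payments -/

lemma integrable_of_lintegral_sum_lt_top {α : Type*} [MeasurableSpace α] {μ : Measure α} {m : ℕ}
    {f : Fin m → α → ℝ} (hf : ∀ j, Measurable (f j))
    (hneg : ∀ j, ∫⁻ a, ENNReal.ofReal (-f j a) ∂μ < ⊤)
    (hsum : ∫⁻ a, ENNReal.ofReal (∑ j, f j a) ∂μ < ⊤) (j : Fin m) : Integrable (f j) μ := by
  refine ⟨(hf j).aestronglyMeasurable, ?_⟩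
  have hb : ∀ a, ‖f j a‖ₑ
      ≤ ENNReal.ofReal (∑ i, f i a) + ∑ i, ENNReal.ofReal (-f i a)
        + ENNReal.ofReal (-f j a) := fun a => by
    have h1 : f j a ≤ ∑ i, f i a + ∑ i, max (-f i a) 0 := by
      rw [← Finset.sum_add_distrib]
      calc f j a ≤ f j a + max (-f j a) 0 := le_add_of_nonneg_right (le_max_right _ _)
        _ ≤ _ := Finset.single_le_sum (f := fun i => f i a + max (-f i a) 0)
          (fun i _ => by linarith [le_max_left (-f i a) 0]) (Finset.mem_univ j)
    have h2 : ∑ i, ENNReal.ofReal (-f i a) = ENNReal.ofReal (∑ i, max (-f i a) 0) := by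
      rw [ENNReal.ofReal_sum_of_nonneg fun i _ => le_max_right _ _]
      exact Finset.sum_congr rfl fun i _ => by rw [ENNReal.ofReal_max]; simp
    rw [h2, Real.enorm_eq_ofReal_abs]
    rcases abs_cases (f j a) with ⟨h, -⟩ | ⟨h, -⟩ <;> rw [h]
    · exact ((ENNReal.ofReal_le_ofReal h1).trans ENNReal.ofReal_add_le).trans le_self_add
    · exact le_add_self
  refine (lintegral_mono hb).trans_lt ?_
  have m1 : Measurable fun a => ENNReal.ofReal (-f j a) := (hf j).neg.ennreal_ofReal
  have m2 : ∀ i, Measurable fun a => ENNReal.ofReal (-f i a) := fun i => (hf i).neg.ennreal_ofReal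
  have m3 : Measurable fun a => ∑ i, ENNReal.ofReal (-f i a) :=
    Finset.measurable_sum _ fun i _ => m2 i
  rw [lintegral_add_right _ m1, lintegral_add_right _ m3, lintegral_finsetSum _ fun i _ => m2 i]
  exact ENNReal.add_lt_top.2 ⟨ENNReal.add_lt_top.2 ⟨hsum, ENNReal.sum_lt_top.2 fun i _ => hneg i⟩,
    hneg j⟩

namespace Mechanism

variable {m n : ℕ} {M : Mechanism m n} {D : Fin m → Measure (BidderValuation n)}
  {T : Fin m → Set (BidderValuation n)}

/-- If all payments are integrable, then the revenue is the sum of their expectations. -/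
lemma revenue_eq_sum (h : ∀ j, Integrable (fun v => M.pay v j) (Measure.pi D)) :
    M.revenue D = ((∑ j, ∫ v, M.pay v j ∂(Measure.pi D) : ℝ) : EReal) := by
  have hs : Integrable (fun v => ∑ j, M.pay v j) (Measure.pi D) :=
    integrable_finsetSum _ fun j _ => h j
  have e := integral_eq_lintegral_pos_part_sub_lintegral_neg_part hs
  have h1 : ∫⁻ v, ENNReal.ofReal (∑ j, M.pay v j) ∂(Measure.pi D) ≠ ⊤ :=
    hs.lintegral_lt_top.ne
  have h2 : ∫⁻ v, ENNReal.ofReal (-∑ j, M.pay v j) ∂(Measure.pi D) ≠ ⊤ :=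
    hs.neg.lintegral_lt_top.ne
  rw [← integral_finsetSum _ fun j _ => h j, e, revenue, EReal.coe_sub,
    EReal.coe_ennreal_toReal h1, EReal.coe_ennreal_toReal h2]

/-- If some payment is not integrable, then the revenue is infinite. -/
lemma revenue_eq_top (hM : M.IsWellPosed D T)
    (h : ¬∀ j, Integrable (fun v => M.pay v j) (Measure.pi D)) : M.revenue D = ⊤ := by
  have h1 : ∫⁻ v, ENNReal.ofReal (∑ j, M.pay v j) ∂(Measure.pi D) = ⊤ := by
    by_contra hne
    exact h (integrable_of_lintegral_sum_lt_top hM.measurable_pay hM.lintegral_neg_pay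
      (lt_top_iff_ne_top.2 hne))
  have h2 : ∫⁻ v, ENNReal.ofReal (-∑ j, M.pay v j) ∂(Measure.pi D) < ⊤ := by
    have m2 : ∀ i, Measurable fun v => ENNReal.ofReal (-M.pay v i) :=
      fun i => (hM.measurable_pay i).neg.ennreal_ofReal
    refine (lintegral_mono (g := fun v => ∑ j, ENNReal.ofReal (-M.pay v j)) fun v => ?_).trans_lt ?_
    · rw [← Finset.sum_neg_distrib]
      exact Finset.le_sum_of_subadditive _ ENNReal.ofReal_zero.le (fun _ _ => ENNReal.ofReal_add_le) _ _
    · rw [lintegral_finsetSum _ fun i _ => m2 i]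
      exact ENNReal.sum_lt_top.2 fun i _ => hM.lintegral_neg_pay i
  rw [revenue, h1, EReal.coe_ennreal_top]
  refine EReal.top_sub ?_
  simpa using h2.ne

variable [∀ j, IsProbabilityMeasure (D j)]

lemma integrable_interimPay {j : Fin m} (h : Integrable (fun v => M.pay v j) (Measure.pi D)) :
    Integrable (M.interimPay D j) (D j) := by
  rw [← map_update_prod_pi D j] at h
  exact (h.comp_measurable (measurable_update_pair j)).integral_prod_left

lemma integral_interimPay {j : Fin m} (h : Integrable (fun v => M.pay v j) (Measure.pi D)) :
    ∫ t, M.interimPay D j t ∂(D j) = ∫ v, M.pay v j ∂(Measure.pi D) := by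
  have e := map_update_prod_pi D j
  rw [← e] at h
  have h1 := integral_map (measurable_update_pair j).aemeasurable h.aestronglyMeasurable
  have h2 := integral_prod _ (h.comp_measurable (measurable_update_pair j))
  rw [e] at h1
  exact h2.symm.trans h1.symm

end Mechanism

/-! ### Averaging over the report of a bidder -/

section Mixture

open Mechanism

variable {m n k : ℕ} {N : Mechanism m n} {D Dp : Fin m → Measure (BidderValuation n)}
  [∀ j, IsProbabilityMeasure (D j)] [∀ j, IsProbabilityMeasure (Dp j)]
  (hl : ∀ a, Measurable fun v => N.lottery v a) (hp : ∀ j, Measurable fun v => N.pay v j)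
  {j : Fin m} {β : Measure (BidderValuation n)} [IsProbabilityMeasure β]

lemma lintegral_bidderLaw {f : BidderState k n → ENNReal} (hf : Measurable f) :
    ∫⁻ ω, f ω ∂(bidderLaw Dp hl hp D k j β)
      = ∫⁻ t, ∫⁻ ω, f ω ∂(bidderLaw Dp hl hp D k j (Measure.dirac t)) ∂β := by
  unfold bidderLaw
  have hm := measurable_average_maxMatchings (measurable_edgeWeight (D := D) (k := k) hl hp j) hf
  rw [lintegral_vcgLaw _ _ hf, lintegral_prod _ hm.aemeasurable]
  refine lintegral_congr fun t => ?_
  rw [lintegral_vcgLaw _ _ hf, lintegral_prod _ hm.aemeasurable, lintegral_dirac']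
  exact hm.lintegral_prod_right'

/-- The expectation over the state of a bidder with a random report averages over her report. -/
lemma integral_bidderLaw {f : BidderState k n → ℝ}
    (hf : Integrable f (bidderLaw Dp hl hp D k j β))
    (hf' : ∀ t, Integrable f (bidderLaw Dp hl hp D k j (Measure.dirac t))) :
    Integrable (fun t => ∫ ω, f ω ∂(bidderLaw Dp hl hp D k j (Measure.dirac t))) β ∧
      ∫ ω, f ω ∂(bidderLaw Dp hl hp D k j β)
        = ∫ t, ∫ ω, f ω ∂(bidderLaw Dp hl hp D k j (Measure.dirac t)) ∂β := by
  have h1 := integrable_expect_of_vcgLaw _ _ hf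
  have h2 := integral_vcgLaw _ _ hf
  have h3 := fun t => (integral_bidderLaw_dirac hl hp t (hf' t)).2
  simp only [h3]
  exact ⟨h1.integral_prod_left, h2.trans (integral_prod _ h1)⟩

end Mixture

section RevenueBound

open Mechanism

variable {m n k : ℕ} {M : Mechanism m n} {D Dp : Fin m → Measure (BidderValuation n)}
  [∀ j, IsProbabilityMeasure (D j)] [∀ j, IsProbabilityMeasure (Dp j)]
  {T : Fin m → Set (BidderValuation n)} {ε : ℝ}

/-- The interim price of the surrogate, if the bidder is matched. -/
noncomputable def stateSurrogatePay (M : Mechanism m n) (D : Fin m → Measure (BidderValuation n))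
    (j : Fin m) (ω : BidderState k n) : ℝ :=
  if 0 ∈ ω.2.2 then M.interimPay D j ω.surrogate else 0

lemma measurableSet_bidder_matched :
    MeasurableSet {ω : BidderState k n | (0 : Fin (k + 1)) ∈ ω.2.2} :=
  measurableSet_matched (Y := BidderValuation n × Draw k n) 0

lemma measurable_stateSurrogatePay (hM : M.IsWellPosed D T) (j : Fin m) :
    Measurable (stateSurrogatePay (k := k) M D j) :=
  Measurable.ite measurableSet_bidder_matched
    ((measurable_interimPay (hM.measurable_pay j)).comp measurable_surrogate) measurable_const

lemma measurable_stateInterimPay (hM : M.IsWellPosed D T) (j : Fin m) :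
    Measurable (stateInterimPay (k := k) M D ε j) :=
  Measurable.ite measurableSet_bidder_matched ((measurable_stateVcgPrice hM j).add
    (((measurable_interimPay (hM.measurable_pay j)).comp measurable_surrogate).const_mul _))
    measurable_const

lemma mul_stateSurrogatePay_le (j : Fin m) (ω : BidderState k n) :
    (1 - ε) * stateSurrogatePay M D j ω ≤ stateInterimPay M D ε j ω := by
  unfold stateSurrogatePay stateInterimPay
  split_ifs
  · have : 0 ≤ stateVcgPrice M D ε j ω := vcgPrice_nonneg _ _ _
    linarith
  · simp

lemma neg_interimNegPay_le_stateSurrogatePay (hM : M.IsWellPosed D T) {j : Fin m}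
    {ω : BidderState k n} (hω : ω.surrogate ∈ T j) :
    -M.interimNegPay D j ω.surrogate ≤ stateSurrogatePay M D j ω := by
  unfold stateSurrogatePay
  split_ifs
  · exact neg_interimNegPay_le hM hω
  · exact neg_nonpos.2 (interimNegPay_nonneg j _)

/-- If the payment of bidder `j` in the replica–surrogate mechanism is integrable under truthful
play, then so is her expected payment given her state. -/
lemma integrable_stateInterimPay (hM : M.IsWellPosed D T) (hT : ∀ j, ∀ᵐ v ∂(D j), v ∈ T j)
    (hε1 : ε ≤ 1) (j : Fin m)
    (h : Integrable (fun v => (replicaSurrogate M D Dp ε k).pay v j) (Measure.pi Dp)) :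
    Integrable (stateInterimPay M D ε j) (stateLaw Dp hM ε k j (Dp j)) := by
  have hε : 0 ≤ 1 - ε := by linarith
  have hg : ∀ (β : Measure (BidderValuation n)) [IsProbabilityMeasure β],
      Integrable (fun ω : BidderState k n => (1 - ε) * M.interimNegPay D j ω.surrogate)
        (stateLaw Dp hM ε k j β) := fun β _ =>
    (integrable_comp_surrogate _ _ j β (integrable_interimNegPay hM j)).const_mul _
  have hQ := fun t => replicaSurrogate_interimPay (Dp := Dp) (k := k) hM hT hε1 j t
  have hQm : Measurable fun ω : BidderState k n => stateInterimPay M D ε j ω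
      + (1 - ε) * M.interimNegPay D j ω.surrogate := by
    refine (measurable_stateInterimPay hM j).add (Measurable.const_mul ?_ _)
    have h1 : Measurable (M.interimNegPay D j) := by
      have h2 : Measurable fun q : BidderValuation n × Profile m n =>
          max (-M.pay (Function.update q.2 j q.1) j) 0 :=
        ((hM.measurable_pay j).comp (measurable_update_pair j)).neg.max measurable_const
      exact h2.stronglyMeasurable.integral_prod_right'.measurable
    exact h1.comp measurable_surrogate
  have hpos : ∀ (β : Measure (BidderValuation n)) [IsProbabilityMeasure β],
      0 ≤ᵐ[stateLaw Dp hM ε k j β] fun ω => stateInterimPay M D ε j ω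
        + (1 - ε) * M.interimNegPay D j ω.surrogate := fun β _ => by
    filter_upwards [ae_stateLaw_surrogate_mem (Dp := Dp) (ε := ε) (k := k) hM hT j β] with ω hω
    have h1 := mul_stateSurrogatePay_le (M := M) (D := D) (ε := ε) j ω
    have h2 := mul_le_mul_of_nonneg_left (neg_interimNegPay_le_stateSurrogatePay hM hω) hε
    simp only [Pi.zero_apply]
    linarith
  have hgI := (integral_bidderLaw (measurable_scaled_lottery hM _) (measurable_scaled_pay hM _)
    (hg (Dp j)) fun t => hg (Measure.dirac t)).1
  have hPI := integrable_interimPay h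
  -- Given the report `t`, the nonnegative function has a finite integral, which is integrable in `t`.
  have key : ∫⁻ ω, ENNReal.ofReal (stateInterimPay M D ε j ω
      + (1 - ε) * M.interimNegPay D j ω.surrogate) ∂(stateLaw Dp hM ε k j (Dp j)) ≠ ⊤ := by
    have e := lintegral_bidderLaw (Dp := Dp) (β := Dp j) (D := D) (j := j)
      (measurable_scaled_lottery hM (1 - ε))
      (measurable_scaled_pay hM (1 - ε)) hQm.ennreal_ofReal
    have e' : ∀ t, ∫⁻ ω, ENNReal.ofReal (stateInterimPay M D ε j ω
        + (1 - ε) * M.interimNegPay D j ω.surrogate) ∂(stateLaw Dp hM ε k j (Measure.dirac t))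
        = ENNReal.ofReal ((replicaSurrogate M D Dp ε k).interimPay Dp j t
          + ∫ ω, (1 - ε) * M.interimNegPay D j ω.surrogate
            ∂(stateLaw Dp hM ε k j (Measure.dirac t))) := fun t => by
      rw [(hQ t).2, ← integral_add (hQ t).1 (hg _)]
      exact (ofReal_integral_eq_lintegral_ofReal ((hQ t).1.add (hg _)) (hpos _)).symm
    have e'' := e.trans (lintegral_congr e')
    have hfin := (hPI.add hgI).lintegral_lt_top.ne
    exact fun h' => hfin (e''.symm.trans h')
  have hsum := (lintegral_ofReal_ne_top_iff_integrable hQm.aestronglyMeasurable (hpos (Dp j))).1 key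
  refine (hsum.sub (hg (Dp j))).congr (.of_forall fun ω => ?_)
  simp

/-- The expected payment of a bidder is at least the expected discounted price of her surrogate,
since VCG prices are nonnegative. -/
lemma integral_stateSurrogatePay_le (hM : M.IsWellPosed D T) (hT : ∀ j, ∀ᵐ v ∂(D j), v ∈ T j)
    (hε1 : ε < 1) (j : Fin m)
    (h : Integrable (fun v => (replicaSurrogate M D Dp ε k).pay v j) (Measure.pi Dp)) :
    Integrable (stateSurrogatePay M D j) (stateLaw Dp hM ε k j (Dp j)) ∧
      (1 - ε) * ∫ ω, stateSurrogatePay M D j ω ∂(stateLaw Dp hM ε k j (Dp j))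
        ≤ ∫ v, (replicaSurrogate M D Dp ε k).pay v j ∂(Measure.pi Dp) := by
  have hε : 0 < 1 - ε := by linarith
  have hQ := integrable_stateInterimPay hM hT hε1.le j h
  have hg : Integrable (fun ω : BidderState k n => M.interimNegPay D j ω.surrogate)
      (stateLaw Dp hM ε k j (Dp j)) :=
    integrable_comp_surrogate _ _ j _ (integrable_interimNegPay hM j)
  have hP : Integrable (stateSurrogatePay M D j) (stateLaw Dp hM ε k j (Dp j)) := by
    refine Integrable.mono' ((hQ.norm.const_mul (1 - ε)⁻¹).add hg)
      (measurable_stateSurrogatePay hM j).aestronglyMeasurable ?_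
    filter_upwards [ae_stateLaw_surrogate_mem (Dp := Dp) (ε := ε) (k := k) hM hT j (Dp j)] with ω hω
    have h1 := mul_stateSurrogatePay_le (M := M) (D := D) (ε := ε) j ω
    have h2 := neg_interimNegPay_le_stateSurrogatePay hM hω
    have h3 : 0 ≤ M.interimNegPay D j ω.surrogate := interimNegPay_nonneg j _
    have h4 : stateSurrogatePay M D j ω ≤ (1 - ε)⁻¹ * ‖stateInterimPay M D ε j ω‖ := by
      rw [← div_eq_inv_mul, le_div_iff₀' hε]
      exact h1.trans (Real.le_norm_self _)
    have h5 : 0 ≤ (1 - ε)⁻¹ * ‖stateInterimPay M D ε j ω‖ := by positivity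
    rw [Real.norm_eq_abs]
    exact abs_le.2 ⟨by simp only [Pi.add_apply]; linarith, by simp only [Pi.add_apply]; linarith⟩
  refine ⟨hP, ?_⟩
  have hdir := fun t => replicaSurrogate_interimPay (Dp := Dp) (k := k) hM hT hε1.le j t
  have e := (integral_bidderLaw (measurable_scaled_lottery hM _) (measurable_scaled_pay hM _) hQ
    fun t => (hdir t).1).2
  have e' : ∫ ω, stateInterimPay M D ε j ω ∂(stateLaw Dp hM ε k j (Dp j))
      = ∫ v, (replicaSurrogate M D Dp ε k).pay v j ∂(Measure.pi Dp) := by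
    rw [← integral_interimPay h]
    exact e.trans (integral_congr_ae (.of_forall fun t => (hdir t).2.symm))
  rw [← e', ← integral_const_mul]
  exact integral_mono (hP.const_mul _) hQ fun ω => mul_stateSurrogatePay_le j ω

lemma slotPay_slot_zero (j : Fin m) (z : ShadowState k n) :
    slotPay M D j (slot 0 z) = stateSurrogatePay M D j (drawOfTypes Prod.fst z.1, z.2) := by
  unfold slotPay stateSurrogatePay
  by_cases hz : (0 : Fin (k + 1)) ∈ z.2.2
  · rw [if_pos hz, if_pos (show (slot 0 z).2.2 from hz)]; rfl
  · rw [if_neg hz, if_neg (show ¬(slot 0 z).2.2 from hz)]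

/-- Forgetting the shadows turns the shadow state into the state of a truthful bidder. -/
lemma measurePreserving_shadow_state (hM : M.IsWellPosed D T) (j : Fin m)
    {c : Measure (BidderValuation n × BidderValuation n)} [IsProbabilityMeasure c]
    (hc : c.map Prod.fst = Dp j) :
    MeasurePreserving (fun z : ShadowState k n => (drawOfTypes Prod.fst z.1, z.2))
      (shadowLaw hM ε k j c) (stateLaw Dp hM ε k j (Dp j)) := by
  have hf : MeasurePreserving Prod.fst c (Dp j) := ⟨measurable_fst, hc⟩
  refine ⟨((measurePreserving_drawOfTypes (D := D) (k := k) hf).measurable.comp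
    measurable_fst).prodMk measurable_snd, ?_⟩
  exact map_drawOfTypes (measurable_scaled_lottery hM (1 - ε)) (measurable_scaled_pay hM (1 - ε)) hf

/-- The revenue of the replica–surrogate mechanism is at least the revenue of `M` with truncated
prices, less small errors and the discounted expected welfare of the differences. -/
lemma le_revenue_replicaSurrogate (hM : M.IsWellPosed D T) (hT : ∀ j, ∀ᵐ v ∂(D j), v ∈ T j)
    (hBIC : M.IsBIC D T) (hIR : M.IsIR D T) (hε0 : 0 < ε) (hε1 : ε < 1)
    {C : Fin m → Measure (BidderValuation n × BidderValuation n)}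
    (hC : ∀ j, IsDominatingCoupling (C j) (Dp j) (D j))
    (hV : expectedWelfare (fun j => differenceLaw (C j)) ≠ ⊤)
    {h N : ℝ} (hh : 0 < h) (hN : 0 ≤ N) (F : Fin m → Finset (Finset (Fin n) → ℕ)) :
    (((1 - ε) * (∑ j, (∫ s, truncatedPay M D j N s ∂(D j)
        - N * ((D j).real {v | cell h v ∉ F j} + 2 * (F j).card / √(k + 1 : ℕ)) - 2 * h / ε)
      - (expectedWelfare (fun j => differenceLaw (C j))).toReal / ε) : ℝ) : EReal)
      ≤ (replicaSurrogate M D Dp ε k).revenue Dp := by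
  have hW := replicaSurrogate_isWellPosed (Dp := Dp) (k := k) hM hT hε1.le
  by_cases hI : ∀ j, Integrable (fun v => (replicaSurrogate M D Dp ε k).pay v j) (Measure.pi Dp)
  swap
  · rw [revenue_eq_top hW hI]; exact le_top
  have hCp : ∀ j, IsProbabilityMeasure (C j) := fun j => by
    have h1 : IsProbabilityMeasure ((C j).map Prod.fst) := by rw [(hC j).map_fst]; infer_instance
    exact Measure.isProbabilityMeasure_of_map Prod.fst
  rw [revenue_eq_sum hI]
  refine EReal.coe_le_coe_iff.2 ?_
  obtain ⟨hX, hXV⟩ := integrable_slotExcess (ε := ε) (k := k) hM (fun j => (hC j).le) hV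
  have hpay : ∀ j, (1 - ε) * (∫ s, truncatedPay M D j N s ∂(D j)
        - N * ((D j).real {v | cell h v ∉ F j} + 2 * (F j).card / √(k + 1 : ℕ))
        - (2 * h + ∫ z, slotExcess M D j (slot 0 z) ∂(shadowLaw hM ε k j (C j))) / ε)
      ≤ ∫ v, (replicaSurrogate M D Dp ε k).pay v j ∂(Measure.pi Dp) := fun j => by
    obtain ⟨h1, h2⟩ := integral_stateSurrogatePay_le hM hT hε1 j (hI j)
    have hmp := measurePreserving_shadow_state (ε := ε) (k := k) hM j (hC j).map_fst
    have hP : Integrable (fun z => slotPay M D j (slot 0 z)) (shadowLaw hM ε k j (C j)) := by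
      simp only [slotPay_slot_zero]
      exact hmp.integrable_comp_of_integrable h1
    have e : ∫ z, slotPay M D j (slot 0 z) ∂(shadowLaw hM ε k j (C j))
        = ∫ ω, stateSurrogatePay M D j ω ∂(stateLaw Dp hM ε k j (Dp j)) := by
      simp only [slotPay_slot_zero]
      exact integral_comp_of_measurePreserving hmp h1.aestronglyMeasurable
    have h3 := integral_slotPay_ge hM hT hBIC hIR hε0 j (hC j).map_snd (hC j).le hP (hX j) hh hN (F j)
    rw [e] at h3
    exact (mul_le_mul_of_nonneg_left h3 (by linarith)).trans h2
  refine le_trans ?_ (Finset.sum_le_sum fun j _ => hpay j)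
  rw [← Finset.mul_sum]
  refine mul_le_mul_of_nonneg_left ?_ (by linarith)
  have h4 := div_le_div_of_nonneg_right hXV hε0.le
  simp only [add_div, ← sub_sub, Finset.sum_sub_distrib, ← Finset.sum_div] at h4 ⊢
  linarith

end RevenueBound

/-! ### Truncated prices recover the revenue -/

section Truncation

open Mechanism Filter Topology

variable {m n : ℕ} {M : Mechanism m n} {D : Fin m → Measure (BidderValuation n)}
  [∀ j, IsProbabilityMeasure (D j)] {T : Fin m → Set (BidderValuation n)}

/-- The expected positive part of a payment, computed from interim quantities. -/
lemma lintegral_interimPay_add_interimNegPay (hM : M.IsWellPosed D T)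
    (hT : ∀ j, ∀ᵐ v ∂(D j), v ∈ T j) (j : Fin m) :
    ∫⁻ s, ENNReal.ofReal (M.interimPay D j s + M.interimNegPay D j s) ∂(D j)
      = ∫⁻ v, ENNReal.ofReal (M.pay v j) ∂(Measure.pi D) := by
  have hm : Measurable fun v : Profile m n => ENNReal.ofReal (M.pay v j) :=
    (hM.measurable_pay j).ennreal_ofReal
  have hm' : Measurable fun q : BidderValuation n × Profile m n =>
      ENNReal.ofReal (M.pay (Function.update q.2 j q.1) j) := hm.comp (measurable_update_pair j)
  have e1 := lintegral_map (μ := (D j).prod (Measure.pi D)) hm (measurable_update_pair j)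
  rw [map_update_prod_pi D j] at e1
  have e2 := lintegral_prod (μ := D j) (ν := Measure.pi D) _ hm'.aemeasurable
  refine Eq.trans (lintegral_congr_ae ?_) (e1.trans e2).symm
  filter_upwards [hT j] with s hs
  have hP := hM.integrable_pay j s hs
  have hPn : Integrable (fun w => max (-M.pay (Function.update w j s) j) 0) (Measure.pi D) :=
    hP.neg.pos_part
  have hPp : Integrable (fun w => max (M.pay (Function.update w j s) j) 0) (Measure.pi D) :=
    hP.pos_part
  have e3 : M.interimPay D j s + M.interimNegPay D j s
      = ∫ w, max (M.pay (Function.update w j s) j) 0 ∂(Measure.pi D) := by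
    unfold interimPay interimNegPay
    rw [← integral_add hP hPn]
    refine integral_congr_ae (.of_forall fun w => ?_)
    dsimp only
    rcases le_total 0 (M.pay (Function.update w j s) j) with h | h
    · rw [max_eq_left h, max_eq_right (by linarith), add_zero]
    · rw [max_eq_right h, max_eq_left (by linarith), add_neg_cancel]
  rw [e3, ofReal_integral_eq_lintegral_ofReal hPp (.of_forall fun _ => le_max_right _ _)]
  refine lintegral_congr fun w => ?_
  rw [ENNReal.ofReal_max]
  simp

lemma neg_interimNegPay_le_truncatedPay (hM : M.IsWellPosed D T) {j : Fin m} {N : ℝ} (hN : 0 ≤ N)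
    {s : BidderValuation n} (hs : s ∈ T j) : -M.interimNegPay D j s ≤ truncatedPay M D j N s := by
  refine le_min (neg_interimNegPay_le hM hs) ?_
  have : 0 ≤ M.interimNegPay D j s := interimNegPay_nonneg j s
  linarith

lemma neg_integral_le_integral_truncatedPay (hM : M.IsWellPosed D T)
    (hT : ∀ j, ∀ᵐ v ∂(D j), v ∈ T j) (j : Fin m) {N : ℝ} (hN : 0 ≤ N) :
    -∫ s, M.interimNegPay D j s ∂(D j) ≤ ∫ s, truncatedPay M D j N s ∂(D j) := by
  rw [← integral_neg]
  refine integral_mono_ae (integrable_interimNegPay hM j).neg (integrable_truncatedPay hM hT j N) ?_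
  filter_upwards [hT j] with s hs using neg_interimNegPay_le_truncatedPay hM hN hs

lemma tendsto_truncatedPay (j : Fin m) (s : BidderValuation n) :
    Tendsto (fun N : ℕ => truncatedPay M D j N s) atTop (𝓝 (M.interimPay D j s)) := by
  refine tendsto_const_nhds.congr' ?_
  obtain ⟨N₀, hN₀⟩ := exists_nat_ge (M.interimPay D j s)
  filter_upwards [eventually_ge_atTop N₀] with N hN
  exact (min_eq_left (hN₀.trans (by exact_mod_cast hN))).symm

/-- If the payment of a bidder has infinite expectation, then the truncated expectations diverge. -/
lemma tendsto_integral_truncatedPay_atTop (hM : M.IsWellPosed D T)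
    (hT : ∀ j, ∀ᵐ v ∂(D j), v ∈ T j) (j : Fin m)
    (h : ¬Integrable (fun v => M.pay v j) (Measure.pi D)) :
    Tendsto (fun N : ℕ => ∫ s, truncatedPay M D j N s ∂(D j)) atTop atTop := by
  have hng := integrable_interimNegPay hM j
  have htop : ∫⁻ v, ENNReal.ofReal (M.pay v j) ∂(Measure.pi D) = ⊤ := by
    by_contra hne
    refine h ⟨(hM.measurable_pay j).aestronglyMeasurable, ?_⟩
    have m1 : Measurable fun v : Profile m n => ENNReal.ofReal (-M.pay v j) :=
      (hM.measurable_pay j).neg.ennreal_ofReal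
    refine (lintegral_mono (g := fun v => ENNReal.ofReal (M.pay v j)
      + ENNReal.ofReal (-M.pay v j)) fun v => ?_).trans_lt ?_
    · rw [Real.enorm_eq_ofReal_abs]
      rcases abs_cases (M.pay v j) with ⟨h', -⟩ | ⟨h', -⟩ <;> rw [h']
      · exact le_self_add
      · exact le_add_self
    · rw [lintegral_add_right _ m1]
      exact ENNReal.add_lt_top.2 ⟨lt_top_iff_ne_top.2 hne, hM.lintegral_neg_pay j⟩
  rw [← lintegral_interimPay_add_interimNegPay hM hT j] at htop
  have hi := fun N : ℕ => integrable_truncatedPay hM hT j N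
  have hlim := lintegral_tendsto_of_tendsto_of_monotone (μ := D j)
    (f := fun (N : ℕ) s => ENNReal.ofReal (truncatedPay M D j N s + M.interimNegPay D j s))
    (F := fun s => ENNReal.ofReal (M.interimPay D j s + M.interimNegPay D j s))
    (fun N => ((hi N).add hng).aestronglyMeasurable.aemeasurable.ennreal_ofReal)
    (.of_forall fun s N N' hN => ENNReal.ofReal_le_ofReal (add_le_add
      (min_le_min le_rfl (by exact_mod_cast hN)) le_rfl))
    (.of_forall fun s => ENNReal.tendsto_ofReal ((tendsto_truncatedPay j s).add_const _))
  rw [htop] at hlim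
  refine tendsto_atTop.2 fun K => ?_
  filter_upwards [hlim.eventually (lt_mem_nhds (ENNReal.ofReal_lt_top
    (r := K + ∫ s, M.interimNegPay D j s ∂(D j))))] with N hN
  have hpos : 0 ≤ᵐ[D j] fun s => truncatedPay M D j N s + M.interimNegPay D j s := by
    filter_upwards [hT j] with s hs
    have := neg_interimNegPay_le_truncatedPay hM (Nat.cast_nonneg N) hs
    simp only [Pi.zero_apply]
    linarith
  have hsum : Integrable (fun s => truncatedPay M D j N s + M.interimNegPay D j s) (D j) :=
    (hi N).add hng
  rw [← ofReal_integral_eq_lintegral_ofReal hsum hpos] at hN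
  have h1 := (ENNReal.ofReal_lt_ofReal_iff'.1 hN).1
  rw [integral_add (hi N) hng] at h1
  linarith

/-- Truncated interim prices yield every amount below the revenue, which may be infinite. -/
lemma exists_lt_sum_integral_truncatedPay (hM : M.IsWellPosed D T)
    (hT : ∀ j, ∀ᵐ v ∂(D j), v ∈ T j) {c : ℝ} (hc : (c : EReal) < M.revenue D) :
    ∃ N : ℕ, c < ∑ j, ∫ s, truncatedPay M D j N s ∂(D j) := by
  by_cases hI : ∀ j, Integrable (fun v => M.pay v j) (Measure.pi D)
  · rw [revenue_eq_sum hI, EReal.coe_lt_coe_iff] at hc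
    have hlim : Tendsto (fun N : ℕ => ∑ j, ∫ s, truncatedPay M D j N s ∂(D j)) atTop
        (𝓝 (∑ j, ∫ v, M.pay v j ∂(Measure.pi D))) := by
      refine tendsto_finsetSum _ fun j _ => ?_
      rw [← integral_interimPay (hI j)]
      refine tendsto_integral_of_dominated_convergence (fun s => ‖M.interimPay D j s‖)
        (fun N => (integrable_truncatedPay hM hT j N).aestronglyMeasurable)
        (integrable_interimPay (hI j)).norm (fun N => .of_forall fun s => ?_)
        (.of_forall fun s => tendsto_truncatedPay j s)
      have hN : (0 : ℝ) ≤ N := Nat.cast_nonneg N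
      rw [Real.norm_eq_abs, Real.norm_eq_abs, truncatedPay]
      rcases min_cases (M.interimPay D j s) (N : ℝ) with ⟨h, -⟩ | ⟨h, h'⟩ <;> rw [h]
      rw [abs_of_nonneg hN, abs_of_nonneg (hN.trans h'.le)]
      exact h'.le
    exact (hlim.eventually (lt_mem_nhds hc)).exists
  · push Not at hI
    obtain ⟨i, hi⟩ := hI
    have hlim := tendsto_integral_truncatedPay_atTop hM hT i hi
    obtain ⟨N, hN⟩ := (hlim.eventually_gt_atTop
      (c + ∑ j ∈ Finset.univ.erase i, ∫ s, M.interimNegPay D j s ∂(D j))).exists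
    refine ⟨N, ?_⟩
    rw [← Finset.add_sum_erase _ _ (Finset.mem_univ i)]
    have h1 : ∑ j ∈ Finset.univ.erase i, -∫ s, M.interimNegPay D j s ∂(D j)
        ≤ ∑ j ∈ Finset.univ.erase i, ∫ s, truncatedPay M D j N s ∂(D j) :=
      Finset.sum_le_sum fun j _ =>
        neg_integral_le_integral_truncatedPay hM hT j (Nat.cast_nonneg N)
    rw [Finset.sum_neg_distrib] at h1
    linarith

end Truncation

/-! ### The limit of large matching markets -/

section Limit

open Mechanism Filter Topology

variable {m n : ℕ} {M : Mechanism m n} {D Dp : Fin m → Measure (BidderValuation n)}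
  [∀ j, IsProbabilityMeasure (D j)] [∀ j, IsProbabilityMeasure (Dp j)]
  {T : Fin m → Set (BidderValuation n)} {ε : ℝ}

/-- The revenue bound with an amount below the revenue of `M` in place of that revenue: the truncation
level and the grid are fixed first, and the sampling errors vanish as the market grows. -/
lemma le_liminf_revenue_replicaSurrogate (hM : M.IsWellPosed D T)
    (hT : ∀ j, ∀ᵐ v ∂(D j), v ∈ T j) (hBIC : M.IsBIC D T) (hIR : M.IsIR D T) (hε0 : 0 < ε)
    (hε1 : ε < 1) {C : Fin m → Measure (BidderValuation n × BidderValuation n)}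
    (hC : ∀ j, IsDominatingCoupling (C j) (Dp j) (D j))
    (hV : expectedWelfare (fun j => differenceLaw (C j)) ≠ ⊤) {c : ℝ}
    (hc : (c : EReal) < M.revenue D) :
    (((1 - ε) * (c - (expectedWelfare (fun j => differenceLaw (C j))).toReal / ε) : ℝ) : EReal)
      ≤ liminf (fun k : ℕ => (replicaSurrogate M D Dp ε k).revenue Dp) atTop := by
  obtain ⟨N, hN⟩ := exists_lt_sum_integral_truncatedPay hM hT hc
  -- The gap is split evenly among the bidders, with `m + 1` shares as there may be none. Each of the
  -- three errors of a bidder (rare cells, mesh of the grid, sampling) will be at most `e / 4`.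
  set e : ℝ := (∑ j, ∫ s, truncatedPay M D j N s ∂(D j) - c) / (m + 1) with he
  have he0 : 0 < e := div_pos (by linarith) (by positivity)
  have hNη : (0 : ℝ) < e / (4 * (N + 1)) := by positivity
  choose F hF using fun j => exists_finset_cells (D j) (ε * e / 8) hNη
  have hlim : ∀ j, Tendsto (fun k : ℕ => (N : ℝ) * (2 * (F j).card / √(k + 1 : ℕ))) atTop (𝓝 0) :=
    fun j => by
      have h1 : Tendsto (fun k : ℕ => √((k + 1 : ℕ) : ℝ)) atTop atTop :=
        Real.tendsto_sqrt_atTop.comp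
          (tendsto_natCast_atTop_atTop.comp (tendsto_add_atTop_nat 1))
      simpa using (h1.const_div_atTop (2 * ((F j).card : ℝ))).const_mul (N : ℝ)
  have hev : ∀ᶠ k : ℕ in atTop, ∀ j, (N : ℝ) * (2 * (F j).card / √(k + 1 : ℕ)) < e / 4 :=
    eventually_all.2 fun j => (hlim j).eventually (gt_mem_nhds (by positivity))
  refine le_liminf_of_le (by isBoundedDefault) ?_
  filter_upwards [hev] with k hk
  refine le_trans (EReal.coe_le_coe_iff.2 ?_) (le_revenue_replicaSurrogate (Dp := Dp) (k := k) hM hT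
    hBIC hIR hε0 hε1 hC hV (h := ε * e / 8) (N := N) (by positivity) (Nat.cast_nonneg N) F)
  refine mul_le_mul_of_nonneg_left (sub_le_sub_right ?_ _) (by linarith)
  have hterm : ∀ j, ∫ s, truncatedPay M D j N s ∂(D j) - e
      ≤ ∫ s, truncatedPay M D j N s ∂(D j)
        - N * ((D j).real {v | cell (ε * e / 8) v ∉ F j} + 2 * (F j).card / √(k + 1 : ℕ))
        - 2 * (ε * e / 8) / ε := fun j => by
    have h1 : (N : ℝ) * (D j).real {v | cell (ε * e / 8) v ∉ F j} ≤ e / 4 := by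
      have h2 := mul_le_mul_of_nonneg_left (hF j).le (Nat.cast_nonneg (α := ℝ) N)
      refine h2.trans ?_
      rw [mul_div_assoc', div_le_div_iff₀ (by positivity) (by norm_num)]
      nlinarith
    have h3 : 2 * (ε * e / 8) / ε = e / 4 := by field_simp; norm_num
    rw [h3, mul_add]
    linarith [hk j]
  refine le_trans ?_ (Finset.sum_le_sum fun j _ => hterm j)
  rw [Finset.sum_sub_distrib, Finset.sum_const, Finset.card_univ, Fintype.card_fin, nsmul_eq_mul]
  have h4 : e * (m + 1) = ∑ j, ∫ s, truncatedPay M D j N s ∂(D j) - c :=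
    div_mul_cancel₀ _ (by positivity)
  linarith

end Limit

theorem mainTheorem9 {m n : ℕ}
    (D Dp : Fin m → Measure (BidderValuation n))
    [∀ j, IsProbabilityMeasure (D j)] [∀ j, IsProbabilityMeasure (Dp j)]
    (C : Fin m → Measure (BidderValuation n × BidderValuation n))
    (hC : ∀ j, IsDominatingCoupling (C j) (Dp j) (D j))
    (T : Fin m → Set (BidderValuation n)) (hT : ∀ j, ∀ᵐ v ∂(D j), v ∈ T j)
    (M : Mechanism m n)
    (hM : M.IsWellPosed D T) (hBIC : M.IsBIC D T) (hIR : M.IsIR D T)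
    (ε : ℝ) (hε0 : 0 < ε) (hε1 : ε < 1) :
    (∀ k : ℕ,
      (replicaSurrogate M D Dp ε k).IsWellPosed Dp (fun _ => Set.univ) ∧
      (replicaSurrogate M D Dp ε k).IsBIC Dp (fun _ => Set.univ) ∧
      (replicaSurrogate M D Dp ε k).IsIR Dp (fun _ => Set.univ)) ∧
    ((1 - ε : ℝ) : EReal) *
        (M.revenue D - (expectedWelfare (fun j => differenceLaw (C j)) : EReal) / (ε : EReal))
      ≤ Filter.liminf (fun k : ℕ => (replicaSurrogate M D Dp ε k).revenue Dp) Filter.atTop := by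
  refine ⟨fun k => ⟨replicaSurrogate_isWellPosed hM hT hε1.le, replicaSurrogate_isBIC hM hT hε1.le,
    replicaSurrogate_isIR hM hT hε1.le⟩, ?_⟩
  have hε : 0 < 1 - ε := by linarith
  by_cases hV : expectedWelfare (fun j => differenceLaw (C j)) = ⊤
  · rw [hV, EReal.coe_ennreal_top, EReal.top_div_of_pos_ne_top (by exact_mod_cast hε0)
      (EReal.coe_ne_top ε), EReal.sub_top, EReal.coe_mul_bot_of_pos hε]
    exact bot_le
  set V := (expectedWelfare (fun j => differenceLaw (C j))).toReal with hVdef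
  have hVε : (expectedWelfare (fun j => differenceLaw (C j)) : EReal) / (ε : EReal)
      = ((V / ε : ℝ) : EReal) := by
    rw [← EReal.coe_ennreal_toReal hV, EReal.coe_div]
  rw [hVε]
  -- A real `z` below the bound comes from the amount `z / (1 - ε) + V / ε` below the revenue of `M`.
  refine EReal.ge_of_forall_gt_iff_ge.1 fun z hz => ?_
  have hz' : z = (1 - ε) * ((z / (1 - ε) + V / ε) - V / ε) := by field_simp; ring
  have hc : ((z / (1 - ε) + V / ε : ℝ) : EReal) < M.revenue D := by
    by_cases hI : ∀ j, Integrable (fun v => M.pay v j) (Measure.pi D)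
    · rw [Mechanism.revenue_eq_sum hI] at hz ⊢
      rw [← EReal.coe_sub, ← EReal.coe_mul, EReal.coe_lt_coe_iff] at hz
      rw [EReal.coe_lt_coe_iff, ← lt_sub_iff_add_lt, div_lt_iff₀' hε]
      exact hz
    · rw [Mechanism.revenue_eq_top hM hI]
      exact EReal.coe_lt_top _
  rw [hz']
  exact le_liminf_revenue_replicaSurrogate hM hT hBIC hIR hε0 hε1 hC hV hc
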